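/- **Theorem 5.3 (a priori estimate in $\mathbb R^n_+$).** Let $n\ge 1$ and let $m>\mu\ge 0$ be integers. Let $$A(\xi,\lambda)=A_{2m}(\xi)+\lambda A_{2m-1}(\xi)+\dots+\lambda^{2m-2\mu}A_{2\mu}(\xi),$$ where $A_j$ is a homogeneous polynomial of degree $j$ in $\xi=(\xi',\xi_n)\in\mathbb R^n$ with complex coefficients. Assume: (a) $A$ is $N$-elliptic with parameter in $[0,\infty)$: there is $c>0$ with $|A(\xi,\lambda)|\ge c\,|\xi|^{2\mu}(\lambda+|\xi|)^{2m-2\mu}$ for all $\xi\in\mathbb R^n$, $\lambda\ge 0$; (b) $A$ degenerates regularly for $\lambda\to\infty$: the polynomial $Q(\tau)=\tau^{-2\mu}A(0,\tau,1)$ has exactly $m-\mu$ roots with positive imaginary part, counted with multiplicity; (c) if $n\le 2$: for all $\xi'\in\mathbb R^{n-1}\setminus\{0\}$ and $\lambda\ge0$, the polynomial $\tau\mapsto A(\xi',\tau,\lambda)$ has exactly $m$ roots with positive imaginary part, counted with multiplicity. *Notation.* $D_j=-i\,\partial/\partial x_j$, $\mathbb R^n_+=\{x:x_n>0\}$, and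 $F$ is the Fourier transform with kernel $(2\pi)^{-n/2}e^{-ix\cdot\xi}$. For a weight $\sigma>0$, $H^\sigma(\mathbb R^n)$ is the space of tempered distributions $u$ such that $\|u\|_{\sigma,\mathbb R^n}=\big(\int\sigma^2|Fu|^2\,d\xi\big)^{1/2}<\infty$, and $H^\sigma(\mathbb R^n_+)$ consists of the restrictions of its elements to $\mathbb R^n_+$. For an integer $0\le l\le m$ let $$\Xi^{(-l)}(\xi,\lambda)=\sum |\xi|^i\lambda^k,\qquad i,k\in\mathbb Z_{\ge0},\ k\le m-\mu,\ i+k\le m-l,$$ and $\Xi=\Xi^{(0)}$; thus, for $\lambda\ge\lambda_0>0$, $\Xi\approx(1+|\xi|)^\mu(\lambda+|\xi|)^{m-\mu}$. For $1\le j\le m$ let $\Xi^{(-j+\frac12)}(\xi',\lambda)=(1+|\xi'|)^{\mu-j+\frac12}(\lambda+|\xi'|)^{m-\mu}$ if $j\le\mu$, and $(\lambda+|\xi'|)^{m-j+\frac12}$ if $j>\mu$. On the half-space, $$\|u\|_{\Xi,\mathbb R^n_+}=\Big(\sum_{l=0}^m\int_0^\infty\|(D_n^lu)(\cdot,x_n)\|^2_{\Xi^{(-l)},\mathbb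 R^{n-1}}\,dx_n\Big)^{1/2},$$ $$\|f\|_{\frac1\Xi,\mathbb R^n_+}=\inf\{\|g\|_{\frac1\Xi,\mathbb R^n}: g\in H^{\frac1\Xi}(\mathbb R^n),\ g=f\text{ on }\mathbb R^n_+\},$$ and $\|D_n^{j-1}u\|_{\Xi^{(-j+\frac12)},\mathbb R^{n-1}}$ is the norm in $H^{\Xi^{(-j+\frac12)}}(\mathbb R^{n-1})$ of the boundary value $D_n^{j-1}u(\cdot,0)$. *Claim.* For every $\lambda_0>0$ there is a constant $C=C(\lambda_0)$ such that for all $\lambda\ge\lambda_0$ and all $u\in H^\Xi(\mathbb R^n_+)$ $$\|u\|_{\Xi,\mathbb R^n_+}\le C\Big(\|A(D,\lambda)u\|_{\frac1\Xi,\mathbb R^n_+}+\sum_{j=1}^m\|D_n^{j-1}u\|_{\Xi^{(-j+\frac12)},\mathbb R^{n-1}}+\lambda^{m-\mu}\|u\|_{L_2(\mathbb R^n_+)}\Big).$$ -/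

import Mathlib

open scoped SchwartzMap FourierTransform ENNReal Topology

noncomputable section

namespace NewtonHalfSpace

open MeasureTheory Filter

/-- `ℝⁿ` with the Euclidean norm. -/
abbrev Rn (n : ℕ) := EuclideanSpace ℝ (Fin n)

/-- The point `(x', t)` of `ℝ^{d+1} = ℝ^d × ℝ`; the last coordinate is the normal one. -/
def glue {d : ℕ} (x' : Rn d) (t : ℝ) : Rn (d + 1) :=
  WithLp.toLp 2 (Fin.snoc (α := fun _ => ℝ) (fun i => x' i) t)

/-- The open half-space `{x : x_n > 0}` of `ℝⁿ`, `n = d + 1`. -/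
def halfSpace (d : ℕ) : Set (Rn (d + 1)) := {x | 0 < x (Fin.last d)}

/-! ### Tempered distributions, weights and norms -/

/-- On the open set `Ω` the tempered distribution `T` is (integration against) the function `f`. -/
def RepresentedOn {n : ℕ} (Ω : Set (Rn n)) (T : 𝓢'(Rn n, ℂ)) (f : Rn n → ℂ) : Prop :=
  ∀ φ : 𝓢(Rn n, ℂ), tsupport φ ⊆ Ω →
    IntegrableOn (fun x => f x * φ x) Ω volume ∧ T φ = ∫ x in Ω, f x * φ x

/-- The norm `(∫ σ(ξ)² |Fu(ξ)|² dξ)^{1/2}` of `H^σ(ℝⁿ)`, with value `∞` if `u` does not belong to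
`H^σ(ℝⁿ)`. Here `F` is the Fourier transform with the kernel `(2π)^{-n/2} exp(-i x·ξ)`. Mathlib's
transform `𝓕` has the kernel `exp(-2π i x·η)`, so that `Fu(ξ) = (2π)^{-n/2} 𝓕u(ξ / 2π)`, and the
substitution `ξ = 2π η` turns the integral above into `∫ σ(2πη)² |𝓕u(η)|² dη`. -/
def sobolevNorm {n : ℕ} (σ : Rn n → ℝ) (u : 𝓢'(Rn n, ℂ)) : ℝ≥0∞ :=
  ⨅ (g : Rn n → ℂ) (_ : RepresentedOn Set.univ (𝓕 u) g),
    eLpNorm (fun η => (σ ((2 * Real.pi) • η) : ℂ) * g η) 2 volume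

/-- `u ∈ H^σ(ℝⁿ)`. -/
def MemSobolevSpace {n : ℕ} (σ : Rn n → ℝ) (u : 𝓢'(Rn n, ℂ)) : Prop :=
  sobolevNorm σ u < ∞

/-- The norm of `H^σ(ℝⁿ)` for a function, regarded as a tempered distribution
(`∞` if the function is not one). -/
def funSobolevNorm {n : ℕ} (σ : Rn n → ℝ) (f : Rn n → ℂ) : ℝ≥0∞ :=
  ⨅ (T : 𝓢'(Rn n, ℂ)) (_ : RepresentedOn Set.univ T f), sobolevNorm σ T

/-- The quotient norm of `H^σ(ℝⁿ₊) = H^σ(ℝⁿ) / H^σ(ℝⁿ)₋` of the restriction of `f` to the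
half-space: the infimum of the norms of all `g` that coincide with `f` on `ℝⁿ₊`, that is, for which
`g - f` is supported in the closed lower half-space. -/
def quotientNorm {d : ℕ} (σ : Rn (d + 1) → ℝ) (f : 𝓢'(Rn (d + 1), ℂ)) : ℝ≥0∞ :=
  ⨅ (g : 𝓢'(Rn (d + 1), ℂ)) (_ : Distribution.IsVanishingOn (g - f) (halfSpace d)),
    sobolevNorm σ g

/-- The norm of `L₂(ℝⁿ₊)` of the restriction of `u` to the half-space. -/
def halfSpaceL2Norm {d : ℕ} (u : 𝓢'(Rn (d + 1), ℂ)) : ℝ≥0∞ :=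
  ⨅ (f : Rn (d + 1) → ℂ) (_ : RepresentedOn (halfSpace d) u f),
    eLpNorm f 2 (volume.restrict (halfSpace d))

/-! ### Differential operators -/

/-- `D_i = -i ∂/∂x_i` on tempered distributions. -/
def D {n : ℕ} (i : Fin n) : Module.End ℂ 𝓢'(Rn n, ℂ) :=
  (-Complex.I) •
    (LineDeriv.lineDerivOpCLM ℂ 𝓢'(Rn n, ℂ) (EuclideanSpace.single i (1 : ℝ))).toLinearMap

/-- `D^α = D_1^{α_1} ⋯ D_n^{α_n}`. -/
def Dpow {n : ℕ} (α : Fin n →₀ ℕ) : Module.End ℂ 𝓢'(Rn n, ℂ) :=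
  ((List.finRange n).map fun i => D i ^ α i).prod

/-- `p(D)` for a polynomial `p` in `n` variables. -/
def diffOp {n : ℕ} (p : MvPolynomial (Fin n) ℂ) (u : 𝓢'(Rn n, ℂ)) : 𝓢'(Rn n, ℂ) :=
  ∑ α ∈ p.support, p.coeff α • Dpow α u

/-- The operator `A(D, lam) = A_{2m}(D) + lam A_{2m-1}(D) + ⋯ + lam^{2m-2μ} A_{2μ}(D)`. -/
def pencil {n : ℕ} (m μ : ℕ) (A : ℕ → MvPolynomial (Fin n) ℂ) (lam : ℝ)
    (u : 𝓢'(Rn n, ℂ)) : 𝓢'(Rn n, ℂ) :=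
  ∑ j ∈ Finset.Icc (2 * μ) (2 * m), ((lam : ℂ) ^ (2 * m - j)) • diffOp (A j) u

/-! ### The symbol -/

/-- `A(ξ, lam) = A_{2m}(ξ) + lam A_{2m-1}(ξ) + ⋯ + lam^{2m-2μ} A_{2μ}(ξ)`. -/
def symbol {n : ℕ} (m μ : ℕ) (A : ℕ → MvPolynomial (Fin n) ℂ) (ξ : Rn n) (lam : ℝ) : ℂ :=
  ∑ j ∈ Finset.Icc (2 * μ) (2 * m),
    (lam : ℂ) ^ (2 * m - j) * MvPolynomial.eval (fun i => (ξ i : ℂ)) (A j)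

/-- `N`-ellipticity with parameter in `[0, ∞)`. -/
def NElliptic {n : ℕ} (m μ : ℕ) (A : ℕ → MvPolynomial (Fin n) ℂ) : Prop :=
  ∃ C : ℝ, 0 < C ∧ ∀ ξ : Rn n, ∀ lam : ℝ, 0 ≤ lam →
    C * ‖ξ‖ ^ (2 * μ) * (lam + ‖ξ‖) ^ (2 * m - 2 * μ) ≤ ‖symbol m μ A ξ lam‖

/-- `A(ξ', τ, lam)` as a polynomial in `τ`. -/
def symbolPoly {d : ℕ} (m μ : ℕ) (A : ℕ → MvPolynomial (Fin (d + 1)) ℂ) (ξ' : Rn d) (lam : ℝ) :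
    Polynomial ℂ :=
  ∑ j ∈ Finset.Icc (2 * μ) (2 * m),
    Polynomial.C ((lam : ℂ) ^ (2 * m - j)) *
      MvPolynomial.aeval
        (Fin.snoc (α := fun _ => Polynomial ℂ) (fun i => Polynomial.C (ξ' i : ℂ)) Polynomial.X)
        (A j)

/-- The number of roots with positive imaginary part, counted with multiplicity. -/
def upperRoots (p : Polynomial ℂ) : ℕ := p.roots.countP fun z => 0 < z.im

/-- The auxiliary polynomial `Q(τ) = τ^{-2μ} A(0, τ, 1)` (the division is exact if each `A_j` is
homogeneous of degree `j`). -/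
def auxPoly {d : ℕ} (m μ : ℕ) (A : ℕ → MvPolynomial (Fin (d + 1)) ℂ) : Polynomial ℂ :=
  symbolPoly m μ A 0 1 /ₘ (Polynomial.X ^ (2 * μ))

/-- Regular degeneration for `lam → ∞`. -/
def DegeneratesRegularly {d : ℕ} (m μ : ℕ) (A : ℕ → MvPolynomial (Fin (d + 1)) ℂ) : Prop :=
  upperRoots (auxPoly m μ A) = m - μ

/-- For all `ξ' ≠ 0` and `lam ≥ 0` exactly `m` roots `τ` of `A(ξ', τ, lam)` have positive
imaginary part. -/
def ProperlyElliptic {d : ℕ} (m μ : ℕ) (A : ℕ → MvPolynomial (Fin (d + 1)) ℂ) : Prop :=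
  ∀ ξ' : Rn d, ξ' ≠ 0 → ∀ lam : ℝ, 0 ≤ lam → upperRoots (symbolPoly m μ A ξ' lam) = m

/-! ### Weights of the Newton polygon

The Newton polygon `N_{m,μ}` has the vertices `(0,0), (0,m-μ), (μ,m-μ), (m,0)`. -/

/-- `Ξ^{(-l)}(ξ, lam)` for an integer shift `l`: the sum of `|ξ|^i lam^k` over all integer points
`(i, k)` of the polygon `{i ≥ 0, 0 ≤ k ≤ m - μ, i + k ≤ m - l}`, which is `N_{m,μ}` shifted to the
left by `l`. For `l = 0` this is the weight `Ξ` itself. -/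
def Xi {n : ℕ} (m μ l : ℕ) (lam : ℝ) (ξ : Rn n) : ℝ :=
  ∑ p ∈ (Finset.range (m + 1) ×ˢ Finset.range (m + 1)).filter
    (fun p => p.2 + μ ≤ m ∧ p.1 + p.2 + l ≤ m), ‖ξ‖ ^ p.1 * lam ^ p.2

/-- `Ξ^{(-r)}(ξ, lam)` for a real shift `0 < r < m`. The shifted polygon has the vertices `(0,0)`,
`(0,m-μ)`, `(μ-r,m-μ)`, `(m-r,0)` if `r ≤ μ`, and `(0,0)`, `(0,m-r)`, `(m-r,0)` if `r ≥ μ`. As it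
need not have integral vertices, the weight is the equivalent product
`(1+|ξ|)^{μ-r} (lam+|ξ|)^{m-μ}`, respectively `(lam+|ξ|)^{m-r}`. -/
def XiReal {n : ℕ} (m μ : ℕ) (r lam : ℝ) (ξ : Rn n) : ℝ :=
  (1 + ‖ξ‖) ^ (max ((μ : ℝ) - r) 0) * (lam + ‖ξ‖) ^ ((m : ℝ) - max (μ : ℝ) r)

/-! ### The half-space norm and the boundary norms -/

/-- The norm `(∑_{l=0}^m ∫_0^∞ ‖(D_n^l u)(·, x_n)‖²_{Ξ^{(-l)}, ℝ^{n-1}} dx_n)^{1/2}` of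
`H^Ξ(ℝⁿ₊)`. Each `D_n^l u` has to be a function on the half-space, else the value is `∞`. -/
def halfSpaceXiNorm {d : ℕ} (m μ : ℕ) (lam : ℝ) (u : 𝓢'(Rn (d + 1), ℂ)) : ℝ≥0∞ :=
  (∑ l ∈ Finset.range (m + 1),
    ⨅ (h : Rn (d + 1) → ℂ) (_ : RepresentedOn (halfSpace d) ((D (Fin.last d) ^ l) u) h),
      ∫⁻ t in Set.Ioi (0 : ℝ),
        funSobolevNorm (Xi m μ l lam) (fun x' : Rn d => h (glue x' t)) ^ 2) ^ (1 / 2 : ℝ)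

/-- `g ∈ L₂(ℝ^{n-1})` is the boundary value `v(·, 0)` of `v` from the half-space: on the half-space
`v` is a function `h` whose slices `h(·, t)` converge to `g` in `L₂(ℝ^{n-1})` as `t → 0+`. -/
def IsTrace {d : ℕ} (v : 𝓢'(Rn (d + 1), ℂ)) (g : Rn d → ℂ) : Prop :=
  MemLp g 2 volume ∧ ∃ h : Rn (d + 1) → ℂ, RepresentedOn (halfSpace d) v h ∧
    Tendsto (fun t : ℝ => eLpNorm (fun x' : Rn d => h (glue x' t) - g x') 2 volume)
      (𝓝[>] 0) (𝓝 0)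

/-- The norm `‖v(·, 0)‖_{σ, ℝ^{n-1}}` of the boundary value of `v`. -/
def traceNorm {d : ℕ} (σ : Rn d → ℝ) (v : 𝓢'(Rn (d + 1), ℂ)) : ℝ≥0∞ :=
  ⨅ (g : Rn d → ℂ) (_ : IsTrace v g), funSobolevNorm σ g

end NewtonHalfSpace

end

/-! After a Fourier transform in the tangential variables the claim becomes a family of estimates on
the half-line, one for each ξ'. It suffices that their constant depends neither on ξ' nor on λ ≥ λ₀
(`exists_halfLine_estimate`); taking L₂ norms over ξ' then gives the theorem. Notation: ξ = (ξ', τ),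
p(τ) = A(ξ', τ, λ), Y = (1+|ξ|)^μ (λ+|ξ|)^(m-μ), which is equivalent to Ξ; V and G are the
transforms in the normal variable t of an extension of u and of an extension of A(D,λ)u. Since G
comes from a distribution that agrees with A(D,λ)u for t > 0, G - pV is the transform of a
distribution carried by t ≤ 0.

The algebraic core is `exists_factorization`: p = a S S' up to an error at most Y (εY + C λ^(m-μ)),
where all zeros of S lie in the lower half-plane, S' has degree m, and |S|, |S'| ≥ cY. For |ξ'| ≥ 1
there is no error: S and S' collect the lower and the upper roots. Ellipticity keeps every root at
distance at least δ|ξ| from τ (`exists_root_separation`), and if |ξ'|/λ is small, regular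
degeneration supplies m-μ roots of modulus comparable with λ or larger on each side
(`exists_countP_large`); this yields the factor (λ+|ξ|)^(m-μ). For |ξ'| ≤ 1 one freezes ξ' = 0,
where p = a τ^(2μ) ∏(τ - λκ) over the roots κ of Q, and replaces τ^(2μ) by (τ²+1)^μ. For large |τ|
the error is relatively small; for bounded |τ| one has Y ≤ K λ^(m-μ), and this is the origin of the
lower-order term (`exists_low_factorization`). The equal number of upper and lower roots is
automatic for n ≥ 3 by a connectedness argument (`properlyElliptic_of_two_le`).

The half-line estimate is of Wiener-Hopf type. Subtract from V a lift W of its boundary values whose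
weighted size is bounded by the boundary norms (`exists_lift`). The remainder has zero Cauchy data
of order < m, so its cut-off at t = 0, with transform Z, still has m square integrable derivatives
(`isFourierPair_indicator_pow`). Now G - pW - pZ is carried by t ≤ 0. Division by S preserves this
because of the position of its zeros, while S'Z is carried by t ≥ 0. With k = (aS)⁻¹(G - pW - pZ),
orthogonality of the supports gives ‖S'Z‖ ≤ ‖S'Z + k‖ (`eLpNorm_prod_mul_le`). In S'Z + k the main
part of pZ cancels; there remain terms in G and W, a small multiple of YZ that is absorbed, and
λ^(m-μ) Z.

The passage between the half-space and the half-lines rests on `IsFourierPair.exists_partial`, on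
`ae_forall_integral_slice_eq_zero` for the equation, and on `IsTrace.ae_eq_integral` for the
boundary values. -/

open scoped SchwartzMap FourierTransform ENNReal Topology

noncomputable section

namespace NewtonHalfSpace

open MeasureTheory Filter

/-! ### Square integrable Fourier pairs: duality, Plancherel, Parseval. -/

section FourierPairs

variable {V : Type*} [NormedAddCommGroup V] [InnerProductSpace ℝ V] [FiniteDimensional ℝ V]
  [MeasurableSpace V] [BorelSpace V]

/-- `F` is the Fourier transform of `f`, both being square integrable. -/
structure IsFourierPair (f F : V → ℂ) : Prop where
  memLp_left : MemLp f 2 volume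
  memLp_right : MemLp F 2 volume
  integral_eq : ∀ φ : 𝓢(V, ℂ), ∫ x, f x * 𝓕 φ x = ∫ x, F x * φ x

theorem Lp_ext_of_integral_schwartz {f g : Lp ℂ 2 (volume : Measure V)}
    (h : ∀ φ : 𝓢(V, ℂ), ∫ x, f x * φ x = ∫ x, g x * φ x) : f = g := by
  have h0 : f - g ∈ (↑(Lp.toTemperedDistributionCLM ℂ (volume : Measure V) 2) :
      Lp ℂ 2 (volume : Measure V) →ₗ[ℂ] 𝓢'(V, ℂ)).ker := by
    rw [LinearMap.mem_ker]
    simp only [ContinuousLinearMap.coe_coe, map_sub, sub_eq_zero]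
    ext φ
    simp only [Lp.toTemperedDistributionCLM_apply, Lp.toTemperedDistribution_apply, smul_eq_mul]
    simpa only [mul_comm] using h φ
  rw [Lp.ker_toTemperedDistributionCLM_eq_bot] at h0
  exact sub_eq_zero.1 h0

/-- Identifies the transform defined by duality with Schwartz functions with the Plancherel
extension on L₂. It allows working with concrete representatives, whose slices make sense, while the
Hilbert space theory stays available. -/
theorem fourier_toLp_eq_iff {f F : V → ℂ} (hf : MemLp f 2 volume) (hF : MemLp F 2 volume) :
    𝓕 hf.toLp = hF.toLp ↔ ∀ φ : 𝓢(V, ℂ), ∫ x, f x * 𝓕 φ x = ∫ x, F x * φ x := by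
  have key : ∀ φ : 𝓢(V, ℂ), ∫ x, (𝓕 hf.toLp : Lp ℂ 2 (volume : Measure V)) x * φ x =
      ∫ x, f x * 𝓕 φ x := by
    intro φ
    have h1 := congrArg (fun T : 𝓢'(V, ℂ) => T φ) (Lp.fourier_toTemperedDistribution_eq hf.toLp)
    simp only [TemperedDistribution.fourier_apply, Lp.toTemperedDistribution_apply,
      smul_eq_mul] at h1
    calc _ = ∫ x, φ x * (𝓕 hf.toLp : Lp ℂ 2 (volume : Measure V)) x := by
          simp only [mul_comm]
      _ = _ := by
          rw [← h1]
          refine integral_congr_ae ?_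
          filter_upwards [hf.coeFn_toLp] with x hx
          rw [hx, mul_comm]
  have key2 : ∀ φ : 𝓢(V, ℂ), ∫ x, (hF.toLp : Lp ℂ 2 (volume : Measure V)) x * φ x =
      ∫ x, F x * φ x := by
    intro φ
    refine integral_congr_ae ?_
    filter_upwards [hF.coeFn_toLp] with x hx
    rw [hx]
  constructor
  · intro h φ
    rw [← key, ← key2, h]
  · intro h
    refine Lp_ext_of_integral_schwartz fun φ => ?_
    rw [key, key2, h]

namespace IsFourierPair

variable {f g F G : V → ℂ}

theorem toLp_eq (h : IsFourierPair f F) : 𝓕 h.memLp_left.toLp = h.memLp_right.toLp :=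
  (fourier_toLp_eq_iff _ _).2 h.integral_eq

theorem of_toLp_eq (hf : MemLp f 2 volume) (hF : MemLp F 2 volume)
    (h : 𝓕 hf.toLp = hF.toLp) : IsFourierPair f F :=
  ⟨hf, hF, (fourier_toLp_eq_iff _ _).1 h⟩

theorem eLpNorm_eq (h : IsFourierPair f F) : eLpNorm F 2 volume = eLpNorm f 2 volume := by
  have h1 := congrArg norm h.toLp_eq
  rw [Lp.norm_fourier_eq, Lp.norm_toLp, Lp.norm_toLp] at h1
  exact ((ENNReal.toReal_eq_toReal_iff' h.memLp_left.eLpNorm_ne_top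
    h.memLp_right.eLpNorm_ne_top).1 h1).symm

theorem exists_right (hf : MemLp f 2 volume) : ∃ F, IsFourierPair f F :=
  ⟨_, of_toLp_eq hf (Lp.memLp (𝓕 hf.toLp)) (by rw [Lp.toLp_coeFn])⟩

theorem exists_left (hF : MemLp F 2 volume) : ∃ f, IsFourierPair f F :=
  ⟨_, of_toLp_eq (Lp.memLp (𝓕⁻ hF.toLp)) hF (by
    rw [Lp.toLp_coeFn, FourierTransform.fourier_fourierInv_eq])⟩

theorem congr (h : IsFourierPair f F) (hfg : f =ᵐ[volume] g) (hFG : F =ᵐ[volume] G) :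
    IsFourierPair g G where
  memLp_left := h.memLp_left.ae_eq hfg
  memLp_right := h.memLp_right.ae_eq hFG
  integral_eq φ := by
    have h1 : (fun x => g x * 𝓕 φ x) =ᵐ[volume] fun x => f x * 𝓕 φ x :=
      hfg.symm.mul (ae_eq_refl _)
    have h2 : (fun x => F x * φ x) =ᵐ[volume] fun x => G x * φ x := hFG.mul (ae_eq_refl _)
    rw [integral_congr_ae h1, h.integral_eq, integral_congr_ae h2]

theorem left_unique (h : IsFourierPair f F) (h' : IsFourierPair g F) : f =ᵐ[volume] g := by
  have := h.toLp_eq.trans h'.toLp_eq.symm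
  have := congrArg (fun k : Lp ℂ 2 (volume : Measure V) => 𝓕⁻ k) this
  simp only [FourierTransform.fourierInv_fourier_eq] at this
  exact (MemLp.toLp_eq_toLp_iff _ _).1 this

theorem add (h : IsFourierPair f F) (h' : IsFourierPair g G) :
    IsFourierPair (fun x => f x + g x) (fun x => F x + G x) := by
  refine of_toLp_eq (h.memLp_left.add h'.memLp_left) (h.memLp_right.add h'.memLp_right) ?_
  change 𝓕 (MemLp.toLp (f + g) _) = MemLp.toLp (F + G) _
  rw [MemLp.toLp_add h.memLp_left h'.memLp_left, MemLp.toLp_add h.memLp_right h'.memLp_right,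
    FourierTransform.fourier_add, h.toLp_eq, h'.toLp_eq]

theorem const_mul (h : IsFourierPair f F) (c : ℂ) :
    IsFourierPair (fun x => c * f x) (fun x => c * F x) := by
  refine of_toLp_eq (h.memLp_left.const_smul c) (h.memLp_right.const_smul c) ?_
  change 𝓕 (MemLp.toLp (c • f) _) = MemLp.toLp (c • F) _
  rw [MemLp.toLp_const_smul c h.memLp_left, MemLp.toLp_const_smul c h.memLp_right,
    FourierTransform.fourier_smul, h.toLp_eq]

theorem sub (h : IsFourierPair f F) (h' : IsFourierPair g G) :
    IsFourierPair (fun x => f x - g x) (fun x => F x - G x) := by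
  have := h.add (h'.const_mul (-1))
  simpa only [neg_mul, one_mul, ← sub_eq_add_neg] using this

theorem of_tendsto {fs Fs : ℕ → V → ℂ} (h : ∀ k, IsFourierPair (fs k) (Fs k))
    (hf : MemLp f 2 volume) (hF : MemLp F 2 volume)
    (hfs : Tendsto (fun k => eLpNorm (fs k - f) 2 volume) atTop (𝓝 0))
    (hFs : Tendsto (fun k => eLpNorm (Fs k - F) 2 volume) atTop (𝓝 0)) : IsFourierPair f F := by
  refine of_toLp_eq hf hF ?_
  have h1 := (Lp.tendsto_Lp_iff_tendsto_eLpNorm'' fs (fun k => (h k).memLp_left) f hf).2 hfs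
  have h2 := (Lp.tendsto_Lp_iff_tendsto_eLpNorm'' Fs (fun k => (h k).memLp_right) F hF).2 hFs
  have h3 := ((FourierTransform.continuous_fourier (E := Lp ℂ 2 (volume : Measure V))).tendsto
    hf.toLp).comp h1
  refine tendsto_nhds_unique h3 (h2.congr fun k => ?_)
  exact (h k).toLp_eq.symm

theorem schwartz (φ : 𝓢(V, ℂ)) : IsFourierPair φ (𝓕 φ : 𝓢(V, ℂ)) where
  memLp_left := φ.memLp 2 volume
  memLp_right := (𝓕 φ).memLp 2 volume
  integral_eq ψ := (SchwartzMap.integral_fourier_mul_eq φ ψ).symm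

end IsFourierPair

theorem exists_schwartz_tendsto {f : V → ℂ} (hf : MemLp f 2 volume) :
    ∃ φ : ℕ → 𝓢(V, ℂ), Tendsto (fun k => eLpNorm (⇑(φ k) - f) 2 volume) atTop (𝓝 0) := by
  have h := (SchwartzMap.denseRange_toLpCLM (E := V) (F := ℂ) (p := 2) (μ := volume)
    (by simp)) hf.toLp
  obtain ⟨x, hx, hlim⟩ := mem_closure_iff_seq_limit.1 h
  choose φ hφ using hx
  refine ⟨φ, ?_⟩
  refine (Lp.tendsto_Lp_iff_tendsto_eLpNorm'' (fun k => (φ k : V → ℂ))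
    (fun k => (φ k).memLp 2 volume) f hf).1 (hlim.congr fun k => ?_)
  rw [← hφ k]
  rfl

theorem tendsto_integral_mul {α : Type*} [MeasurableSpace α] {ν : Measure α} {f g : α → ℂ}
    {gs : ℕ → α → ℂ} (hf : MemLp f 2 ν) (hg : MemLp g 2 ν) (hgs : ∀ k, MemLp (gs k) 2 ν)
    (h : Tendsto (fun k => eLpNorm (gs k - g) 2 ν) atTop (𝓝 0)) :
    Tendsto (fun k => ∫ x, f x * gs k x ∂ν) atTop (𝓝 (∫ x, f x * g x ∂ν)) := by
  have h1 := (Lp.tendsto_Lp_iff_tendsto_eLpNorm'' gs hgs g hg).2 h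
  have h2 := ((ContinuousLinearMap.lpPairing ν 2 2 (ContinuousLinearMap.mul ℂ ℂ)
    hf.toLp).continuous.tendsto hg.toLp).comp h1
  have key : ∀ (k : α → ℂ) (hk : MemLp k 2 ν),
      ContinuousLinearMap.lpPairing ν 2 2 (ContinuousLinearMap.mul ℂ ℂ) hf.toLp hk.toLp =
        ∫ x, f x * k x ∂ν := by
    intro k hk
    rw [ContinuousLinearMap.lpPairing_eq_integral]
    refine integral_congr_ae ?_
    filter_upwards [hf.coeFn_toLp, hk.coeFn_toLp] with x h1 h2
    simp [h1, h2]
  rw [key] at h2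
  exact h2.congr fun k => key _ _

/-- Bilinear Parseval formula. -/
theorem IsFourierPair.integral_mul_eq {f F k K : V → ℂ} (h : IsFourierPair f F)
    (h' : IsFourierPair k K) : ∫ x, f x * K x = ∫ x, F x * k x := by
  obtain ⟨φ, hφ⟩ := exists_schwartz_tendsto h'.memLp_left
  have h1 := tendsto_integral_mul h.memLp_right h'.memLp_left (fun n => (φ n).memLp 2 volume) hφ
  have h2 : Tendsto (fun n => eLpNorm (⇑(𝓕 (φ n) : 𝓢(V, ℂ)) - K) 2 volume) atTop (𝓝 0) := by
    refine hφ.congr fun n => ?_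
    exact (((IsFourierPair.schwartz (φ n)).sub h').eLpNorm_eq).symm
  have h3 := tendsto_integral_mul h.memLp_left h'.memLp_right
    (fun n => (𝓕 (φ n)).memLp 2 volume) h2
  exact tendsto_nhds_unique h3 (h1.congr fun n => (h.integral_eq _).symm)

theorem integral_mul_fourier_eq {f : V → ℂ} (hf : Integrable f) (φ : 𝓢(V, ℂ)) :
    ∫ x, f x * 𝓕 φ x = ∫ x, 𝓕 f x * φ x := by
  have := VectorFourier.integral_fourierIntegral_smul_eq_flip (μ := volume) (ν := volume)
    (L := innerₗ V) Real.continuous_fourierChar continuous_inner hf φ.integrable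
  simp only [smul_eq_mul, flip_innerₗ] at this
  exact this.symm

theorem ae_eq_of_integral_schwartz_eq {f g : V → ℂ} (hf : LocallyIntegrable f)
    (hg : LocallyIntegrable g) 
    (h : ∀ φ : 𝓢(V, ℂ), HasCompactSupport φ → ∫ x, f x * φ x = ∫ x, g x * φ x) :
    f =ᵐ[volume] g := by
  have h0 : ∀ᵐ x, f x - g x = 0 := by
    refine ae_eq_zero_of_integral_contDiff_smul_eq_zero (hf.sub hg) fun k hk hkc => ?_
    have hk' : HasCompactSupport fun x => (k x : ℂ) :=
      hkc.comp_left (g := fun r : ℝ => (r : ℂ)) Complex.ofReal_zero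
    have hks : ContDiff ℝ (⊤ : ℕ∞) fun x => (k x : ℂ) := Complex.ofRealCLM.contDiff.comp hk
    have h1 := h (hk'.toSchwartzMap hks) hk'
    have hi : ∀ {f : V → ℂ}, LocallyIntegrable f → Integrable fun x => f x * (k x : ℂ) := by
      intro f hf
      have := hf.integrable_smul_left_of_hasCompactSupport hks.continuous hk'
      simpa only [smul_eq_mul, mul_comm] using this
    have h2 : ∫ x, f x * (k x : ℂ) = ∫ x, g x * (k x : ℂ) := h1
    rw [← sub_eq_zero, ← integral_sub (hi hf) (hi hg)] at h2
    rw [← h2]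
    refine integral_congr_ae (Eventually.of_forall fun x => ?_)
    simp only [Complex.real_smul]
    ring
  filter_upwards [h0] with x hx
  exact sub_eq_zero.1 hx

theorem MemLp.locallyIntegrable_two {f : V → ℂ} (hf : MemLp f 2 volume) :
    LocallyIntegrable f := hf.locallyIntegrable (by norm_num)

theorem continuous_fourier_of_integrable {f : V → ℂ} (hf : Integrable f) : Continuous (𝓕 f) :=
  VectorFourier.fourierIntegral_continuous Real.continuous_fourierChar continuous_inner hf

/-- The L₂ preimage of `𝓕 f` and `f` itself pair equally with every Schwartz function, because each
is tested against `𝓕 (𝓕⁻ φ)`. Square integrability of `f` is thus a conclusion. -/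
theorem IsFourierPair.of_integrable_of_memLp {f : V → ℂ} (hf : Integrable f)
    (hf2 : MemLp (𝓕 f) 2 volume) : IsFourierPair f (𝓕 f) := by
  obtain ⟨g, hg⟩ := IsFourierPair.exists_left hf2
  refine hg.congr (ae_eq_of_integral_schwartz_eq
    (MemLp.locallyIntegrable_two hg.memLp_left) hf.locallyIntegrable fun φ _ => ?_) (ae_eq_refl _)
  have h1 := hg.integral_eq (𝓕⁻ φ)
  have h2 := integral_mul_fourier_eq hf (𝓕⁻ φ)
  rw [FourierTransform.fourier_fourierInv_eq] at h1 h2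
  rw [h1, h2]

theorem IsFourierPair.of_integrable_right {F : V → ℂ} (hF : Integrable F)
    (hF2 : MemLp F 2 volume) : IsFourierPair (𝓕⁻ F) F := by
  obtain ⟨f, hf⟩ := IsFourierPair.exists_left hF2
  have hc : Continuous (𝓕⁻ F) := by
    have : 𝓕⁻ F = fun x => 𝓕 F (-x) := by
      ext x; rw [Real.fourierInv_eq_fourier_neg]
    rw [this]
    exact (continuous_fourier_of_integrable hF).comp continuous_neg
  refine hf.congr (ae_eq_of_integral_schwartz_eq
    (MemLp.locallyIntegrable_two hf.memLp_left) hc.locallyIntegrable fun φ _ => ?_) (ae_eq_refl _)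
  have h1 := hf.integral_eq (𝓕⁻ φ)
  rw [FourierTransform.fourier_fourierInv_eq] at h1
  rw [h1]
  have h2 := integral_mul_fourier_eq hF φ
  calc ∫ x, F x * 𝓕⁻ φ x = ∫ x, F (-x) * 𝓕⁻ φ (-x) :=
        (integral_neg_eq_self (fun x => F x * 𝓕⁻ φ x) volume).symm
    _ = ∫ x, F (-x) * 𝓕 φ x := by
        refine integral_congr_ae (Eventually.of_forall fun x => ?_)
        simp only [SchwartzMap.fourierInv_coe, SchwartzMap.fourier_coe,
          Real.fourierInv_eq_fourier_neg, neg_neg]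
    _ = ∫ x, 𝓕 (fun y => F (-y)) x * φ x := integral_mul_fourier_eq hF.comp_neg φ
    _ = _ := by
        refine integral_congr_ae (Eventually.of_forall fun x => ?_)
        simp only [Real.fourierInv_eq_fourier_comp_neg]

end FourierPairs

/-! ### The splitting ℝ^{d+1} = ℝ^d × ℝ: norms, inner products, measures. -/

section Glue

variable {d : ℕ}

@[simp] theorem glue_last (x : Rn d) (t : ℝ) : glue x t (Fin.last d) = t := by simp [glue]

@[simp] theorem glue_castSucc (x : Rn d) (t : ℝ) (i : Fin d) : glue x t i.castSucc = x i := by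
  simp [glue]

theorem ext_castSucc_last {x y : Rn (d + 1)} (h : ∀ i : Fin d, x i.castSucc = y i.castSucc)
    (h' : x (Fin.last d) = y (Fin.last d)) : x = y := by
  ext i
  induction i using Fin.lastCases with
  | last => exact h'
  | cast i => exact h i

/-- The linear isomorphism `ℝ^d × ℝ ≃ ℝ^{d+1}`. -/
def glueEquiv (d : ℕ) : (Rn d × ℝ) ≃L[ℝ] Rn (d + 1) :=
  LinearEquiv.toContinuousLinearEquiv
    { toFun := fun p => glue p.1 p.2
      invFun := fun y => (WithLp.toLp 2 fun i => y i.castSucc, y (Fin.last d))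
      map_add' := fun p q => by apply ext_castSucc_last <;> simp
      map_smul' := fun c p => by apply ext_castSucc_last <;> simp
      left_inv := fun p => by
        refine Prod.ext ?_ (by simp)
        ext i
        simp
      right_inv := fun y => by apply ext_castSucc_last <;> simp }

theorem glueEquiv_apply (p : Rn d × ℝ) : glueEquiv d p = glue p.1 p.2 := rfl

theorem glue_eq (x : Rn d) (t : ℝ) : glue x t = glue x 0 + glue 0 t := by
  apply ext_castSucc_last <;> simp

theorem glue_sub_left (x y : Rn d) (t : ℝ) : glue x t - glue y t = glue (x - y) 0 := by
  apply ext_castSucc_last <;> simp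

theorem glue_sub_right (x : Rn d) (s t : ℝ) : glue x s - glue x t = glue 0 (s - t) := by
  apply ext_castSucc_last <;> simp

theorem smul_glue (c : ℝ) (x : Rn d) (t : ℝ) : c • glue x t = glue (c • x) (c * t) := by
  apply ext_castSucc_last <;> simp

theorem inner_glue (x y : Rn d) (s t : ℝ) :
    inner ℝ (glue x s) (glue y t) = inner ℝ x y + s * t := by
  simp [PiLp.inner_apply, Fin.sum_univ_castSucc, mul_comm]

theorem norm_glue_sq (x : Rn d) (t : ℝ) : ‖glue x t‖ ^ 2 = ‖x‖ ^ 2 + t ^ 2 := by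
  rw [← real_inner_self_eq_norm_sq, inner_glue, real_inner_self_eq_norm_sq, sq t]

theorem norm_glue (x : Rn d) (t : ℝ) : ‖glue x t‖ = √(‖x‖ ^ 2 + t ^ 2) := by
  rw [← norm_glue_sq, Real.sqrt_sq (norm_nonneg _)]

theorem norm_le_norm_glue (x : Rn d) (t : ℝ) : ‖x‖ ≤ ‖glue x t‖ := by
  rw [norm_glue]
  exact Real.le_sqrt_of_sq_le (by nlinarith [sq_nonneg t])

theorem abs_le_norm_glue (x : Rn d) (t : ℝ) : |t| ≤ ‖glue x t‖ := by
  rw [norm_glue]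
  exact Real.le_sqrt_of_sq_le (by rw [sq_abs]; nlinarith [sq_nonneg ‖x‖])

theorem norm_glue_le (x : Rn d) (t : ℝ) : ‖glue x t‖ ≤ ‖x‖ + |t| := by
  rw [norm_glue]
  refine Real.sqrt_le_iff.2 ⟨by positivity, ?_⟩
  nlinarith [sq_abs t, mul_nonneg (norm_nonneg x) (abs_nonneg t)]

theorem norm_glue_zero_right (x : Rn d) : ‖glue x 0‖ = ‖x‖ := by simp [norm_glue]

theorem norm_glue_zero_left (t : ℝ) : ‖glue (0 : Rn d) t‖ = |t| := by
  simp [norm_glue, Real.sqrt_sq_eq_abs]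

theorem continuous_glue : Continuous fun p : Rn d × ℝ => glue p.1 p.2 := (glueEquiv d).continuous

theorem measurableEmbedding_glue : MeasurableEmbedding fun p : Rn d × ℝ => glue p.1 p.2 :=
  (glueEquiv d).toHomeomorph.measurableEmbedding

theorem measurePreserving_glue : MeasurePreserving (fun p : Rn d × ℝ => glue p.1 p.2)
    (volume.prod volume) volume := by
  have h1 := (volume_preserving_piFinSuccAbove (fun _ : Fin (d + 1) => ℝ) (Fin.last d)).symm
  have h2 : MeasurePreserving (fun p : Rn d × ℝ => ((p.2, p.1.ofLp) : ℝ × (Fin d → ℝ)))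
      (volume.prod volume) (volume.prod volume) :=
    ((MeasurePreserving.id (volume : Measure ℝ)).prod (PiLp.volume_preserving_ofLp (Fin d))).comp
      (Measure.measurePreserving_swap (μ := (volume : Measure (Rn d)))
        (ν := (volume : Measure ℝ)))
  have h3 := (PiLp.volume_preserving_toLp (Fin (d + 1))).comp (h1.comp h2)
  have h4 : (fun p : Rn d × ℝ => glue p.1 p.2) = WithLp.toLp 2 ∘
      ⇑(MeasurableEquiv.piFinSuccAbove (fun _ => ℝ) (Fin.last d)).symm ∘
        fun p => (p.2, p.1.ofLp) := by
    funext p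
    simp [glue, MeasurableEquiv.piFinSuccAbove, Fin.insertNthEquiv]
  rw [h4]
  exact h3

end Glue

/-! ### L₂ norms of slices of functions on a product. -/

section Slices

variable {α β : Type*} [MeasurableSpace α] [MeasurableSpace β] {μ : Measure α} {ν : Measure β}

theorem eLpNorm_two_sq {f : α → ℂ} : eLpNorm f 2 μ ^ 2 = ∫⁻ x, ‖f x‖ₑ ^ 2 ∂μ := by
  have := eLpNorm_nnreal_pow_eq_lintegral (μ := μ) (f := f) (p := 2) (by norm_num)
  simpa using this

variable [SFinite ν]

theorem lintegral_eLpNorm_sq_left {f : α × β → ℂ} (hf : AEStronglyMeasurable f (μ.prod ν)) :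
    ∫⁻ a, eLpNorm (fun b => f (a, b)) 2 ν ^ 2 ∂μ = eLpNorm f 2 (μ.prod ν) ^ 2 := by
  simp only [eLpNorm_two_sq]
  rw [lintegral_prod _ (by fun_prop)]

theorem aemeasurable_eLpNorm_left {f : α × β → ℂ} (hf : AEStronglyMeasurable f (μ.prod ν)) :
    AEMeasurable (fun a => eLpNorm (fun b => f (a, b)) 2 ν ^ 2) μ := by
  simp only [eLpNorm_two_sq]
  exact AEMeasurable.lintegral_prod_right' (f := fun p => ‖f p‖ₑ ^ 2) (by fun_prop)

theorem memLp_slice_left {f : α × β → ℂ} (hf : MemLp f 2 (μ.prod ν)) :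
    ∀ᵐ a ∂μ, MemLp (fun b => f (a, b)) 2 ν := by
  have h1 := lintegral_eLpNorm_sq_left hf.1
  have h2 := ae_lt_top' (aemeasurable_eLpNorm_left hf.1)
    (by rw [h1]; exact ENNReal.pow_ne_top hf.2.ne)
  filter_upwards [h2, hf.1.prodMk_left] with a ha ha'
  exact ⟨ha', by simpa using ha⟩

/-- Geometric decay makes the sum over k of the squared slice norms integrable in a. It is then
finite for almost every a, and its terms tend to 0. This is why subsequences with rate 2^(-k) are
extracted below. -/
theorem tendsto_slice_left {f : ℕ → α × β → ℂ} (hf : ∀ k, AEStronglyMeasurable (f k) (μ.prod ν))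
    (h : ∀ k, eLpNorm (f k) 2 (μ.prod ν) ^ 2 ≤ 2⁻¹ ^ k) :
    ∀ᵐ a ∂μ, Tendsto (fun k => eLpNorm (fun b => f k (a, b)) 2 ν) atTop (𝓝 0) := by
  have h1 : ∫⁻ a, ∑' k, eLpNorm (fun b => f k (a, b)) 2 ν ^ 2 ∂μ < ∞ := by
    rw [lintegral_tsum fun k => aemeasurable_eLpNorm_left (hf k)]
    refine lt_of_le_of_lt (ENNReal.tsum_le_tsum fun k => ?_)
      (b := ∑' k : ℕ, (2⁻¹ : ℝ≥0∞) ^ k) ?_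
    · rw [lintegral_eLpNorm_sq_left (hf k)]
      exact h k
    · rw [ENNReal.tsum_geometric, ENNReal.one_sub_inv_two, inv_inv]
      simp
  have h2 := ae_lt_top' (AEMeasurable.tsum fun k => aemeasurable_eLpNorm_left (hf k)) h1.ne
  filter_upwards [h2] with a ha
  have h3 := ENNReal.tendsto_atTop_zero_of_tsum_ne_top ha.ne
  have h4 := (ENNReal.continuous_rpow_const (y := (1 / 2 : ℝ))).tendsto 0 |>.comp h3
  simp only [one_div, Function.comp_def] at h4
  rw [ENNReal.zero_rpow_of_pos (by norm_num)] at h4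
  refine h4.congr fun k => ?_
  rw [← ENNReal.rpow_natCast, ← ENNReal.rpow_mul]
  norm_num

variable [SFinite μ]

theorem lintegral_eLpNorm_sq_right {f : α × β → ℂ} (hf : AEStronglyMeasurable f (μ.prod ν)) :
    ∫⁻ b, eLpNorm (fun a => f (a, b)) 2 μ ^ 2 ∂ν = eLpNorm f 2 (μ.prod ν) ^ 2 := by
  simp only [eLpNorm_two_sq]
  rw [lintegral_prod_symm _ (by fun_prop)]

theorem MemLp.swap {f : α × β → ℂ} (hf : MemLp f 2 (μ.prod ν)) :
    MemLp (fun p : β × α => f p.swap) 2 (ν.prod μ) :=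
  hf.comp_measurePreserving (Measure.measurePreserving_swap)

theorem memLp_slice_right {f : α × β → ℂ} (hf : MemLp f 2 (μ.prod ν)) :
    ∀ᵐ b ∂ν, MemLp (fun a => f (a, b)) 2 μ :=
  memLp_slice_left (MemLp.swap hf)

theorem tendsto_slice_right {f : ℕ → α × β → ℂ} (hf : ∀ k, AEStronglyMeasurable (f k) (μ.prod ν))
    (h : ∀ k, eLpNorm (f k) 2 (μ.prod ν) ^ 2 ≤ 2⁻¹ ^ k) :
    ∀ᵐ b ∂ν, Tendsto (fun k => eLpNorm (fun a => f k (a, b)) 2 μ) atTop (𝓝 0) := by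
  refine tendsto_slice_left (f := fun k p => f k p.swap) (fun k => ?_) fun k => ?_
  · exact (hf k).comp_measurePreserving Measure.measurePreserving_swap
  · refine le_trans (le_of_eq ?_) (h k)
    congr 1
    exact eLpNorm_comp_measurePreserving (hf k) Measure.measurePreserving_swap

theorem exists_subseq_eLpNorm_le {u : ℕ → ℝ≥0∞} (h : Tendsto u atTop (𝓝 0)) :
    ∀ k : ℕ, ∀ᶠ n in atTop, u n ^ 2 ≤ 2⁻¹ ^ k := by
  intro k
  have h1 : Tendsto (fun n => u n ^ 2) atTop (𝓝 0) := by
    have := ((ENNReal.continuous_pow 2).tendsto 0).comp h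
    simpa [Function.comp_def] using this
  have : (0 : ℝ≥0∞) < 2⁻¹ ^ k := ENNReal.pow_pos (by simp) k
  exact (h1.eventually (gt_mem_nhds this)).mono fun n hn => hn.le

end Slices

/-! ### Partial Fourier transform in the tangential variables. -/

section PartialFourier

variable {d : ℕ}

theorem hasTemperateGrowth_glue_left (t : ℝ) :
    (fun x : Rn d => glue x t).HasTemperateGrowth := by
  have h : (fun x : Rn d => glue x t) =
      ⇑((glueEquiv d : (Rn d × ℝ) →L[ℝ] Rn (d + 1)).comp (ContinuousLinearMap.inl ℝ (Rn d) ℝ)) +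
        fun _ => glue 0 t := by
    ext1 x
    rw [glue_eq]; rfl
  rw [h]
  exact (ContinuousLinearMap.hasTemperateGrowth _).add (.const _)

theorem hasTemperateGrowth_glue_right (x : Rn d) :
    (fun t : ℝ => glue x t).HasTemperateGrowth := by
  have h : (fun t : ℝ => glue x t) =
      ⇑((glueEquiv d : (Rn d × ℝ) →L[ℝ] Rn (d + 1)).comp (ContinuousLinearMap.inr ℝ (Rn d) ℝ)) +
        fun _ => glue x 0 := by
    ext1 t
    exact (glue_eq x t).trans (add_comm _ _)
  rw [h]
  exact (ContinuousLinearMap.hasTemperateGrowth _).add (.const _)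

/-- The restriction of a Schwartz function to a horizontal hyperplane. -/
def sliceLeft (t : ℝ) : 𝓢(Rn (d + 1), ℂ) →L[ℂ] 𝓢(Rn d, ℂ) :=
  SchwartzMap.compCLMOfAntilipschitz ℂ (K := 1) (hasTemperateGrowth_glue_left t)
    (AntilipschitzWith.of_le_mul_dist fun x y => by
      simp [dist_eq_norm, glue_sub_left, norm_glue_zero_right])

/-- The restriction of a Schwartz function to a vertical line. -/
def sliceRight (x : Rn d) : 𝓢(Rn (d + 1), ℂ) →L[ℂ] 𝓢(ℝ, ℂ) :=
  SchwartzMap.compCLMOfAntilipschitz ℂ (K := 1) (hasTemperateGrowth_glue_right x)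
    (AntilipschitzWith.of_le_mul_dist fun s t => by
      simp [dist_eq_norm, glue_sub_right, norm_glue_zero_left])

/-- The Fourier transform with respect to the tangential variables. -/
def partialFourier (φ : 𝓢(Rn (d + 1), ℂ)) (p : Rn d × ℝ) : ℂ := 𝓕 (sliceLeft p.2 φ) p.1

theorem partialFourier_eq (φ : 𝓢(Rn (d + 1), ℂ)) (ξ : Rn d) (t : ℝ) :
    partialFourier φ (ξ, t) = ∫ x, Real.fourierChar (-inner ℝ x ξ) • φ (glue x t) := by
  rw [partialFourier, SchwartzMap.fourier_coe, Real.fourier_eq]; rfl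

theorem partialFourier_sub (φ ψ : 𝓢(Rn (d + 1), ℂ)) :
    partialFourier (φ - ψ) = partialFourier φ - partialFourier ψ := by
  ext p
  simp only [partialFourier, Pi.sub_apply]
  rw [map_sub]
  exact congrArg (fun f : 𝓢(Rn d, ℂ) => f p.1)
    (map_sub (FourierTransform.fourierCLM ℂ 𝓢(Rn d, ℂ)) _ _)

theorem stronglyMeasurable_partialFourier (φ : 𝓢(Rn (d + 1), ℂ)) :
    StronglyMeasurable (partialFourier φ) := by
  have : partialFourier φ = fun p : Rn d × ℝ =>
      ∫ x, Real.fourierChar (-inner ℝ x p.1) • φ (glue x p.2) := by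
    ext p; exact partialFourier_eq φ p.1 p.2
  rw [this]
  refine StronglyMeasurable.integral_prod_right (Continuous.stronglyMeasurable ?_)
  have h1 : Continuous fun q : (Rn d × ℝ) × Rn d => φ (glue q.2 q.1.2) :=
    φ.continuous.comp (continuous_glue.comp (by fun_prop : Continuous fun q : (Rn d × ℝ) × Rn d =>
      (q.2, q.1.2)))
  have h2 : Continuous fun q : (Rn d × ℝ) × Rn d => Real.fourierChar (-inner ℝ q.2 q.1.1) :=
    Real.continuous_fourierChar.comp (by fun_prop)
  exact h2.smul h1

theorem isFourierPair_partialFourier_left (φ : 𝓢(Rn (d + 1), ℂ)) (t : ℝ) :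
    IsFourierPair (fun x => φ (glue x t)) (fun ξ => partialFourier φ (ξ, t)) :=
  IsFourierPair.schwartz (sliceLeft t φ)

/-- Plancherel on each hyperplane t = const, followed by Tonelli. This isometry extends the partial
transform from Schwartz functions to L₂. -/
theorem eLpNorm_partialFourier (φ : 𝓢(Rn (d + 1), ℂ)) :
    eLpNorm (partialFourier φ) 2 (volume.prod volume) = eLpNorm φ 2 volume := by
  have h1 : eLpNorm (fun p : Rn d × ℝ => φ (glue p.1 p.2)) 2 (volume.prod volume) =
      eLpNorm φ 2 volume :=
    eLpNorm_comp_measurePreserving φ.continuous.aestronglyMeasurable measurePreserving_glue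
  rw [← h1]
  have h2 := lintegral_eLpNorm_sq_right (μ := (volume : Measure (Rn d)))
    (ν := (volume : Measure ℝ)) (stronglyMeasurable_partialFourier φ).aestronglyMeasurable
  have h3 := lintegral_eLpNorm_sq_right (μ := (volume : Measure (Rn d)))
    (ν := (volume : Measure ℝ)) (f := fun p : Rn d × ℝ => φ (glue p.1 p.2))
    (φ.continuous.comp continuous_glue).aestronglyMeasurable
  have h4 : ∀ t : ℝ, eLpNorm (fun ξ : Rn d => partialFourier φ (ξ, t)) 2 volume =
      eLpNorm (fun x : Rn d => φ (glue x t)) 2 volume :=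
    fun t => (isFourierPair_partialFourier_left φ t).eLpNorm_eq
  simp only [h4] at h2
  rw [h3] at h2
  exact ((ENNReal.pow_right_strictMono two_ne_zero).injective h2).symm

theorem integrable_comp_glue (φ : 𝓢(Rn (d + 1), ℂ)) :
    Integrable (fun p : Rn d × ℝ => φ (glue p.1 p.2)) (volume.prod volume) :=
  measurePreserving_glue.integrable_comp_of_integrable φ.integrable

theorem integrable_fourierChar_smul (φ : 𝓢(Rn (d + 1), ℂ)) (ξ : Rn d) :
    Integrable (fun p : Rn d × ℝ => Real.fourierChar (-inner ℝ p.1 ξ) • φ (glue p.1 p.2))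
      (volume.prod volume) := by
  refine (integrable_comp_glue φ).mono ?_ (Eventually.of_forall fun p => by simp)
  refine Continuous.aestronglyMeasurable ?_
  exact (Real.continuous_fourierChar.comp (by fun_prop)).smul (φ.continuous.comp continuous_glue)

theorem fourier_partialFourier (φ : 𝓢(Rn (d + 1), ℂ)) (ξ : Rn d) (η : ℝ) :
    𝓕 (fun t => partialFourier φ (ξ, t)) η = 𝓕 φ (glue ξ η) := by
  rw [SchwartzMap.fourier_coe, Real.fourier_eq, Real.fourier_eq]
  rw [← measurePreserving_glue.integral_comp measurableEmbedding_glue]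
  have h : ∀ p : Rn d × ℝ, Real.fourierChar (-inner ℝ (glue p.1 p.2) (glue ξ η)) •
      φ (glue p.1 p.2) = Real.fourierChar (-inner ℝ p.2 η) •
        Real.fourierChar (-inner ℝ p.1 ξ) • φ (glue p.1 p.2) := by
    intro p
    rw [smul_smul, ← AddChar.map_add_eq_mul, inner_glue]
    congr 2
    simp [mul_comm]
  simp only [h]
  rw [integral_prod_symm]
  · refine integral_congr_ae (Eventually.of_forall fun t => ?_)
    simp only [partialFourier_eq]
    exact (integral_smul (Real.fourierChar (-inner ℝ t η) : ℂ) _).symm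
  · refine (integrable_fourierChar_smul φ ξ).mono ?_ (Eventually.of_forall fun p => by simp)
    refine Continuous.aestronglyMeasurable ?_
    exact (Real.continuous_fourierChar.comp (by fun_prop)).smul
      ((Real.continuous_fourierChar.comp (by fun_prop)).smul
        (φ.continuous.comp continuous_glue))

theorem isFourierPair_partialFourier_right (φ : 𝓢(Rn (d + 1), ℂ)) (ξ : Rn d) :
    IsFourierPair (fun t => partialFourier φ (ξ, t)) (fun η => 𝓕 φ (glue ξ η)) := by
  have h1 : Integrable fun t => partialFourier φ (ξ, t) := by
    simp only [partialFourier_eq]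
    exact (integrable_fourierChar_smul φ ξ).integral_prod_right
  have h2 : 𝓕 (fun t => partialFourier φ (ξ, t)) = fun η => 𝓕 φ (glue ξ η) := by
    ext η; exact fourier_partialFourier φ ξ η
  rw [← h2]
  refine IsFourierPair.of_integrable_of_memLp h1 ?_
  rw [h2]
  exact (sliceRight ξ (𝓕 φ)).memLp 2 volume

theorem MemLp.comp_glue {h : Rn (d + 1) → ℂ} (hh : MemLp h 2 volume) :
    MemLp (fun p : Rn d × ℝ => h (glue p.1 p.2)) 2 (volume.prod volume) :=
  hh.comp_measurePreserving measurePreserving_glue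

/-- The partial Fourier transform of a square integrable function. -/
theorem IsFourierPair.exists_partial {h hh : Rn (d + 1) → ℂ} (hp : IsFourierPair h hh) :
    ∃ H : Rn d × ℝ → ℂ, StronglyMeasurable H ∧ MemLp H 2 (volume.prod volume) ∧
      (∀ᵐ t : ℝ, IsFourierPair (fun x => h (glue x t)) (fun ξ => H (ξ, t))) ∧
      (∀ᵐ ξ : Rn d, IsFourierPair (fun t => H (ξ, t)) (fun η => hh (glue ξ η))) := by
  obtain ⟨φ, hφ⟩ := exists_schwartz_tendsto hp.memLp_left
  have hmem : ∀ k, MemLp (partialFourier (φ k)) 2 (volume.prod volume) := fun k =>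
    ⟨(stronglyMeasurable_partialFourier _).aestronglyMeasurable, by
      rw [eLpNorm_partialFourier]; exact ((φ k).memLp 2 volume).2⟩
  -- The partial transform is an isometry on differences, so it carries the Cauchy sequence of
  -- approximants to a Cauchy sequence; its limit is the partial transform of `h`.
  have hdist : ∀ i j, dist ((hmem i).toLp) ((hmem j).toLp) =
      dist (((φ i).memLp 2 volume).toLp) (((φ j).memLp 2 volume).toLp) := by
    intro i j
    rw [Lp.dist_def, Lp.dist_def]
    congr 1
    rw [eLpNorm_congr_ae ((hmem i).coeFn_toLp.sub (hmem j).coeFn_toLp), ← partialFourier_sub,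
      eLpNorm_partialFourier,
      eLpNorm_congr_ae (((φ i).memLp 2 volume).coeFn_toLp.sub ((φ j).memLp 2 volume).coeFn_toLp)]
    rfl
  have hcauchy : CauchySeq fun k => (hmem k).toLp := by
    have h1 := ((Lp.tendsto_Lp_iff_tendsto_eLpNorm'' (fun k => (φ k : Rn (d + 1) → ℂ))
      (fun k => (φ k).memLp 2 volume) h hp.memLp_left).2 hφ).cauchySeq
    rw [Metric.cauchySeq_iff] at h1 ⊢
    simpa only [hdist] using h1
  obtain ⟨H, hH⟩ := cauchySeq_tendsto_of_complete hcauchy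
  have hHlim : Tendsto (fun k => eLpNorm (partialFourier (φ k) - ⇑H) 2 (volume.prod volume))
      atTop (𝓝 0) := by
    rw [← Lp.toLp_coeFn H (Lp.memLp H)] at hH
    exact (Lp.tendsto_Lp_iff_tendsto_eLpNorm'' _ hmem H (Lp.memLp H)).1 hH
  have hFlim : Tendsto (fun k => eLpNorm (⇑(𝓕 (φ k) : 𝓢(Rn (d + 1), ℂ)) - hh) 2 volume)
      atTop (𝓝 0) :=
    hφ.congr fun n => (((IsFourierPair.schwartz (φ n)).sub hp).eLpNorm_eq).symm
  -- One subsequence along which the functions, their partial transforms and their full transforms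
  -- all converge with squared error at most 2^(-k). Almost every slice of each then converges, and
  -- Fourier pairs are closed under L₂ limits.
  obtain ⟨s, -, hs⟩ := extraction_forall_of_eventually (fun k =>
    (exists_subseq_eLpNorm_le hφ k).and ((exists_subseq_eLpNorm_le hHlim k).and
      (exists_subseq_eLpNorm_le hFlim k)))
  have hHm := Lp.memLp H
  have hglue : ∀ {f : Rn (d + 1) → ℂ}, MemLp f 2 volume →
      eLpNorm (fun p : Rn d × ℝ => f (glue p.1 p.2)) 2 (volume.prod volume) =
        eLpNorm f 2 volume := fun hf =>
    eLpNorm_comp_measurePreserving hf.1 measurePreserving_glue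
  have hd1 : ∀ k, MemLp (⇑(φ (s k)) - h) 2 volume := fun k =>
    ((φ (s k)).memLp 2 volume).sub hp.memLp_left
  have hd3 : ∀ k, MemLp (⇑(𝓕 (φ (s k)) : 𝓢(Rn (d + 1), ℂ)) - hh) 2 volume := fun k =>
    ((𝓕 (φ (s k))).memLp 2 volume).sub hp.memLp_right
  have hd2 : ∀ k, MemLp (partialFourier (φ (s k)) - ⇑H) 2 (volume.prod volume) := fun k =>
    (hmem _).sub hHm
  refine ⟨H, Lp.stronglyMeasurable H, hHm, ?_, ?_⟩
  · filter_upwards [memLp_slice_right (MemLp.comp_glue hp.memLp_left), memLp_slice_right hHm,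
      tendsto_slice_right (fun k => (MemLp.comp_glue (hd1 k)).1)
        (fun k => by rw [hglue (hd1 k)]; exact (hs k).1),
      tendsto_slice_right (fun k => (hd2 k).1) (fun k => (hs k).2.1)] with t h1 h2 h3 h4
    exact IsFourierPair.of_tendsto
      (fun k => isFourierPair_partialFourier_left (φ (s k)) t) h1 h2 h3 h4
  · filter_upwards [memLp_slice_left (MemLp.comp_glue hp.memLp_right), memLp_slice_left hHm,
      tendsto_slice_left (fun k => (MemLp.comp_glue (hd3 k)).1)
        (fun k => by rw [hglue (hd3 k)]; exact (hs k).2.2),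
      tendsto_slice_left (fun k => (hd2 k).1) (fun k => (hs k).2.1)] with ξ h1 h2 h3 h4
    exact IsFourierPair.of_tendsto
      (fun k => isFourierPair_partialFourier_right (φ (s k)) ξ) h2 h1 h4 h3

end PartialFourier

/-! ### One-dimensional Wiener-Hopf argument and cut-off at the boundary point. -/

section HalfLine

open LineDeriv in
/-- The operator `i ∂_t - ζ` on Schwartz functions of one variable. -/
def shiftedDeriv (ζ : ℂ) (χ : 𝓢(ℝ, ℂ)) : 𝓢(ℝ, ℂ) := Complex.I • ∂_{(1 : ℝ)} χ - ζ • χ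

theorem shiftedDeriv_apply (ζ : ℂ) (χ : 𝓢(ℝ, ℂ)) (t : ℝ) :
    shiftedDeriv ζ χ t = Complex.I * deriv χ t - ζ * χ t := by
  simp [shiftedDeriv, SchwartzMap.lineDerivOp_apply_eq_fderiv]

theorem fourierInv_shiftedDeriv (ζ : ℂ) (χ : 𝓢(ℝ, ℂ)) (η : ℝ) :
    𝓕⁻ (shiftedDeriv ζ χ) η = ((2 * Real.pi * η : ℝ) - ζ) * 𝓕⁻ χ η := by
  have h1 : 𝓕⁻ (shiftedDeriv ζ χ) =
      Complex.I • 𝓕⁻ (LineDeriv.lineDerivOp (1 : ℝ) χ) - ζ • 𝓕⁻ χ := by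
    have := map_sub (FourierTransform.fourierInvCLM ℂ 𝓢(ℝ, ℂ))
      (Complex.I • LineDeriv.lineDerivOp (1 : ℝ) χ) (ζ • χ)
    simpa only [FourierTransform.fourierInvCLM_apply, FourierTransform.fourierInv_smul,
      shiftedDeriv] using this
  have h2 : (fun x : ℝ => inner ℝ x (1 : ℝ)).HasTemperateGrowth := by fun_prop
  rw [h1, SchwartzMap.fourierInv_lineDerivOp_eq]
  simp only [sub_apply, smul_apply, smul_eq_mul,
    SchwartzMap.smulLeftCLM_apply_apply h2, neg_smul, neg_apply]
  simp only [RCLike.inner_apply, conj_trivial, one_mul, Complex.real_smul]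
  push_cast
  linear_combination (-2 * Real.pi * η * 𝓕⁻ χ η) * Complex.I_sq

theorem tsupport_shiftedDeriv_subset (ζ : ℂ) (χ : 𝓢(ℝ, ℂ)) :
    tsupport (shiftedDeriv ζ χ) ⊆ tsupport χ := by
  have h1 : tsupport (⇑(LineDeriv.lineDerivOp (1 : ℝ) χ)) ⊆ tsupport χ :=
    SchwartzMap.tsupport_lineDerivOp_subset 1 χ
  refine closure_minimal (fun t ht => ?_) isClosed_closure
  by_contra h
  apply ht
  have h2 : χ t = 0 := image_eq_zero_of_notMem_tsupport h
  have h3 := image_eq_zero_of_notMem_tsupport (fun h4 => h (h1 h4))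
  simp [shiftedDeriv, h2, h3]

/-- With x = 2πη, write 1/(x - ζ) as the conjugate of x - ζ divided by |x - ζ|², where |x - ζ|² =
(Im ζ)² (1 + ((x - Re ζ)/Im ζ)²). The reciprocal of 1 + |·|² has temperate growth. -/
theorem hasTemperateGrowth_inv_sub {ζ : ℂ} (hζ : ζ.im ≠ 0) :
    (fun η : ℝ => ((2 * Real.pi * η : ℝ) - ζ : ℂ)⁻¹).HasTemperateGrowth := by
  have h1 : (fun η : ℝ => (2 * Real.pi * η - ζ.re) / ζ.im).HasTemperateGrowth := by
    have : (fun η : ℝ => (2 * Real.pi * η - ζ.re) / ζ.im) =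
        fun η : ℝ => (2 * Real.pi / ζ.im) * η + (- ζ.re / ζ.im) := by
      ext η; field_simp; ring
    rw [this]
    exact ((Function.HasTemperateGrowth.const _).mul .id').add (.const _)
  have h2 : (fun η : ℝ => (ζ.im ^ 2)⁻¹ *
      (1 + ‖(2 * Real.pi * η - ζ.re) / ζ.im‖ ^ 2) ^ (-1 : ℝ)).HasTemperateGrowth :=
    (Function.HasTemperateGrowth.const _).mul
      ((Function.hasTemperateGrowth_one_add_norm_sq_rpow ℝ (-1)).comp h1)
  have h3 : (fun η : ℝ => (((2 * Real.pi * η : ℝ) : ℂ) -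
      (starRingEnd ℂ) ζ)).HasTemperateGrowth := by
    refine Function.HasTemperateGrowth.sub ?_ (.const _)
    exact Function.HasTemperateGrowth.comp Function.Complex.hasTemperateGrowth_ofReal
      ((Function.HasTemperateGrowth.const _).mul .id')
  have h4 := (Function.HasTemperateGrowth.comp Function.Complex.hasTemperateGrowth_ofReal h2).mul h3
  refine (congrArg Function.HasTemperateGrowth (funext fun η => ?_)).mpr h4
  have h5 : (ζ.im ^ 2)⁻¹ * (1 + ‖(2 * Real.pi * η - ζ.re) / ζ.im‖ ^ 2) ^ (-1 : ℝ) =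
      (Complex.normSq ((2 * Real.pi * η : ℝ) - ζ))⁻¹ := by
    rw [Real.rpow_neg_one, ← mul_inv, Real.norm_eq_abs, sq_abs, Complex.normSq_apply]
    congr 1
    simp
    field_simp
    ring
  simp only [Pi.mul_apply, Function.comp]
  rw [Complex.inv_def, h5, mul_comm, map_sub (starRingEnd ℂ), Complex.conj_ofReal]

/-- Functions that vanish to the left of some positive number. -/
def VanishesLeft (ψ : ℝ → ℂ) : Prop := ∃ a > 0, ∀ t < a, ψ t = 0

/-- Division by 2πη - ζ means solving (i∂ - ζ)χ = ψ in the Schwartz class. To the left of the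
support of ψ the solution is a multiple of exp(-iζt), which blows up as t → -∞ when Im ζ < 0, so the
multiple is zero. Here the position of the zeros matters. -/
theorem exists_shiftedDeriv_eq {ζ : ℂ} (hζ : ζ.im < 0) {ψ : 𝓢(ℝ, ℂ)} (hψ : VanishesLeft ψ) :
    ∃ χ : 𝓢(ℝ, ℂ), VanishesLeft χ ∧
      ∀ η : ℝ, ((2 * Real.pi * η : ℝ) - ζ) * 𝓕⁻ χ η = 𝓕⁻ ψ η := by
  have hg := hasTemperateGrowth_inv_sub hζ.ne
  set χ : 𝓢(ℝ, ℂ) := 𝓕 (SchwartzMap.smulLeftCLM ℂ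
    (fun η : ℝ => ((2 * Real.pi * η : ℝ) - ζ : ℂ)⁻¹) (𝓕⁻ ψ)) with hχ
  have h1 : ∀ η : ℝ, ((2 * Real.pi * η : ℝ) - ζ) * 𝓕⁻ χ η = 𝓕⁻ ψ η := by
    intro η
    have h0 : ((2 * Real.pi * η : ℝ) - ζ : ℂ) ≠ 0 := by
      intro h
      have := congrArg Complex.im h
      simp at this
      exact hζ.ne this
    rw [hχ, FourierTransform.fourierInv_fourier_eq, SchwartzMap.smulLeftCLM_apply_apply hg,
      smul_eq_mul, mul_inv_cancel_left₀ h0]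
  refine ⟨χ, ?_, h1⟩
  have h2 : shiftedDeriv ζ χ = ψ := by
    have : 𝓕⁻ (shiftedDeriv ζ χ) = 𝓕⁻ ψ := by
      ext η
      rw [fourierInv_shiftedDeriv, h1]
    have := congrArg (fun k : 𝓢(ℝ, ℂ) => 𝓕 k) this
    simpa only [FourierTransform.fourier_fourierInv_eq] using this
  obtain ⟨a, ha, hψa⟩ := hψ
  refine ⟨a, ha, fun t ht => ?_⟩
  -- The integrating factor removes the zeroth-order term, so `E` is constant on s < a. It has
  -- modulus exp(-(Im ζ) s), which tends to 0 at -∞, while χ is bounded; the constant is therefore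
  -- 0.
  set E : ℝ → ℂ := fun s => Complex.exp (Complex.I * ζ * s) * χ s with hE
  have hder : ∀ s : ℝ, HasDerivAt E (Complex.exp (Complex.I * ζ * s) * (-Complex.I * ψ s)) s := by
    intro s
    have e1 : HasDerivAt (fun s : ℝ => Complex.exp (Complex.I * ζ * s))
        (Complex.exp (Complex.I * ζ * s) * (Complex.I * ζ)) s := by
      have := ((Complex.ofRealCLM.hasDerivAt (x := s)).const_mul (Complex.I * ζ)).cexp
      simpa using this
    refine (e1.mul (χ.hasDerivAt s)).congr_deriv ?_
    rw [← h2, shiftedDeriv_apply]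
    linear_combination (Complex.exp (Complex.I * ζ * s) * deriv χ s) * Complex.I_sq
  obtain ⟨c, hc⟩ := isOpen_Iio.exists_is_const_of_deriv_eq_zero (isPreconnected_Iio (a := a))
    (f := E) (fun s _ => (hder s).differentiableAt.differentiableWithinAt) (by
      intro s hs
      rw [(hder s).deriv, hψa s hs]
      simp)
  have hlim : Tendsto E atBot (𝓝 0) := by
    obtain ⟨C, hC⟩ := χ.decay 0 0
    have hC' : ∀ s, ‖χ s‖ ≤ C := by simpa using hC.2
    have e2 : Tendsto (fun s : ℝ => Real.exp (-ζ.im * s) * C) atBot (𝓝 (0 * C)) := by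
      refine Tendsto.mul_const _ (Real.tendsto_exp_atBot.comp ?_)
      exact tendsto_id.const_mul_atBot (neg_pos.2 hζ)
    rw [zero_mul] at e2
    refine squeeze_zero_norm (fun s => ?_) e2
    rw [hE]
    simp only [norm_mul, Complex.norm_exp]
    refine mul_le_mul (le_of_eq ?_) (hC' s) (norm_nonneg _) (Real.exp_nonneg _)
    congr 1
    simp
  have hc0 : c = 0 := by
    refine tendsto_nhds_unique (tendsto_const_nhds.congr' ?_) hlim
    filter_upwards [Iio_mem_atBot a] with s hs
    exact (hc s hs).symm
  have := hc t ht
  rw [hc0, hE] at this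
  simpa [Complex.exp_ne_zero] using this

theorem exists_prod_mul_fourierInv_eq (s : Multiset ℂ) (hs : ∀ ζ ∈ s, ζ.im < 0) {ψ : 𝓢(ℝ, ℂ)}
    (hψ : VanishesLeft ψ) : ∃ χ : 𝓢(ℝ, ℂ), VanishesLeft χ ∧
      ∀ η : ℝ, (s.map fun ζ => ((2 * Real.pi * η : ℝ) - ζ : ℂ)).prod * 𝓕⁻ χ η = 𝓕⁻ ψ η := by
  induction s using Multiset.induction_on with
  | empty => exact ⟨ψ, hψ, by simp⟩
  | cons ζ s ih =>
    obtain ⟨χ, hχ, h⟩ := ih fun z hz => hs z (Multiset.mem_cons_of_mem hz)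
    obtain ⟨χ', hχ', h'⟩ := exists_shiftedDeriv_eq (hs ζ (Multiset.mem_cons_self ζ s)) hχ
    refine ⟨χ', hχ', fun η => ?_⟩
    rw [← h, ← h']
    simp only [Multiset.map_cons, Multiset.prod_cons]
    ring

/-- Multiplication by a polynomial is a differential operator in t, hence local. No condition on the
zeros is needed, in contrast with division. -/
theorem exists_fourierInv_eq_prod_mul (s : Multiset ℂ) (ψ : 𝓢(ℝ, ℂ)) :
    ∃ χ : 𝓢(ℝ, ℂ), tsupport χ ⊆ tsupport ψ ∧
      ∀ η : ℝ, 𝓕⁻ χ η = (s.map fun ζ => ((2 * Real.pi * η : ℝ) - ζ : ℂ)).prod * 𝓕⁻ ψ η := by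
  induction s using Multiset.induction_on with
  | empty => exact ⟨ψ, subset_rfl, by simp⟩
  | cons ζ s ih =>
    obtain ⟨χ, hχ, h⟩ := ih
    refine ⟨shiftedDeriv ζ χ, (tsupport_shiftedDeriv_subset ζ χ).trans hχ, fun η => ?_⟩
    rw [fourierInv_shiftedDeriv, h]
    simp only [Multiset.map_cons, Multiset.prod_cons]
    ring

theorem ae_eq_zero_of_integral_schwartz {V : Type*} [NormedAddCommGroup V] [NormedSpace ℝ V]
    [FiniteDimensional ℝ V] [MeasurableSpace V] [BorelSpace V] {ν : Measure V} {U : Set V}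
    (hU : IsOpen U) {f : V → ℂ} (hf : LocallyIntegrableOn f U ν)
    (h : ∀ φ : 𝓢(V, ℂ), HasCompactSupport φ → tsupport φ ⊆ U → ∫ x, f x * φ x ∂ν = 0) :
    ∀ᵐ x ∂ν, x ∈ U → f x = 0 := by
  refine hU.ae_eq_zero_of_integral_contDiff_smul_eq_zero hf fun k hk hkc hkU => ?_
  have hk' : HasCompactSupport fun x => (k x : ℂ) :=
    hkc.comp_left (g := fun r : ℝ => (r : ℂ)) Complex.ofReal_zero
  have hks : ContDiff ℝ (⊤ : ℕ∞) fun x => (k x : ℂ) := Complex.ofRealCLM.contDiff.comp hk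
  have hsupp : tsupport (fun x => (k x : ℂ)) ⊆ U := by
    refine (closure_mono fun x hx => ?_).trans hkU
    simpa using hx
  rw [← h (hk'.toSchwartzMap hks) hk' hsupp]
  refine integral_congr_ae (Eventually.of_forall fun x => ?_)
  change k x • f x = f x * (k x : ℂ)
  rw [Complex.real_smul, mul_comm]

theorem vanishesLeft_of_tsupport {ψ : 𝓢(ℝ, ℂ)} (h : tsupport ψ ⊆ Set.Ioi 0) : VanishesLeft ψ := by
  have h0 : (0 : ℝ) ∉ tsupport ψ := fun h' => lt_irrefl (0 : ℝ) (h h')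
  obtain ⟨ε, hε, hb⟩ := Metric.isOpen_iff.1 (isClosed_tsupport ψ).isOpen_compl 0 h0
  refine ⟨ε, hε, fun t ht => ?_⟩
  by_cases h1 : 0 < t
  · refine image_eq_zero_of_notMem_tsupport (hb ?_)
    simpa [abs_of_pos h1] using ht
  · exact image_eq_zero_of_notMem_tsupport fun h' => h1 (h h')

/-- Orthogonality of a function supported in the right half-line to a distribution supported in
the left half-line, after the application of the two factors of the operator. -/
theorem eLpNorm_prod_mul_le {z Z k : ℝ → ℂ} (s s' : Multiset ℂ) (hs : ∀ ζ ∈ s, ζ.im < 0)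
    (hz : IsFourierPair z Z) (hz0 : ∀ᵐ t, t < 0 → z t = 0)
    (hZ : MemLp (fun η : ℝ => (s'.map fun ζ => ((2 * Real.pi * η : ℝ) - ζ : ℂ)).prod * Z η) 2)
    (hk : MemLp k 2)
    (hk0 : ∀ ψ : 𝓢(ℝ, ℂ), VanishesLeft ψ →
      ∫ η : ℝ, ((s.map fun ζ => ((2 * Real.pi * η : ℝ) - ζ : ℂ)).prod * k η) * 𝓕⁻ ψ η = 0) :
    eLpNorm (fun η : ℝ => (s'.map fun ζ => ((2 * Real.pi * η : ℝ) - ζ : ℂ)).prod * Z η) 2 volume ≤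
      eLpNorm (fun η : ℝ => (s'.map fun ζ => ((2 * Real.pi * η : ℝ) - ζ : ℂ)).prod * Z η + k η)
        2 volume := by
  obtain ⟨k₁, h₁⟩ := IsFourierPair.exists_left hZ
  obtain ⟨k₂, h₂⟩ := IsFourierPair.exists_left hk
  -- `k₁` arises from `z` by a differential operator, and `z` vanishes for t < 0.
  have e₁ : ∀ᵐ t, t ∈ Set.Iio (0 : ℝ) → k₁ t = 0 := by
    refine ae_eq_zero_of_integral_schwartz isOpen_Iio
      ((MemLp.locallyIntegrable_two h₁.memLp_left).locallyIntegrableOn _) fun ψ _ hψ => ?_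
    obtain ⟨χ, hχ, hχ'⟩ := exists_fourierInv_eq_prod_mul s' ψ
    have e := h₁.integral_eq (𝓕⁻ ψ)
    have e' := hz.integral_eq (𝓕⁻ χ)
    rw [FourierTransform.fourier_fourierInv_eq] at e e'
    rw [e]
    calc _ = ∫ η, Z η * 𝓕⁻ χ η := by
          refine integral_congr_ae (Eventually.of_forall fun η => ?_)
          simp only [hχ']
          ring
      _ = ∫ t, z t * χ t := e'.symm
      _ = 0 := by
          refine integral_eq_zero_of_ae ?_
          filter_upwards [hz0] with t ht
          by_cases h : t < 0
          · simp [ht h]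
          · have : χ t = 0 := image_eq_zero_of_notMem_tsupport fun h' => h (hψ (hχ h'))
            simp [this]
  -- Pairing `k₂` with ψ equals pairing the multiplied transform of the hypothesis `hk0` with χ,
  -- where χ is ψ divided by the factor. Division leaves χ zero up to a positive point, so `hk0`
  -- applies to it.
  have e₂ : ∀ᵐ t, t ∈ Set.Ioi (0 : ℝ) → k₂ t = 0 := by
    refine ae_eq_zero_of_integral_schwartz isOpen_Ioi
      ((MemLp.locallyIntegrable_two h₂.memLp_left).locallyIntegrableOn _) fun ψ _ hψ => ?_
    have hψ' : VanishesLeft ψ := vanishesLeft_of_tsupport hψ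
    obtain ⟨χ, hχ, hχ'⟩ := exists_prod_mul_fourierInv_eq s hs hψ'
    have e := h₂.integral_eq (𝓕⁻ ψ)
    rw [FourierTransform.fourier_fourierInv_eq] at e
    rw [e, ← hk0 χ hχ]
    refine integral_congr_ae (Eventually.of_forall fun η => ?_)
    simp only [← hχ']
    ring
  have h₃ := h₁.add h₂
  rw [h₁.eLpNorm_eq, h₃.eLpNorm_eq]
  -- The two supports meet only in the null set {0}, so `k₁` is the restriction of the sum to t > 0,
  -- and restriction does not increase the norm.
  have h₄ : k₁ =ᵐ[volume] (Set.Ioi (0 : ℝ)).indicator fun t => k₁ t + k₂ t := by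
    have h0 : ∀ᵐ t : ℝ, t ≠ 0 := by simp [ae_iff]
    filter_upwards [e₁, e₂, h0] with t h1 h2 h0
    by_cases h : 0 < t
    · rw [Set.indicator_of_mem (Set.mem_Ioi.2 h), h2 h, add_zero]
    · rw [Set.indicator_of_notMem (by simpa using h)]
      exact h1 (lt_of_le_of_ne (not_lt.1 h) h0)
  rw [eLpNorm_congr_ae h₄]
  exact eLpNorm_indicator_le _

/-- Cauchy-Schwarz: V = (1 + iη)⁻¹ (V + iηV) is a product of two square integrable functions. It
gives a meaning to the boundary value at t = 0 as the integral of V. -/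
theorem integrable_of_memLp_mul {V : ℝ → ℂ} (hV : MemLp V 2)
    (hV' : MemLp (fun η : ℝ => ((2 * Real.pi * η : ℝ) : ℂ) * V η) 2) : Integrable V := by
  have h1 : MemLp (fun η : ℝ => ((1 : ℂ) + Complex.I * η)⁻¹) 2 := by
    have hm : AEStronglyMeasurable (fun η : ℝ => ((1 : ℂ) + Complex.I * η)⁻¹) volume :=
      Measurable.aestronglyMeasurable (by fun_prop)
    rw [memLp_two_iff_integrable_sq_norm hm]
    refine integrable_inv_one_add_sq.congr (Eventually.of_forall fun η => ?_)
    simp only [norm_inv, inv_pow, ← Complex.normSq_eq_norm_sq, Complex.normSq_apply]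
    simp [sq]
  have h2 : MemLp (fun η : ℝ => V η +
      (Complex.I / (2 * Real.pi)) * (((2 * Real.pi * η : ℝ) : ℂ) * V η)) 2 :=
    hV.add (hV'.const_mul _)
  refine (h1.integrable_mul h2).congr (Eventually.of_forall fun η => ?_)
  have h3 : ((1 : ℂ) + Complex.I * η) ≠ 0 := by
    intro h
    have := congrArg Complex.re h
    simp at this
  simp only [Pi.mul_apply]
  have hpi : (Real.pi : ℂ) ≠ 0 := by exact_mod_cast Real.pi_ne_zero
  push_cast
  field_simp

theorem fourierInv_indicator_eq (f : ℝ → ℂ) (η : ℝ) :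
    𝓕⁻ ((Set.Ioi 0).indicator f) η =
      ∫ t in Set.Ioi (0 : ℝ), Complex.exp (((2 * Real.pi * η : ℝ) : ℂ) * Complex.I * t) * f t := by
  rw [Real.fourierInv_eq', ← integral_indicator measurableSet_Ioi]
  refine integral_congr_ae (Eventually.of_forall fun t => ?_)
  by_cases h : t ∈ Set.Ioi (0 : ℝ)
  · simp only [Set.indicator_of_mem h, smul_eq_mul]
    congr 2
    simp
    ring
  · simp [Set.indicator_of_notMem h]

/-- Integration by parts on (0, ∞). The boundary term iψ(0) does not depend on η; against V it
produces the integral of V, that is, the boundary value of v. -/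
theorem mul_fourierInv_indicator (ψ : 𝓢(ℝ, ℂ)) (η : ℝ) :
    ((2 * Real.pi * η : ℝ) : ℂ) * 𝓕⁻ ((Set.Ioi 0).indicator ψ) η =
      Complex.I * 𝓕⁻ ((Set.Ioi 0).indicator (deriv ψ)) η + Complex.I * ψ 0 := by
  rw [fourierInv_indicator_eq, fourierInv_indicator_eq]
  set c : ℂ := ((2 * Real.pi * η : ℝ) : ℂ) with hc
  set E : ℝ → ℂ := fun t => Complex.exp (c * Complex.I * t) with hE
  have hEn : ∀ t, ‖E t‖ = 1 := by
    intro t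
    rw [hE]
    have : c * Complex.I * t = ((2 * Real.pi * η * t : ℝ) : ℂ) * Complex.I := by
      rw [hc]; push_cast; ring
    simp only [this]
    exact Complex.norm_exp_ofReal_mul_I _
  have hEc : Continuous E := by fun_prop
  have hi : ∀ k : 𝓢(ℝ, ℂ), Integrable fun t => E t * k t := by
    intro k
    refine k.integrable.mono (hEc.mul k.continuous).aestronglyMeasurable
      (Eventually.of_forall fun t => by simp [hEn])
  have hi' : Integrable fun t => E t * deriv ψ t := hi (SchwartzMap.derivCLM ℂ ℂ ψ)
  have hder : ∀ t, HasDerivAt (fun t => E t * ψ t)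
      (c * Complex.I * (E t * ψ t) + E t * deriv ψ t) t := by
    intro t
    have e1 : HasDerivAt E (E t * (c * Complex.I)) t := by
      have := ((Complex.ofRealCLM.hasDerivAt (x := t)).const_mul (c * Complex.I)).cexp
      simpa using this
    refine (e1.mul (ψ.hasDerivAt t)).congr_deriv ?_
    ring
  have hlim : Tendsto (fun t => E t * ψ t) atTop (𝓝 0) := by
    have h0 : Tendsto ψ atTop (𝓝 0) := ψ.tendsto_cocompact.mono_left atTop_le_cocompact
    rw [tendsto_zero_iff_norm_tendsto_zero] at h0 ⊢
    simpa [hEn] using h0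
  have h1 := integral_Ioi_of_hasDerivAt_of_tendsto (a := 0) (hder 0).continuousAt.continuousWithinAt
    (fun t _ => hder t) (((hi ψ).const_mul _).add hi').integrableOn hlim
  rw [integral_add ((hi ψ).const_mul _).integrableOn hi'.integrableOn,
    integral_const_mul] at h1
  have hE0 : E 0 = 1 := by simp [hE]
  rw [hE0] at h1
  linear_combination (-Complex.I) * h1 + c * (∫ t in Set.Ioi (0 : ℝ), E t * ψ t) * Complex.I_sq

theorem isFourierPair_indicator_schwartz (ψ : 𝓢(ℝ, ℂ)) :
    IsFourierPair (𝓕⁻ ((Set.Ioi 0).indicator ψ)) ((Set.Ioi 0).indicator ψ) :=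
  IsFourierPair.of_integrable_right (ψ.integrable.indicator measurableSet_Ioi)
    ((ψ.memLp 2 volume).indicator measurableSet_Ioi)

/-- If the boundary value of `v` vanishes, then the extension by zero commutes with `D`. -/
theorem IsFourierPair.indicator_deriv {v v₁ V Z : ℝ → ℂ} (hV : IsFourierPair v V)
    (hv₁ : IsFourierPair v₁ fun η : ℝ => ((2 * Real.pi * η : ℝ) : ℂ) * V η) (h0 : ∫ η, V η = 0)
    (hZ : IsFourierPair ((Set.Ioi 0).indicator v) Z) :
    IsFourierPair ((Set.Ioi 0).indicator v₁) fun η : ℝ => ((2 * Real.pi * η : ℝ) : ℂ) * Z η := by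
  obtain ⟨Z₁, hZ₁⟩ := IsFourierPair.exists_right
    (hv₁.memLp_left.indicator (measurableSet_Ioi (a := (0 : ℝ))))
  have hVi := integrable_of_memLp_mul hV.memLp_right hv₁.memLp_right
  refine hZ₁.congr (ae_eq_refl _) (ae_eq_of_integral_schwartz_eq
    (MemLp.locallyIntegrable_two hZ₁.memLp_right) ?_ fun φ _ => ?_)
  · have h1 := (MemLp.locallyIntegrable_two hZ.memLp_right).locallyIntegrableOn Set.univ
    rw [← locallyIntegrableOn_univ]
    exact h1.continuousOn_mul (by fun_prop) isOpen_univ.isLocallyClosed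
  set ψ : 𝓢(ℝ, ℂ) := 𝓕 φ with hψ
  set χ : 𝓢(ℝ, ℂ) := 𝓕⁻ (shiftedDeriv 0 ψ) with hχ
  have h1 : ∀ η : ℝ, χ η = ((2 * Real.pi * η : ℝ) : ℂ) * φ η := by
    intro η
    rw [hχ, fourierInv_shiftedDeriv, hψ, FourierTransform.fourierInv_fourier_eq, sub_zero]
  have h2 : ∀ t : ℝ, 𝓕 χ t = Complex.I * deriv ψ t := by
    intro t
    rw [hχ, FourierTransform.fourier_fourierInv_eq, shiftedDeriv_apply]
    ring
  have hK := isFourierPair_indicator_schwartz ψ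
  have hK₁ : IsFourierPair (𝓕⁻ ((Set.Ioi 0).indicator (deriv ψ)))
      ((Set.Ioi 0).indicator (deriv ψ)) :=
    isFourierPair_indicator_schwartz (SchwartzMap.derivCLM ℂ ℂ ψ)
  -- Move the cut-off onto the test function, pass to the Fourier side by Parseval and integrate by
  -- parts. The boundary term is iψ(0) times the integral of V, which vanishes by `h0`.
  have e1 : ∫ η, Z₁ η * φ η = Complex.I * ∫ η, V η * 𝓕⁻ ((Set.Ioi 0).indicator (deriv ψ)) η := by
    calc _ = ∫ t, (Set.Ioi 0).indicator v₁ t * ψ t := (hZ₁.integral_eq φ).symm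
      _ = ∫ t, v₁ t * (Set.Ioi 0).indicator ψ t := by
          refine integral_congr_ae (Eventually.of_forall fun t => ?_)
          by_cases h : t ∈ Set.Ioi (0 : ℝ) <;> simp only [Set.indicator_of_mem,
            Set.indicator_of_notMem, h, not_false_eq_true, mul_zero, zero_mul]
      _ = ∫ η, ((2 * Real.pi * η : ℝ) : ℂ) * V η * 𝓕⁻ ((Set.Ioi 0).indicator ψ) η :=
          hv₁.integral_mul_eq hK
      _ = ∫ η, (Complex.I * (V η * 𝓕⁻ ((Set.Ioi 0).indicator (deriv ψ)) η) +
            Complex.I * ψ 0 * V η) := by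
          refine integral_congr_ae (Eventually.of_forall fun η => ?_)
          have := mul_fourierInv_indicator ψ η
          simp only
          linear_combination V η * this
      _ = _ := by
          have hi : Integrable fun η => V η * 𝓕⁻ ((Set.Ioi 0).indicator (deriv ψ)) η :=
            hV.memLp_right.integrable_mul hK₁.memLp_left
          rw [integral_add (hi.const_mul _) (hVi.const_mul _), integral_const_mul, integral_const_mul, h0, mul_zero, add_zero]
  have e2 : ∫ η, ((2 * Real.pi * η : ℝ) : ℂ) * Z η * φ η =
      Complex.I * ∫ η, V η * 𝓕⁻ ((Set.Ioi 0).indicator (deriv ψ)) η := by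
    calc _ = ∫ η, Z η * χ η := by
          refine integral_congr_ae (Eventually.of_forall fun η => ?_)
          simp only [h1]
          ring
      _ = ∫ t, (Set.Ioi 0).indicator v t * 𝓕 χ t := (hZ.integral_eq χ).symm
      _ = ∫ t, Complex.I * (v t * (Set.Ioi 0).indicator (deriv ψ) t) := by
          refine integral_congr_ae (Eventually.of_forall fun t => ?_)
          simp only [h2]
          by_cases h : t ∈ Set.Ioi (0 : ℝ) <;> simp only [Set.indicator_of_mem,
            Set.indicator_of_notMem, h, not_false_eq_true, mul_zero, zero_mul]
          ring
      _ = _ := by rw [integral_const_mul, hV.integral_mul_eq hK₁]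
  rw [e1, e2]

end HalfLine

/-! ### Roots of complex polynomials: semicontinuity of counts, bounds for products. -/

section Roots

open Polynomial

theorem exists_fin_map_eq {α : Type*} {N : ℕ} (s : Multiset α) (h : s.card = N) :
    ∃ v : Fin N → α, (Finset.univ : Finset (Fin N)).val.map v = s := by
  obtain ⟨l, rfl⟩ : ∃ l : List α, (l : Multiset α) = s := ⟨s.toList, s.coe_toList⟩
  have h' : l.length = N := h
  subst h'
  refine ⟨l.get, ?_⟩
  rw [Fin.univ_val_map]
  exact congrArg _ (List.ofFn_get l)

theorem eval_eq_leadingCoeff_mul_prod (p : ℂ[X]) (z : ℂ) :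
    p.eval z = p.leadingCoeff * (p.roots.map fun κ => z - κ).prod := by
  conv_lhs => rw [(IsAlgClosed.splits p).eq_prod_roots]
  rw [eval_mul, eval_C, eval_multiset_prod, Multiset.map_map]
  simp

/-- The number of roots in an open set is lower semicontinuous, as long as the degree and the
leading coefficient do not change. -/
theorem eventually_countP_roots_le {S : Type*} [TopologicalSpace S] {P : S → ℂ[X]} {N : ℕ} {a : ℂ}
    (ha : a ≠ 0) (hN : ∀ x, (P x).natDegree = N) (hlead : ∀ x, (P x).coeff N = a)
    (hc : ∀ k, Continuous fun x => (P x).coeff k) (x₀ : S) (p : ℂ → Prop) [DecidablePred p]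
    (hp : IsOpen {z | p z}) :
    ∀ᶠ x in 𝓝 x₀, (P x₀).roots.countP p ≤ (P x).roots.countP p := by
  by_contra hbad
  rw [not_eventually] at hbad
  -- An ultrafilter concentrated on the bad parameters and converging to x₀ plays the role of a
  -- convergent subsequence; no countability of `S` is available.
  obtain ⟨U, hU⟩ := Ultrafilter.exists_le (f := 𝓝 x₀ ⊓ 𝓟 {x | ¬ (P x₀).roots.countP p ≤
    (P x).roots.countP p}) (h := frequently_mem_iff_neBot.1 hbad)
  have hUx : (U : Filter S) ≤ 𝓝 x₀ := hU.trans inf_le_left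
  have hUb : ∀ᶠ x in (U : Filter S), ¬ (P x₀).roots.countP p ≤ (P x).roots.countP p :=
    le_principal_iff.1 (hU.trans inf_le_right)
  have hlc : ∀ x, (P x).leadingCoeff = a := fun x => by rw [leadingCoeff, hN, hlead]
  have h0 : ∀ x, P x ≠ 0 := fun x h => ha (by rw [← hlead x, h, coeff_zero])
  choose v hv using fun x => exists_fin_map_eq (P x).roots
    ((IsAlgClosed.card_roots_eq_natDegree).trans (hN x))
  have heval : ∀ x z, (P x).eval z = a * ∏ i, (z - v x i) := by
    intro x z
    rw [eval_eq_leadingCoeff_mul_prod, hlc, ← hv x, Multiset.map_map]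
    rfl
  -- Cauchy's bound is locally uniform because the leading coefficient is the fixed number `a`. The
  -- enumerated roots then stay in a compact set and converge along `U`.
  obtain ⟨B, hB⟩ : ∃ B : ℝ, ∀ᶠ x in 𝓝 x₀, ∀ i, ‖v x i‖ ≤ B := by
    have hS : Continuous fun x => ∑ k ∈ Finset.range N, ‖(P x).coeff k‖₊ :=
      continuous_finsetSum _ fun k _ => (hc k).nnnorm
    refine ⟨((∑ k ∈ Finset.range N, ‖(P x₀).coeff k‖₊) + 1) / ‖a‖₊ + 1, ?_⟩
    filter_upwards [hS.continuousAt.eventually_lt_const (lt_add_one _)] with x hx i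
    have hroot : (P x).IsRoot (v x i) := by
      refine isRoot_of_mem_roots ?_
      rw [← hv x]
      exact Multiset.mem_map_of_mem _ (Finset.mem_univ i)
    have h1 := hroot.norm_lt_cauchyBound (h0 x)
    have h2 : cauchyBound (P x) ≤ ((∑ k ∈ Finset.range N, ‖(P x₀).coeff k‖₊) + 1) / ‖a‖₊ + 1 := by
      rw [cauchyBound, hlc, hN]
      gcongr
      refine le_trans (Finset.sup_le fun k hk => ?_) hx.le
      exact Finset.single_le_sum (f := fun k => ‖(P x).coeff k‖₊) (fun _ _ => bot_le) hk
    exact_mod_cast (h1.le.trans h2)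
  obtain ⟨w, -, hw⟩ := (isCompact_closedBall (0 : Fin N → ℂ) (max B 0)).ultrafilter_le_nhds
    (U.map v) (by
      rw [le_principal_iff]
      change ∀ᶠ x in (U : Filter S), v x ∈ Metric.closedBall 0 (max B 0)
      filter_upwards [hUx hB] with x hx
      rw [mem_closedBall_zero_iff, pi_norm_le_iff_of_nonneg (le_max_right _ _)]
      exact fun i => (hx i).trans (le_max_left _ _))
  have hw' : Tendsto v (U : Filter S) (𝓝 w) := hw
  have hwi : ∀ i, Tendsto (fun x => v x i) (U : Filter S) (𝓝 (w i)) := fun i =>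
    ((continuous_apply i).tendsto w).comp hw'
  -- Passing to the limit in the values at each z shows that the limits `w i` are the roots of `P
  -- x₀` with multiplicity. An open condition satisfied by `w i` is eventually satisfied by `v x i`,
  -- contradicting badness.
  have hlim : P x₀ = C a * ∏ i, (X - C (w i)) := by
    refine Polynomial.funext fun z => ?_
    have e1 : Tendsto (fun x => (P x).eval z) (U : Filter S) (𝓝 ((P x₀).eval z)) := by
      have : Continuous fun x => (P x).eval z := by
        have h : (fun x => (P x).eval z) =
            fun x => ∑ k ∈ Finset.range (N + 1), (P x).coeff k * z ^ k := by
          ext x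
          rw [eval_eq_sum_range, hN]
        rw [h]
        exact continuous_finsetSum _ fun k _ => (hc k).mul continuous_const
      exact (this.tendsto x₀).mono_left hUx
    have e2 : Tendsto (fun x => (P x).eval z) (U : Filter S) (𝓝 (a * ∏ i, (z - w i))) := by
      simp only [heval]
      exact (tendsto_finsetProd _ fun i _ => tendsto_const_nhds.sub (hwi i)).const_mul a
    rw [tendsto_nhds_unique e1 e2, eval_mul, eval_C, eval_prod]
    simp
  have hroots : (P x₀).roots = (Finset.univ : Finset (Fin N)).val.map w := by
    rw [hlim, roots_C_mul _ ha]
    have : (∏ i, (X - C (w i)) : ℂ[X]) =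
        (((Finset.univ : Finset (Fin N)).val.map w).map fun z => X - C z).prod := by
      rw [Multiset.map_map]; rfl
    rw [this, roots_multiset_prod_X_sub_C]
  have hev : ∀ᶠ x in (U : Filter S), ∀ i, p (w i) → p (v x i) := by
    rw [eventually_all]
    intro i
    by_cases h : p (w i)
    · filter_upwards [(hwi i).eventually (hp.mem_nhds h)] with x hx _ using hx
    · exact Eventually.of_forall fun x h' => absurd h' h
  obtain ⟨x, hx1, hx2⟩ := (hUb.and hev).exists
  refine hx1 ?_
  rw [hroots, ← hv x, Multiset.countP_map, Multiset.countP_map]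
  refine Multiset.card_le_card (Multiset.monotone_filter_right _ fun i hi => hx2 i hi)

theorem countP_im_pos_add_countP_im_neg {s : Multiset ℂ} (h : ∀ z ∈ s, z.im ≠ 0) :
    s.countP (fun z => 0 < z.im) + s.countP (fun z => z.im < 0) = s.card := by
  induction s using Multiset.induction_on with
  | empty => simp
  | cons z s ih =>
    have h1 := ih fun w hw => h w (Multiset.mem_cons_of_mem hw)
    have h2 := h z (Multiset.mem_cons_self z s)
    rcases lt_or_gt_of_ne h2 with h3 | h3
    · rw [Multiset.countP_cons_of_neg (p := fun z : ℂ => 0 < z.im) _ (not_lt.2 h3.le),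
        Multiset.countP_cons_of_pos (p := fun z : ℂ => z.im < 0) _ h3, Multiset.card_cons, ← h1]
      ring
    · rw [Multiset.countP_cons_of_pos (p := fun z : ℂ => 0 < z.im) _ h3,
        Multiset.countP_cons_of_neg (p := fun z : ℂ => z.im < 0) _ (not_lt.2 h3.le),
        Multiset.card_cons, ← h1]
      ring

/-- Factors satisfying p contribute y and all others x. Since x ≤ y, having more than l good factors
only helps. -/
theorem prod_map_ge_of_countP {s : Multiset ℂ} {f : ℂ → ℝ} {p : ℂ → Prop} [DecidablePred p]
    {c x y : ℝ} {k l : ℕ} (hc : 0 ≤ c) (hx : 0 ≤ x) (hxy : x ≤ y) (h1 : ∀ z ∈ s, c * x ≤ f z)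
    (h2 : ∀ z ∈ s, p z → c * y ≤ f z) (hcard : s.card = k + l) (hp : l ≤ s.countP p) :
    c ^ (k + l) * (x ^ k * y ^ l) ≤ (s.map f).prod := by
  have key : ∀ t : Multiset ℂ, (∀ z ∈ t, c * x ≤ f z) → (∀ z ∈ t, p z → c * y ≤ f z) →
      c ^ t.card * (x ^ (t.card - t.countP p) * y ^ t.countP p) ≤ (t.map f).prod := by
    intro t
    induction t using Multiset.induction_on with
    | empty => simp
    | cons z t ih =>
      intro h1 h2
      have ih' := ih (fun w hw => h1 w (Multiset.mem_cons_of_mem hw))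
        (fun w hw => h2 w (Multiset.mem_cons_of_mem hw))
      have hle : t.countP p ≤ t.card := Multiset.countP_le_card p t
      have hy := hx.trans hxy
      rw [Multiset.map_cons, Multiset.prod_cons, Multiset.card_cons]
      by_cases hz : p z
      · rw [Multiset.countP_cons_of_pos _ hz, Nat.add_sub_add_right]
        calc _ = (c * y) * (c ^ t.card * (x ^ (t.card - t.countP p) * y ^ t.countP p)) := by ring
          _ ≤ f z * (t.map f).prod := by
            have := h2 z (Multiset.mem_cons_self z t) hz
            have h0 : 0 ≤ c * y := by positivity
            gcongr
            exact h0.trans this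
      · rw [Multiset.countP_cons_of_neg _ hz, Nat.sub_add_comm hle]
        calc _ = (c * x) * (c ^ t.card * (x ^ (t.card - t.countP p) * y ^ t.countP p)) := by ring
          _ ≤ f z * (t.map f).prod := by
            have := h1 z (Multiset.mem_cons_self z t)
            have h0 : 0 ≤ c * x := by positivity
            gcongr
            exact h0.trans this
  refine le_trans ?_ (key s h1 h2)
  rw [hcard]
  have hle := Multiset.countP_le_card p s
  rw [hcard] at hle
  -- j counts the good factors beyond the required l; lowering their bound from y to x gives exactly
  -- the exponents k and l.
  obtain ⟨j, hj⟩ := Nat.exists_eq_add_of_le hp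
  have hk : k = (k + l - s.countP p) + j := by omega
  refine mul_le_mul_of_nonneg_left ?_ (pow_nonneg hc _)
  rw [hj, pow_add]
  conv_lhs => rw [hk, pow_add]
  have hj' : k + l - (l + j) = k + l - s.countP p := by rw [hj]
  rw [hj']
  have hy : 0 ≤ y := hx.trans hxy
  calc _ = x ^ (k + l - s.countP p) * (y ^ l * x ^ j) := by ring
    _ ≤ _ := by gcongr

/-- For nonreal z, |t - z| dominates both |Im z| and |t| - |z|, hence a multiple of 1 + |t|. -/
theorem exists_prod_ge {s : Multiset ℂ} (h : ∀ z ∈ s, z.im ≠ 0) :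
    ∃ c > 0, ∀ t : ℝ, c * (1 + |t|) ^ s.card ≤ ‖(s.map fun κ => (t : ℂ) - κ).prod‖ := by
  induction s using Multiset.induction_on with
  | empty => exact ⟨1, one_pos, by simp⟩
  | cons z s ih =>
    obtain ⟨c, hc, h1⟩ := ih fun w hw => h w (Multiset.mem_cons_of_mem hw)
    have hz : 0 < |z.im| := abs_pos.2 (h z (Multiset.mem_cons_self z s))
    have h2 : ∀ t : ℝ, ((1 + ‖z‖) / |z.im| + 1)⁻¹ * (1 + |t|) ≤ ‖(t : ℂ) - z‖ := by
      intro t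
      have e1 : |z.im| ≤ ‖(t : ℂ) - z‖ := by
        have := Complex.abs_im_le_norm ((t : ℂ) - z)
        simpa using this
      have e2 : |t| ≤ ‖(t : ℂ) - z‖ + ‖z‖ := by
        have := norm_add_le ((t : ℂ) - z) z
        simpa using this
      rw [inv_mul_le_iff₀ (by positivity)]
      have e3 : 1 + ‖z‖ ≤ (1 + ‖z‖) / |z.im| * ‖(t : ℂ) - z‖ := by
        rw [div_mul_eq_mul_div, le_div_iff₀ hz]
        gcongr
      linarith
    refine ⟨((1 + ‖z‖) / |z.im| + 1)⁻¹ * c, by positivity, fun t => ?_⟩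
    rw [Multiset.map_cons, Multiset.prod_cons, Multiset.card_cons, norm_mul]
    calc _ = (((1 + ‖z‖) / |z.im| + 1)⁻¹ * (1 + |t|)) * (c * (1 + |t|) ^ s.card) := by ring
      _ ≤ _ := by
        gcongr
        · exact h2 t
        · exact h1 t

theorem exists_prod_le (s : Multiset ℂ) :
    ∃ c > 0, ∀ t : ℝ, ‖(s.map fun κ => (t : ℂ) - κ).prod‖ ≤ c * (1 + |t|) ^ s.card := by
  induction s using Multiset.induction_on with
  | empty => exact ⟨1, one_pos, by simp⟩
  | cons z s ih =>
    obtain ⟨c, hc, h1⟩ := ih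
    refine ⟨(1 + ‖z‖) * c, by positivity, fun t => ?_⟩
    rw [Multiset.map_cons, Multiset.prod_cons, Multiset.card_cons, norm_mul]
    have h2 : ‖(t : ℂ) - z‖ ≤ (1 + ‖z‖) * (1 + |t|) := by
      have := norm_sub_le (t : ℂ) z
      rw [Complex.norm_real, Real.norm_eq_abs] at this
      nlinarith [norm_nonneg z, abs_nonneg t, mul_nonneg (norm_nonneg z) (abs_nonneg t)]
    calc _ ≤ ((1 + ‖z‖) * (1 + |t|)) * (c * (1 + |t|) ^ s.card) := by
          gcongr
          exact h1 t
      _ = _ := by ring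

theorem exists_lt_norm {s : Multiset ℂ} (h : ∀ z ∈ s, z ≠ 0) : ∃ c > 0, ∀ z ∈ s, c < ‖z‖ := by
  induction s using Multiset.induction_on with
  | empty => exact ⟨1, one_pos, by simp⟩
  | cons z s ih =>
    obtain ⟨c, hc, h1⟩ := ih fun w hw => h w (Multiset.mem_cons_of_mem hw)
    have hz : 0 < ‖z‖ := norm_pos_iff.2 (h z (Multiset.mem_cons_self z s))
    refine ⟨min c (‖z‖ / 2), by positivity, fun w hw => ?_⟩
    rcases Multiset.mem_cons.1 hw with rfl | hw
    · exact (min_le_right _ _).trans_lt (by linarith)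
    · exact (min_le_left _ _).trans_lt (h1 w hw)

end Roots

/-! ### Homogeneity and continuity estimates of the symbol at complex vectors. -/

section Symbol

variable {n d m μ : ℕ}

/-- `A(x, lam)` for a complex vector `x`. -/
def complexSymbol (m μ : ℕ) (A : ℕ → MvPolynomial (Fin n) ℂ) (lam : ℝ) (x : Fin n → ℂ) : ℂ :=
  ∑ j ∈ Finset.Icc (2 * μ) (2 * m), (lam : ℂ) ^ (2 * m - j) * MvPolynomial.eval x (A j)

/-- The point `(ξ', z)` with a complex normal component. -/
def complexGlue (ξ : Rn d) (z : ℂ) : Fin (d + 1) → ℂ :=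
  Fin.snoc (α := fun _ => ℂ) (fun i => (ξ i : ℂ)) z

theorem symbol_eq (A : ℕ → MvPolynomial (Fin n) ℂ) (ξ : Rn n) (lam : ℝ) :
    symbol m μ A ξ lam = complexSymbol m μ A lam fun i => (ξ i : ℂ) := rfl

theorem ofReal_glue (ξ : Rn d) (τ : ℝ) :
    (fun i => (glue ξ τ i : ℂ)) = complexGlue ξ (τ : ℂ) := by
  ext i
  induction i using Fin.lastCases with
  | last => simp [complexGlue]
  | cast i => simp [complexGlue]

theorem norm_complexGlue_le {ξ : Rn d} {z : ℂ} {R : ℝ} (h : ‖ξ‖ ≤ R) (hz : ‖z‖ ≤ R) :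
    ‖complexGlue ξ z‖ ≤ R := by
  rw [pi_norm_le_iff_of_nonneg ((norm_nonneg _).trans h)]
  intro i
  induction i using Fin.lastCases with
  | last => simpa [complexGlue] using hz
  | cast i =>
    simp only [complexGlue, Fin.snoc_castSucc, Complex.norm_real]
    exact (PiLp.norm_apply_le ξ i).trans h

theorem complexGlue_sub (ξ ζ : Rn d) (z w : ℂ) :
    complexGlue ξ z - complexGlue ζ w = complexGlue (ξ - ζ) (z - w) := by
  ext i
  induction i using Fin.lastCases with
  | last => simp [complexGlue]
  | cast i => simp [complexGlue]

theorem smul_complexGlue (c : ℝ) (ξ : Rn d) (z : ℂ) :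
    (c : ℂ) • complexGlue ξ z = complexGlue (c • ξ) (c * z) := by
  ext i
  induction i using Fin.lastCases with
  | last => simp [complexGlue]
  | cast i => simp [complexGlue]

theorem eval_smul_of_isHomogeneous {P : MvPolynomial (Fin n) ℂ} {j : ℕ} (hP : P.IsHomogeneous j)
    (c : ℂ) (x : Fin n → ℂ) : MvPolynomial.eval (c • x) P = c ^ j * MvPolynomial.eval x P := by
  rw [MvPolynomial.eval_eq', MvPolynomial.eval_eq', Finset.mul_sum]
  refine Finset.sum_congr rfl fun α hα => ?_
  have h1 : ∑ i, α i = j := by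
    have := hP (MvPolynomial.mem_support_iff.1 hα)
    rw [Finsupp.weight_apply, Finsupp.sum_fintype _ _ (by simp)] at this
    simpa using this
  simp only [Pi.smul_apply, smul_eq_mul, mul_pow, Finset.prod_mul_distrib, Finset.prod_pow_eq_pow_sum,
    h1]
  ring

theorem complexSymbol_smul {A : ℕ → MvPolynomial (Fin n) ℂ}
    (hA : ∀ j ∈ Finset.Icc (2 * μ) (2 * m), (A j).IsHomogeneous j) (c lam : ℝ) (x : Fin n → ℂ) :
    complexSymbol m μ A (c * lam) ((c : ℂ) • x) = c ^ (2 * m) * complexSymbol m μ A lam x := by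
  rw [complexSymbol, complexSymbol, Finset.mul_sum]
  refine Finset.sum_congr rfl fun j hj => ?_
  rw [eval_smul_of_isHomogeneous (hA j hj)]
  have : 2 * m = (2 * m - j) + j := by have := (Finset.mem_Icc.1 hj).2; omega
  conv_rhs => rw [this, pow_add]
  push_cast
  rw [mul_pow, Nat.add_sub_cancel]
  ring

/-- The size `R^{2μ} (lam + R)^{2m-2μ}` of the symbol at `|ξ| = R`. -/
def symbolSize (m μ : ℕ) (R lam : ℝ) : ℝ := R ^ (2 * μ) * (lam + R) ^ (2 * m - 2 * μ)

theorem pow_mul_pow_le_symbolSize {R lam : ℝ} (hR : 0 ≤ R) (hlam : 0 ≤ lam) {j : ℕ}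
    (hj : j ∈ Finset.Icc (2 * μ) (2 * m)) :
    lam ^ (2 * m - j) * R ^ j ≤ symbolSize m μ R lam := by
  obtain ⟨h1, h2⟩ := Finset.mem_Icc.1 hj
  have e1 : j = 2 * μ + (j - 2 * μ) := by omega
  have e2 : 2 * m - 2 * μ = (2 * m - j) + (j - 2 * μ) := by omega
  rw [symbolSize, e2, pow_add (lam + R)]
  conv_lhs => rw [e1, pow_add, Nat.add_sub_cancel' h1]
  calc _ = R ^ (2 * μ) * (lam ^ (2 * m - j) * R ^ (j - 2 * μ)) := by ring
    _ ≤ _ := by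
      gcongr <;> linarith

/-- Reduction to the unit ball that stays valid for R = 0. The explicit formula for y keeps the
dependence on x linear, which is needed for differences. -/
theorem exists_eq_smul {R : ℝ} (x : Fin n → ℂ) (hx : ‖x‖ ≤ R) :
    ∃ y : Fin n → ℂ, ‖y‖ ≤ 1 ∧ x = (R : ℂ) • y ∧ y = (R⁻¹ : ℂ) • x := by
  rcases ((norm_nonneg x).trans hx).eq_or_lt with h | h
  · refine ⟨0, by simp, ?_, ?_⟩
    · rw [smul_zero]
      exact norm_le_zero_iff.1 (h ▸ hx)
    · rw [← h]; simp
  · refine ⟨(R⁻¹ : ℂ) • x, ?_, ?_, rfl⟩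
    · rw [norm_smul, norm_inv, Complex.norm_real, Real.norm_of_nonneg h.le, inv_mul_le_iff₀ h,
        mul_one]
      exact hx
    · rw [smul_smul, mul_inv_cancel₀ (by exact_mod_cast h.ne'), one_smul]

theorem exists_norm_eval_le {P : MvPolynomial (Fin n) ℂ} {j : ℕ} (hP : P.IsHomogeneous j) :
    ∃ C > 0, ∀ (R : ℝ) (x : Fin n → ℂ), ‖x‖ ≤ R → ‖MvPolynomial.eval x P‖ ≤ C * R ^ j := by
  obtain ⟨C, hC⟩ := (isCompact_closedBall (0 : Fin n → ℂ) 1).exists_bound_of_continuousOn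
    (MvPolynomial.continuous_eval P).continuousOn
  refine ⟨max C 1, by positivity, fun R x hx => ?_⟩
  obtain ⟨y, hy, rfl, -⟩ := exists_eq_smul x hx
  have hR := (norm_nonneg _).trans hx
  rw [eval_smul_of_isHomogeneous hP, norm_mul, norm_pow, Complex.norm_real, Real.norm_of_nonneg hR,
    mul_comm]
  gcongr
  exact (hC y (by simpa using hy)).trans (le_max_left _ _)

/-- Uniform continuity on the closed unit ball, scaled by homogeneity. -/
theorem exists_norm_eval_sub_le {P : MvPolynomial (Fin n) ℂ} {j : ℕ} (hP : P.IsHomogeneous j)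
    {ε : ℝ} (hε : 0 < ε) : ∃ δ > 0, ∀ (R : ℝ) (x y : Fin n → ℂ), ‖x‖ ≤ R → ‖y‖ ≤ R →
      ‖x - y‖ ≤ δ * R → ‖MvPolynomial.eval x P - MvPolynomial.eval y P‖ ≤ ε * R ^ j := by
  have huc := (isCompact_closedBall (0 : Fin n → ℂ) 1).uniformContinuousOn_of_continuous
    (MvPolynomial.continuous_eval P).continuousOn
  obtain ⟨δ, hδ, h⟩ := Metric.uniformContinuousOn_iff_le.1 huc ε hε
  refine ⟨δ, hδ, fun R x y hx hy hxy => ?_⟩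
  have hR := (norm_nonneg _).trans hx
  obtain ⟨x', hx', hxx, hx2⟩ := exists_eq_smul x hx
  obtain ⟨y', hy', hyy, hy2⟩ := exists_eq_smul y hy
  have hd : ‖x' - y'‖ ≤ δ := by
    rw [hx2, hy2, ← smul_sub, norm_smul, norm_inv, Complex.norm_real, Real.norm_of_nonneg hR]
    rcases hR.eq_or_lt with h0 | h0
    · rw [← h0]; simpa using hδ.le
    · rw [inv_mul_le_iff₀ h0, mul_comm]
      exact hxy
  have h1 := h x' (by simpa using hx') y' (by simpa using hy') (by rwa [dist_eq_norm])
  rw [dist_eq_norm] at h1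
  rw [hxx, hyy, eval_smul_of_isHomogeneous hP, eval_smul_of_isHomogeneous hP, ← mul_sub, norm_mul,
    norm_pow, Complex.norm_real, Real.norm_of_nonneg hR, mul_comm]
  gcongr

theorem exists_norm_complexSymbol_le {A : ℕ → MvPolynomial (Fin n) ℂ}
    (hA : ∀ j ∈ Finset.Icc (2 * μ) (2 * m), (A j).IsHomogeneous j) :
    ∃ C > 0, ∀ (R lam : ℝ) (x : Fin n → ℂ), 0 ≤ lam → ‖x‖ ≤ R →
      ‖complexSymbol m μ A lam x‖ ≤ C * symbolSize m μ R lam := by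
  choose! C hC h using fun j hj => exists_norm_eval_le (hA j hj)
  refine ⟨∑ j ∈ Finset.Icc (2 * μ) (2 * m), max (C j) 0 + 1, by positivity,
    fun R lam x hlam hx => ?_⟩
  have hR := (norm_nonneg _).trans hx
  have hS : 0 ≤ symbolSize m μ R lam := by unfold symbolSize; positivity
  rw [add_mul, Finset.sum_mul, one_mul]
  refine le_trans (norm_sum_le_of_le _ fun j hj => ?_) (le_add_of_nonneg_right hS)
  rw [norm_mul, norm_pow, Complex.norm_real, Real.norm_of_nonneg hlam]
  calc _ ≤ lam ^ (2 * m - j) * (C j * R ^ j) := by gcongr; exact h j hj R x hx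
    _ = C j * (lam ^ (2 * m - j) * R ^ j) := by ring
    _ ≤ _ := by
      gcongr
      · exact le_max_left _ _
      · exact pow_mul_pow_le_symbolSize hR hlam hj

theorem exists_norm_complexSymbol_sub_le {A : ℕ → MvPolynomial (Fin n) ℂ}
    (hA : ∀ j ∈ Finset.Icc (2 * μ) (2 * m), (A j).IsHomogeneous j) {ε : ℝ} (hε : 0 < ε) :
    ∃ δ > 0, ∀ (R lam : ℝ) (x y : Fin n → ℂ), 0 ≤ lam → ‖x‖ ≤ R → ‖y‖ ≤ R → ‖x - y‖ ≤ δ * R →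
      ‖complexSymbol m μ A lam x - complexSymbol m μ A lam y‖ ≤ ε * symbolSize m μ R lam := by
  -- Number of terms among which ε is shared; the added 1 avoids division by zero.
  set N : ℝ := (Finset.Icc (2 * μ) (2 * m)).card + 1 with hN
  have hN0 : 0 < N := by positivity
  choose! D hD h using fun j hj => exists_norm_eval_sub_le (hA j hj) (div_pos hε hN0)
  obtain ⟨δ, hδ, hδD⟩ : ∃ δ > 0, ∀ j ∈ Finset.Icc (2 * μ) (2 * m), δ ≤ D j := by
    rcases (Finset.Icc (2 * μ) (2 * m)).eq_empty_or_nonempty with he | hne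
    · exact ⟨1, one_pos, by simp [he]⟩
    · obtain ⟨i, hi, hmin⟩ := Finset.exists_min_image _ D hne
      exact ⟨D i, hD i hi, hmin⟩
  refine ⟨δ, hδ, fun R lam x y hlam hx hy hxy => ?_⟩
  have hR := (norm_nonneg _).trans hx
  have hS : 0 ≤ symbolSize m μ R lam := by unfold symbolSize; positivity
  rw [complexSymbol, complexSymbol, ← Finset.sum_sub_distrib]
  refine le_trans (norm_sum_le_of_le _ fun j hj => (?_ : _ ≤ ε / N * symbolSize m μ R lam)) ?_
  · rw [← mul_sub, norm_mul, norm_pow, Complex.norm_real, Real.norm_of_nonneg hlam]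
    calc _ ≤ lam ^ (2 * m - j) * (ε / N * R ^ j) := by
          gcongr
          exact h j hj R x y hx hy (hxy.trans (by gcongr; exact hδD j hj))
      _ = ε / N * (lam ^ (2 * m - j) * R ^ j) := by ring
      _ ≤ _ := by
        gcongr
        exact pow_mul_pow_le_symbolSize hR hlam hj
  · rw [Finset.sum_const, nsmul_eq_mul]
    calc _ = ((Finset.Icc (2 * μ) (2 * m)).card / N) * (ε * symbolSize m μ R lam) := by
          field_simp
      _ ≤ 1 * (ε * symbolSize m μ R lam) := by
          gcongr
          rw [div_le_one hN0, hN]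
          linarith
      _ = _ := one_mul _

end Symbol

/-! ### The symbol as a polynomial in the normal covariable; root counts. -/

section SymbolPolynomial

open Polynomial

variable {d m μ : ℕ} {A : ℕ → MvPolynomial (Fin (d + 1)) ℂ}

theorem aeval_snoc_eq (P : MvPolynomial (Fin (d + 1)) ℂ) (ξ : Rn d) :
    MvPolynomial.aeval (Fin.snoc (α := fun _ => ℂ[X]) (fun i => C (ξ i : ℂ)) X) P =
      ∑ α ∈ P.support, C (P.coeff α * ∏ i : Fin d, (ξ i : ℂ) ^ α i.castSucc) *
        X ^ α (Fin.last d) := by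
  rw [MvPolynomial.aeval_def, MvPolynomial.eval₂_eq']
  refine Finset.sum_congr rfl fun α _ => ?_
  rw [Fin.prod_univ_castSucc]
  simp only [Fin.snoc_castSucc, Fin.snoc_last, algebraMap_eq, C_mul, map_prod, C_pow]
  ring

theorem eval_complexGlue_eq (P : MvPolynomial (Fin (d + 1)) ℂ) (ξ : Rn d) (z : ℂ) :
    MvPolynomial.eval (complexGlue ξ z) P =
      ∑ α ∈ P.support, (P.coeff α * ∏ i : Fin d, (ξ i : ℂ) ^ α i.castSucc) *
        z ^ α (Fin.last d) := by
  rw [MvPolynomial.eval_eq']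
  refine Finset.sum_congr rfl fun α _ => ?_
  rw [Fin.prod_univ_castSucc]
  simp only [complexGlue, Fin.snoc_castSucc, Fin.snoc_last]
  ring

theorem eval_symbolPoly (ξ : Rn d) (lam : ℝ) (z : ℂ) :
    (symbolPoly m μ A ξ lam).eval z = complexSymbol m μ A lam (complexGlue ξ z) := by
  rw [symbolPoly, complexSymbol, eval_finsetSum]
  refine Finset.sum_congr rfl fun j _ => ?_
  rw [eval_mul, eval_C, aeval_snoc_eq, eval_complexGlue_eq, eval_finsetSum]
  simp only [eval_mul, eval_C, eval_pow, eval_X]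

theorem eval_symbolPoly_ofReal (ξ : Rn d) (lam τ : ℝ) :
    (symbolPoly m μ A ξ lam).eval (τ : ℂ) = symbol m μ A (glue ξ τ) lam := by
  rw [eval_symbolPoly, symbol_eq, ofReal_glue]

theorem coeff_symbolPoly (ξ : Rn d) (lam : ℝ) (k : ℕ) :
    (symbolPoly m μ A ξ lam).coeff k = ∑ j ∈ Finset.Icc (2 * μ) (2 * m), (lam : ℂ) ^ (2 * m - j) *
      ∑ α ∈ (A j).support, if k = α (Fin.last d) then
        (A j).coeff α * ∏ i : Fin d, (ξ i : ℂ) ^ α i.castSucc else 0 := by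
  rw [symbolPoly, finsetSum_coeff]
  refine Finset.sum_congr rfl fun j _ => ?_
  rw [coeff_C_mul, aeval_snoc_eq, finsetSum_coeff]
  simp only [coeff_C_mul_X_pow]

theorem continuous_coeff_symbolPoly (k : ℕ) :
    Continuous fun q : Rn d × ℝ => (symbolPoly m μ A q.1 q.2).coeff k := by
  simp only [coeff_symbolPoly]
  refine continuous_finsetSum _ fun j _ => Continuous.mul (by fun_prop) ?_
  refine continuous_finsetSum _ fun α _ => ?_
  split_ifs
  · refine continuous_const.mul (continuous_finsetProd _ fun i _ => Continuous.pow ?_ _)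
    exact Complex.continuous_ofReal.comp ((EuclideanSpace.proj i).continuous.comp continuous_fst)
  · exact continuous_const

theorem sum_eq_of_mem_support {P : MvPolynomial (Fin (d + 1)) ℂ} {j : ℕ} (hP : P.IsHomogeneous j)
    {α : Fin (d + 1) →₀ ℕ} (hα : α ∈ P.support) :
    (∑ i : Fin d, α i.castSucc) + α (Fin.last d) = j := by
  have := hP (MvPolynomial.mem_support_iff.1 hα)
  rw [Finsupp.weight_apply, Finsupp.sum_fintype _ _ (by simp), Fin.sum_univ_castSucc] at this
  simpa using this

/-- A monomial of degree j with last exponent j contains no tangential variable; any other monomial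
contains one and vanishes at ξ' = 0. This gives the constant leading coefficient and the
divisibility of A(0, τ, 1) by τ^(2μ). -/
theorem ite_eq_of_mem_support {P : MvPolynomial (Fin (d + 1)) ℂ} {j : ℕ} (hP : P.IsHomogeneous j)
    {α : Fin (d + 1) →₀ ℕ} (hα : α ∈ P.support) (c : ℂ) (ξ : Rn d) :
    (if j = α (Fin.last d) then c * ∏ i : Fin d, (ξ i : ℂ) ^ α i.castSucc else 0) =
      c * ∏ i : Fin d, ((0 : Rn d) i : ℂ) ^ α i.castSucc := by
  have h := sum_eq_of_mem_support hP hα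
  split_ifs with h1
  · have h2 : ∑ i : Fin d, α i.castSucc = 0 := by omega
    rw [Finset.sum_eq_zero_iff] at h2
    simp [h2]
  · obtain ⟨i, hi⟩ : ∃ i : Fin d, α i.castSucc ≠ 0 := by
      by_contra! h2
      simp only [h2, Finset.sum_const_zero, zero_add] at h
      exact h1 h.symm
    rw [Finset.prod_eq_zero (Finset.mem_univ i) (by simp [hi]), mul_zero]

variable (hA : ∀ j ∈ Finset.Icc (2 * μ) (2 * m), (A j).IsHomogeneous j) (hμ : μ < m)

include hA

theorem coeff_symbolPoly_of_lt (ξ : Rn d) (lam : ℝ) {k : ℕ} (hk : 2 * m < k) :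
    (symbolPoly m μ A ξ lam).coeff k = 0 := by
  rw [coeff_symbolPoly]
  refine Finset.sum_eq_zero fun j hj => ?_
  rw [Finset.sum_eq_zero, mul_zero]
  intro α hα
  have h1 := sum_eq_of_mem_support (hA j hj) hα
  have h2 := (Finset.mem_Icc.1 hj).2
  rw [if_neg (by omega)]

include hμ

/-- Only A_{2m} can reach degree 2m in τ, and only through its pure power of the normal variable.
The leading coefficient is therefore independent of ξ' and λ, which makes the root counts
semicontinuous. -/
theorem coeff_symbolPoly_two_mul (ξ : Rn d) (lam : ℝ) :
    (symbolPoly m μ A ξ lam).coeff (2 * m) =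
      MvPolynomial.eval (complexGlue (0 : Rn d) 1) (A (2 * m)) := by
  have hm : 2 * m ∈ Finset.Icc (2 * μ) (2 * m) := Finset.mem_Icc.2 ⟨by omega, le_rfl⟩
  rw [coeff_symbolPoly, Finset.sum_eq_single (2 * m)]
  · rw [Nat.sub_self, pow_zero, one_mul, eval_complexGlue_eq]
    refine Finset.sum_congr rfl fun α hα => ?_
    rw [ite_eq_of_mem_support (hA _ hm) hα, one_pow, mul_one]
  · intro j hj hj'
    rw [Finset.sum_eq_zero, mul_zero]
    intro α hα
    have h1 := sum_eq_of_mem_support (hA j hj) hα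
    have h2 := (Finset.mem_Icc.1 hj).2
    rw [if_neg (by omega)]
  · exact fun h => absurd hm h

omit hA in
theorem leadingCoeff_ne_zero (hell : NElliptic m μ A) :
    MvPolynomial.eval (complexGlue (0 : Rn d) 1) (A (2 * m)) ≠ 0 := by
  obtain ⟨c, hc, h⟩ := hell
  have h1 := h (glue 0 1) 0 le_rfl
  rw [symbol_eq, ofReal_glue, norm_glue_zero_left, complexSymbol, Finset.sum_eq_single (2 * m)] at h1
  · intro h2
    simp [h2] at h1
    linarith
  · intro j hj hj'
    have h2 := (Finset.mem_Icc.1 hj).2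
    rw [Complex.ofReal_zero, zero_pow (by omega), zero_mul]
  · intro h2
    exact absurd (Finset.mem_Icc.2 ⟨by omega, le_rfl⟩) h2

theorem natDegree_symbolPoly (hell : NElliptic m μ A) (ξ : Rn d) (lam : ℝ) :
    (symbolPoly m μ A ξ lam).natDegree = 2 * m := by
  refine le_antisymm (natDegree_le_iff_coeff_eq_zero.2 fun k hk =>
    coeff_symbolPoly_of_lt hA ξ lam hk) (le_natDegree_of_ne_zero ?_)
  rw [coeff_symbolPoly_two_mul hA hμ]
  exact leadingCoeff_ne_zero hμ hell

theorem leadingCoeff_symbolPoly (hell : NElliptic m μ A) (ξ : Rn d) (lam : ℝ) :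
    (symbolPoly m μ A ξ lam).leadingCoeff =
      MvPolynomial.eval (complexGlue (0 : Rn d) 1) (A (2 * m)) := by
  rw [leadingCoeff, natDegree_symbolPoly hA hμ hell, coeff_symbolPoly_two_mul hA hμ]

omit hA hμ in
theorem symbol_ne_zero (hell : NElliptic m μ A) {ξ : Rn (d + 1)} (hξ : ξ ≠ 0) {lam : ℝ}
    (hlam : 0 ≤ lam) : symbol m μ A ξ lam ≠ 0 := by
  obtain ⟨c, hc, h⟩ := hell
  have h1 := h ξ lam hlam
  intro h2
  rw [h2, norm_zero] at h1
  have h3 : 0 < ‖ξ‖ := norm_pos_iff.2 hξ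
  exact absurd h1 (not_le.2 (by positivity))

omit hA hμ in
theorem glue_ne_zero_left {ξ : Rn d} (hξ : ξ ≠ 0) (τ : ℝ) : glue ξ τ ≠ 0 := by
  intro h
  have := norm_le_norm_glue ξ τ
  rw [h, norm_zero] at this
  exact hξ (norm_le_zero_iff.1 this)

omit hA hμ in
theorem im_ne_zero_of_mem_roots (hell : NElliptic m μ A) {ξ : Rn d} (hξ : ξ ≠ 0) {lam : ℝ}
    (hlam : 0 ≤ lam) : ∀ z ∈ (symbolPoly m μ A ξ lam).roots, z.im ≠ 0 := by
  intro z hz him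
  have h1 := (isRoot_of_mem_roots hz).eq_zero
  have h2 : z = (z.re : ℂ) := Complex.ext rfl him
  rw [h2, eval_symbolPoly_ofReal] at h1
  exact symbol_ne_zero hell (glue_ne_zero_left hξ _) hlam h1

theorem countP_add_countP_roots (hell : NElliptic m μ A) {ξ : Rn d} (hξ : ξ ≠ 0) {lam : ℝ}
    (hlam : 0 ≤ lam) : (symbolPoly m μ A ξ lam).roots.countP (fun z => 0 < z.im) +
      (symbolPoly m μ A ξ lam).roots.countP (fun z => z.im < 0) = 2 * m := by
  rw [countP_im_pos_add_countP_im_neg (im_ne_zero_of_mem_roots hell hξ hlam),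
    IsAlgClosed.card_roots_eq_natDegree, natDegree_symbolPoly hA hμ hell]

omit hA hμ in
theorem isOpen_im_pos : IsOpen {z : ℂ | 0 < z.im} :=
  isOpen_lt continuous_const Complex.continuous_im

omit hA hμ in
theorem isOpen_im_neg : IsOpen {z : ℂ | z.im < 0} :=
  isOpen_lt Complex.continuous_im continuous_const

theorem eventually_countP_symbolPoly_le (hell : NElliptic m μ A) (q₀ : Rn d × ℝ) (p : ℂ → Prop)
    [DecidablePred p] (hp : IsOpen {z | p z}) :
    ∀ᶠ q : Rn d × ℝ in 𝓝 q₀, (symbolPoly m μ A q₀.1 q₀.2).roots.countP p ≤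
      (symbolPoly m μ A q.1 q.2).roots.countP p :=
  eventually_countP_roots_le (P := fun q : Rn d × ℝ => symbolPoly m μ A q.1 q.2)
    (leadingCoeff_ne_zero hμ hell) (fun q => natDegree_symbolPoly hA hμ hell q.1 q.2)
    (fun q => coeff_symbolPoly_two_mul hA hμ q.1 q.2) continuous_coeff_symbolPoly q₀ p hp

/-- The numbers of upper and of lower roots are both lower semicontinuous. Ellipticity excludes real
roots, so their sum is the constant 2m, and neither can jump. -/
theorem continuousOn_upperRoots (hell : NElliptic m μ A) :
    ContinuousOn (fun q : Rn d × ℝ => upperRoots (symbolPoly m μ A q.1 q.2))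
      ({0}ᶜ ×ˢ Set.Ici 0) := by
  rintro ⟨ξ₀, l₀⟩ ⟨h1, h2⟩
  have e0 := countP_add_countP_roots hA hμ hell h1 h2
  refine tendsto_nhds_of_eventually_eq (eventually_nhdsWithin_iff.2 ?_)
  filter_upwards [eventually_countP_symbolPoly_le hA hμ hell (ξ₀, l₀) _ isOpen_im_pos,
    eventually_countP_symbolPoly_le hA hμ hell (ξ₀, l₀) _ isOpen_im_neg] with q e1 e2 hq
  have e3 := countP_add_countP_roots hA hμ hell hq.1 hq.2
  simp only at e0 e1 e2
  unfold upperRoots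
  omega

/-- At λ = 0 the symbol is homogeneous of even degree, so passing from ξ' to -ξ' changes the sign of
every root and exchanges upper and lower ones. -/
theorem upperRoots_neg (hell : NElliptic m μ A) {ξ : Rn d} (hξ : ξ ≠ 0) :
    upperRoots (symbolPoly m μ A (-ξ) 0) + upperRoots (symbolPoly m μ A ξ 0) = 2 * m := by
  have hp : symbolPoly m μ A (-ξ) 0 = (symbolPoly m μ A ξ 0).comp (-X) := by
    refine Polynomial.funext fun z => ?_
    rw [eval_comp, eval_symbolPoly, eval_symbolPoly]
    have h1 : complexGlue (-ξ) z = ((-1 : ℝ) : ℂ) • complexGlue ξ (-z) := by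
      rw [smul_complexGlue]; simp
    have h2 := complexSymbol_smul hA (-1) 0 (complexGlue ξ (-z))
    rw [mul_zero] at h2
    rw [h1, h2, eval_neg, eval_X]
    simp
  have hroots : (symbolPoly m μ A (-ξ) 0).roots = (symbolPoly m μ A ξ 0).roots.map Neg.neg := by
    have e := eval_eq_leadingCoeff_mul_prod (symbolPoly m μ A ξ 0)
    have e' : (symbolPoly m μ A (-ξ) 0) = C ((symbolPoly m μ A ξ 0).leadingCoeff) *
        (((symbolPoly m μ A ξ 0).roots.map Neg.neg).map fun κ => X - C κ).prod := by
      refine Polynomial.funext fun z => ?_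
      rw [hp, eval_comp, e, eval_mul, eval_C, eval_multiset_prod, Multiset.map_map,
        Multiset.map_map]
      congr 1
      have h3 : ((symbolPoly m μ A ξ 0).roots.map fun κ => eval z (-X) - κ) =
          (symbolPoly m μ A ξ 0).roots.map fun κ => (-1) * (z + κ) := by
        refine Multiset.map_congr rfl fun κ _ => ?_
        simp; ring
      rw [h3, Multiset.prod_map_mul, Multiset.map_const', Multiset.prod_replicate,
        IsAlgClosed.card_roots_eq_natDegree, natDegree_symbolPoly hA hμ hell, pow_mul]
      simp
    rw [e', roots_C_mul _ (by
      rw [leadingCoeff_symbolPoly hA hμ hell]; exact leadingCoeff_ne_zero hμ hell),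
      roots_multiset_prod_X_sub_C]
  have hcount : upperRoots (symbolPoly m μ A (-ξ) 0) =
      (symbolPoly m μ A ξ 0).roots.countP (fun z => z.im < 0) := by
    rw [upperRoots, hroots, Multiset.countP_map, Multiset.countP_eq_card_filter]
    congr 1
    refine Multiset.filter_congr fun z _ => ?_
    simp
  rw [hcount, add_comm]
  exact countP_add_countP_roots hA hμ hell hξ le_rfl

/-- In three and more variables proper ellipticity is automatic. -/
theorem properlyElliptic_of_two_le (hell : NElliptic m μ A) (hd : 2 ≤ d) :
    ProperlyElliptic m μ A := by
  intro ξ hξ lam hlam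
  have hrank : 1 < Module.rank ℝ (Rn d) := by
    rw [← Module.finrank_eq_rank, finrank_euclideanSpace_fin]
    exact_mod_cast hd
  -- For d ≥ 2 the punctured space is connected, so the number of upper roots is one constant. By
  -- the symmetry ξ' → -ξ' at λ = 0, twice this constant is 2m.
  have hconn : IsPreconnected (({0}ᶜ : Set (Rn d)) ×ˢ Set.Ici (0 : ℝ)) :=
    (isConnected_compl_singleton_of_one_lt_rank hrank 0).isPreconnected.prod isPreconnected_Ici
  have hc := continuousOn_upperRoots hA hμ hell
  have e1 := hconn.constant hc (x := (ξ, lam)) (y := (ξ, 0)) ⟨hξ, hlam⟩ ⟨hξ, Set.self_mem_Ici⟩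
  have e2 := hconn.constant hc (x := (-ξ, 0)) (y := (ξ, 0)) ⟨neg_ne_zero.2 hξ, Set.self_mem_Ici⟩
    ⟨hξ, Set.self_mem_Ici⟩
  have e3 := upperRoots_neg hA hμ hell hξ
  simp only at e1 e2
  omega

omit hμ in
theorem eval_symbolPoly_scale (ξ : Rn d) {lam : ℝ} (hlam : 0 < lam) (z : ℂ) :
    (symbolPoly m μ A ξ lam).eval z =
      lam ^ (2 * m) * (symbolPoly m μ A (lam⁻¹ • ξ) 1).eval (z / lam) := by
  have h1 := complexSymbol_smul hA lam 1 (complexGlue (lam⁻¹ • ξ) (z / lam))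
  rw [mul_one, smul_complexGlue, smul_smul, mul_inv_cancel₀ hlam.ne', one_smul,
    mul_div_cancel₀ _ (by exact_mod_cast hlam.ne')] at h1
  rw [eval_symbolPoly, eval_symbolPoly, h1]

/-- By joint homogeneity the roots at (ξ', λ) are λ times the roots at (ξ'/λ, 1). Uniformity in λ
thus reduces to the behaviour of the latter roots as ξ'/λ → 0. -/
theorem eval_symbolPoly_eq_prod (hell : NElliptic m μ A) (ξ : Rn d) {lam : ℝ} (hlam : 0 < lam)
    (z : ℂ) : (symbolPoly m μ A ξ lam).eval z =
      MvPolynomial.eval (complexGlue (0 : Rn d) 1) (A (2 * m)) *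
        ((symbolPoly m μ A (lam⁻¹ • ξ) 1).roots.map fun κ => z - lam * κ).prod := by
  have hl : (lam : ℂ) ≠ 0 := by exact_mod_cast hlam.ne'
  have h2 : ((symbolPoly m μ A (lam⁻¹ • ξ) 1).roots.map fun κ => z - lam * κ) =
      (symbolPoly m μ A (lam⁻¹ • ξ) 1).roots.map fun κ => lam * (z / lam - κ) := by
    refine Multiset.map_congr rfl fun κ _ => ?_
    field_simp
  rw [eval_symbolPoly_scale hA ξ hlam, eval_eq_leadingCoeff_mul_prod,
    leadingCoeff_symbolPoly hA hμ hell, h2, Multiset.prod_map_mul, Multiset.map_const',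
    Multiset.prod_replicate, IsAlgClosed.card_roots_eq_natDegree, natDegree_symbolPoly hA hμ hell]
  ring

omit hμ in
-- At ξ' = 0 only the pure powers τ^j with j ≥ 2μ survive.
theorem symbolPoly_zero_eq : symbolPoly m μ A 0 1 = X ^ (2 * μ) * auxPoly m μ A := by
  have hdvd : (X ^ (2 * μ) : ℂ[X]) ∣ symbolPoly m μ A 0 1 := by
    rw [symbolPoly]
    refine Finset.dvd_sum fun j hj => Dvd.dvd.mul_left ?_ _
    rw [aeval_snoc_eq]
    refine Finset.dvd_sum fun α hα => ?_
    by_cases h : α (Fin.last d) = j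
    · refine Dvd.dvd.mul_left (pow_dvd_pow _ ?_) _
      rw [h]
      exact (Finset.mem_Icc.1 hj).1
    · have := ite_eq_of_mem_support (hA j hj) hα ((A j).coeff α) 0
      rw [if_neg (fun h' => h h'.symm)] at this
      rw [← this]
      simp
  rw [auxPoly]
  have h1 := (modByMonic_eq_zero_iff_dvd (monic_X_pow (R := ℂ) (2 * μ))).2 hdvd
  have h2 := modByMonic_add_div (symbolPoly m μ A 0 1) (X ^ (2 * μ) : ℂ[X])
  rw [h1, zero_add] at h2
  exact h2.symm

end SymbolPolynomial

/-! ### Approximate factorization of the symbol with two-sided control by the weight. -/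

section Factorization

open Polynomial

variable {d m μ : ℕ} {A : ℕ → MvPolynomial (Fin (d + 1)) ℂ}

/-- The product `(1 + s)^μ (lam + s)^(m - μ)`, equivalent to the weight `Ξ` at `|ξ| = s`. -/
def prodWeight (m μ : ℕ) (s lam : ℝ) : ℝ := (1 + s) ^ μ * (lam + s) ^ (m - μ)

theorem prodWeight_pos {s lam : ℝ} (hs : 0 ≤ s) (hlam : 0 < lam) : 0 < prodWeight m μ s lam := by
  unfold prodWeight; positivity

theorem pow_le_prodWeight {s lam : ℝ} (hs : 0 ≤ s) (hlam : 0 < lam) :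
    lam ^ (m - μ) ≤ prodWeight m μ s lam := by
  unfold prodWeight
  have h1 : 1 ≤ (1 + s) ^ μ := one_le_pow₀ (by linarith)
  have h2 : lam ^ (m - μ) ≤ (lam + s) ^ (m - μ) := by gcongr; linarith
  have h3 : 0 < lam ^ (m - μ) := by positivity
  nlinarith

theorem symbolSize_le_prodWeight_sq {s lam : ℝ} (hs : 0 ≤ s) (hlam : 0 < lam) :
    symbolSize m μ s lam ≤ prodWeight m μ s lam ^ 2 := by
  unfold symbolSize prodWeight
  rw [mul_pow, ← pow_mul, ← pow_mul, mul_comm μ, mul_comm (m - μ), Nat.mul_sub]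
  gcongr
  linarith

theorem symbolSize_two_mul_le (hμ : μ < m) {s lam : ℝ} (hs : 0 ≤ s) (hlam : 0 ≤ lam) :
    symbolSize m μ (2 * s) lam ≤ 2 ^ (2 * m) * symbolSize m μ s lam := by
  unfold symbolSize
  have h : 2 * m = 2 * μ + (2 * m - 2 * μ) := by omega
  calc (2 * s) ^ (2 * μ) * (lam + 2 * s) ^ (2 * m - 2 * μ)
      ≤ (2 * s) ^ (2 * μ) * (2 * (lam + s)) ^ (2 * m - 2 * μ) := by gcongr; linarith
    _ = (2 ^ (2 * μ) * 2 ^ (2 * m - 2 * μ)) * (s ^ (2 * μ) * (lam + s) ^ (2 * m - 2 * μ)) := by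
        rw [mul_pow, mul_pow]; ring
    _ = _ := by rw [← pow_add, ← h]

theorem complexGlue_ofReal_norm_le {ξ : Rn d} {τ R : ℝ} (h : ‖glue ξ τ‖ ≤ R) :
    ‖complexGlue ξ (τ : ℂ)‖ ≤ R :=
  norm_complexGlue_le ((norm_le_norm_glue ξ τ).trans h)
    (by rw [Complex.norm_real]; exact (abs_le_norm_glue ξ τ).trans h)

theorem exists_norm_symbol_le (hA : ∀ j ∈ Finset.Icc (2 * μ) (2 * m), (A j).IsHomogeneous j) :
    ∃ C > 0, ∀ lam > 0, ∀ (ξ : Rn d) (τ : ℝ),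
      ‖symbol m μ A (glue ξ τ) lam‖ ≤ C * prodWeight m μ ‖glue ξ τ‖ lam ^ 2 := by
  obtain ⟨C, hC, h⟩ := exists_norm_complexSymbol_le hA
  refine ⟨C, hC, fun lam hlam ξ τ => ?_⟩
  rw [symbol_eq, ofReal_glue]
  refine (h _ lam _ hlam.le (complexGlue_ofReal_norm_le le_rfl)).trans ?_
  gcongr
  exact symbolSize_le_prodWeight_sq (norm_nonneg _) hlam

variable (hA : ∀ j ∈ Finset.Icc (2 * μ) (2 * m), (A j).IsHomogeneous j) (hμ : μ < m)
  (hell : NElliptic m μ A)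

include hA hμ hell

/-- Roots of an elliptic symbol stay away from the real axis. -/
theorem exists_root_separation : ∃ δ > 0, ∀ lam ≥ 0, ∀ (ξ : Rn d) (τ : ℝ) (z : ℂ),
    (symbolPoly m μ A ξ lam).IsRoot z → δ * ‖glue ξ τ‖ ≤ ‖(τ : ℂ) - z‖ := by
  obtain ⟨c, hc, h⟩ := hell
  -- If z were too close to τ, the symbol at τ would be close to its value 0 at z. The comparison is
  -- made at radius 2s, which enlarges the symbol size by up to 2^(2m); with this tolerance c/2
  -- remains against the elliptic bound c.
  obtain ⟨δ, hδ, h1⟩ := exists_norm_complexSymbol_sub_le hA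
    (show 0 < c / 2 ^ (2 * m + 1) by positivity)
  refine ⟨min 1 (2 * δ), by positivity, fun lam hlam ξ τ z hz => ?_⟩
  by_contra! hlt
  set s := ‖glue ξ τ‖ with hs
  have hs0 : 0 < s := by
    by_contra! h0
    have : s = 0 := le_antisymm h0 (norm_nonneg _)
    rw [this, mul_zero] at hlt
    exact absurd hlt (not_lt.2 (norm_nonneg _))
  have e1 : ‖(τ : ℂ) - z‖ ≤ s := by
    refine hlt.le.trans ?_
    nlinarith [min_le_left 1 (2 * δ)]
  have e2 : ‖(τ : ℂ) - z‖ ≤ 2 * δ * s := by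
    refine hlt.le.trans ?_
    nlinarith [min_le_right 1 (2 * δ)]
  have e3 : ‖(τ : ℂ)‖ ≤ s := by rw [Complex.norm_real]; exact abs_le_norm_glue ξ τ
  have e4 : ‖z‖ ≤ 2 * s := by
    have := norm_sub_le (τ : ℂ) ((τ : ℂ) - z)
    rw [sub_sub_cancel] at this
    linarith
  have e5 := h1 (2 * s) lam (complexGlue ξ (τ : ℂ)) (complexGlue ξ z) hlam
    (complexGlue_ofReal_norm_le (by linarith))
    (norm_complexGlue_le (by linarith [norm_le_norm_glue ξ τ]) e4)
    (by
      rw [complexGlue_sub, sub_self]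
      refine norm_complexGlue_le (by rw [norm_zero]; positivity) (by linarith))
  rw [← eval_symbolPoly (z := z), hz.eq_zero, sub_zero, ← ofReal_glue, ← symbol_eq] at e5
  have e6 := h (glue ξ τ) lam hlam
  have e7 := symbolSize_two_mul_le hμ hs0.le hlam
  have e8 : 0 < symbolSize m μ s lam := by unfold symbolSize; positivity
  have e9 : c / 2 ^ (2 * m + 1) * symbolSize m μ (2 * s) lam ≤ c / 2 * symbolSize m μ s lam := by
    calc _ ≤ c / 2 ^ (2 * m + 1) * (2 ^ (2 * m) * symbolSize m μ s lam) := by gcongr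
      _ = _ := by rw [pow_succ]; field_simp
  have e10 : c * symbolSize m μ s lam ≤ c / 2 * symbolSize m μ s lam := by
    refine le_trans ?_ (e5.trans e9)
    refine le_trans (le_of_eq ?_) e6
    unfold symbolSize; ring
  nlinarith

theorem auxPoly_roots : (symbolPoly m μ A 0 1).roots =
    Multiset.replicate (2 * μ) 0 + (auxPoly m μ A).roots := by
  have h0 : symbolPoly m μ A 0 1 ≠ 0 := by
    intro h
    have := natDegree_symbolPoly hA hμ hell 0 1
    rw [h, natDegree_zero] at this
    omega
  rw [symbolPoly_zero_eq hA] at h0 ⊢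
  rw [roots_mul h0, roots_X_pow, Multiset.nsmul_singleton]

omit hμ in
-- Dividing the elliptic bound at ξ' = 0, λ = 1 by |τ|^(2μ) leaves |Q(τ)| ≥ c for real τ ≠ 0.
-- Continuity extends this to τ = 0, where ellipticity itself says nothing.
theorem auxPoly_im_ne_zero : ∀ z ∈ (auxPoly m μ A).roots, z.im ≠ 0 := by
  obtain ⟨c, hc, h⟩ := hell
  have h1 : ∀ t : ℝ, t ≠ 0 → c ≤ ‖(auxPoly m μ A).eval (t : ℂ)‖ := by
    intro t ht
    have h2 := h (glue 0 t) 1 zero_le_one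
    rw [← eval_symbolPoly_ofReal, symbolPoly_zero_eq hA, norm_glue_zero_left, eval_mul,
      eval_pow, eval_X, norm_mul, norm_pow, Complex.norm_real, Real.norm_eq_abs] at h2
    have h3 : 0 < |t| ^ (2 * μ) := by positivity
    have h4 : 1 ≤ (1 + |t|) ^ (2 * m - 2 * μ) := one_le_pow₀ (by linarith [abs_nonneg t])
    have h5 : |t| ^ (2 * μ) * (c * (1 + |t|) ^ (2 * m - 2 * μ)) ≤
        |t| ^ (2 * μ) * ‖(auxPoly m μ A).eval (t : ℂ)‖ := by
      refine le_trans (le_of_eq ?_) h2; ring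
    have h6 := le_of_mul_le_mul_left h5 h3
    nlinarith
  have h2 : ∀ t : ℝ, c ≤ ‖(auxPoly m μ A).eval (t : ℂ)‖ := by
    have hcl : IsClosed {t : ℝ | c ≤ ‖(auxPoly m μ A).eval (t : ℂ)‖} :=
      isClosed_le continuous_const
        (((auxPoly m μ A).continuous.comp Complex.continuous_ofReal).norm)
    have hd : Dense ({0}ᶜ : Set ℝ) := dense_compl_singleton 0
    intro t
    have : closure ({0}ᶜ : Set ℝ) ⊆ {t : ℝ | c ≤ ‖(auxPoly m μ A).eval (t : ℂ)‖} :=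
      closure_minimal (fun t ht => h1 t ht) hcl
    exact this (hd t)
  intro z hz him
  have h3 := (isRoot_of_mem_roots hz).eq_zero
  have h4 := h2 z.re
  have h5 : (z.re : ℂ) = z := Complex.ext rfl him.symm
  rw [h5, h3, norm_zero] at h4
  linarith

theorem auxPoly_card_roots : (auxPoly m μ A).roots.card = 2 * (m - μ) := by
  have h := congrArg Multiset.card (auxPoly_roots hA hμ hell)
  rw [IsAlgClosed.card_roots_eq_natDegree, natDegree_symbolPoly hA hμ hell, Multiset.card_add,
    Multiset.card_replicate] at h
  omega

variable (hreg : DegeneratesRegularly m μ A)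

include hreg

theorem auxPoly_countP_neg : (auxPoly m μ A).roots.countP (fun z => z.im < 0) = m - μ := by
  have h := countP_im_pos_add_countP_im_neg (auxPoly_im_ne_zero hA hell)
  have h1 := auxPoly_card_roots hA hμ hell
  unfold DegeneratesRegularly upperRoots at hreg
  omega

/-- For small `ζ ≠ 0` at least `m - μ` roots on either side of the real axis stay away from the
origin. -/
theorem exists_countP_large : ∃ η > 0, ∃ c > 0, ∀ ζ : Rn d, ‖ζ‖ < η →
    m - μ ≤ (symbolPoly m μ A ζ 1).roots.countP (fun z => c < ‖z‖ ∧ 0 < z.im) ∧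
    m - μ ≤ (symbolPoly m μ A ζ 1).roots.countP (fun z => c < ‖z‖ ∧ z.im < 0) := by
  obtain ⟨c, hc, h⟩ := exists_lt_norm (s := (auxPoly m μ A).roots) (by
    intro z hz h0
    exact auxPoly_im_ne_zero hA hell z hz (by rw [h0, Complex.zero_im]))
  have hopen : IsOpen {z : ℂ | c < ‖z‖} := isOpen_lt continuous_const continuous_norm
  have e1 := eventually_countP_symbolPoly_le hA hμ hell (0, 1) (fun z => c < ‖z‖ ∧ 0 < z.im)
    (hopen.inter isOpen_im_pos)
  have e2 := eventually_countP_symbolPoly_le hA hμ hell (0, 1) (fun z => c < ‖z‖ ∧ z.im < 0)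
    (hopen.inter isOpen_im_neg)
  -- At ζ = 0 the roots are 2μ zeros together with the roots of Q. The zeros are discarded, and
  -- every root of Q has modulus above c. The counts then persist nearby because the conditions are
  -- open.
  have key : ∀ p : ℂ → Prop, ∀ [DecidablePred p], (auxPoly m μ A).roots.countP p = m - μ →
      m - μ ≤ (symbolPoly m μ A 0 1).roots.countP (fun z => c < ‖z‖ ∧ p z) := by
    intro p _ hp
    rw [auxPoly_roots hA hμ hell, Multiset.countP_add, ← hp]
    refine le_trans (le_of_eq ?_) (Nat.le_add_left _ _)
    refine Multiset.countP_congr rfl fun z hz => ?_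
    simp [h z hz]
  obtain ⟨η, hη, he⟩ := Metric.eventually_nhds_iff.1 (e1.and e2)
  refine ⟨η, hη, c, hc, fun ζ hζ => ?_⟩
  have := he (y := (ζ, 1)) (by
    rw [Prod.dist_eq, dist_self, dist_zero_right]
    exact max_lt hζ hη)
  exact ⟨(key _ hreg).trans this.1, (key _ (auxPoly_countP_neg hA hμ hell hreg)).trans this.2⟩

omit hreg in
-- Root separation bounds each of the m factors below by a multiple of |ξ|, comparable with 1 + |ξ|
-- since |ξ'| ≥ 1. At least m-μ factors even reach λ + |ξ|: when ξ'/λ is small because the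
-- corresponding roots have size at least cλ, and otherwise because λ is dominated by |ξ|.
theorem exists_prod_roots_ge {lam0 : ℝ} (hlam0 : 0 < lam0) (p : ℂ → Prop) [DecidablePred p]
    (hcount : ∀ ζ : Rn d, ζ ≠ 0 → (symbolPoly m μ A ζ 1).roots.countP p = m)
    (hlarge : ∃ η > 0, ∃ c > 0, ∀ ζ : Rn d, ‖ζ‖ < η →
      m - μ ≤ (symbolPoly m μ A ζ 1).roots.countP (fun z => c < ‖z‖ ∧ p z)) :
    ∃ c > 0, ∀ lam ≥ lam0, ∀ ξ : Rn d, 1 ≤ ‖ξ‖ → ∀ τ : ℝ,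
      c * prodWeight m μ ‖glue ξ τ‖ lam ≤
        ‖((((symbolPoly m μ A (lam⁻¹ • ξ) 1).roots.filter p).map fun κ => (lam : ℂ) * κ).map
          fun z => (τ : ℂ) - z).prod‖ := by
  obtain ⟨δ, hδ, hsep⟩ := exists_root_separation hA hμ hell
  obtain ⟨η, hη, c₁, hc₁, hlarge⟩ := hlarge
  set b := min 1 lam0 with hb
  have hb0 : 0 < b := by positivity
  -- The three entries serve, in this order, the basic bound (using 1 + s ≤ 2s), the case λ ≤ s/η,
  -- and the large roots in the case of small ξ'/λ. The number b makes b(1+s) ≤ λ + s, the ordering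
  -- required by `prod_map_ge_of_countP`.
  set c := min (min (δ / 2) (δ * η / (1 + η))) ((1 / c₁ * (1 + 1 / δ) + 1 / δ)⁻¹) with hcdef
  have hc : 0 < c := by positivity
  refine ⟨c ^ m * b ^ μ, by positivity, fun lam hlam ξ hξ τ => ?_⟩
  have hl : 0 < lam := hlam0.trans_le hlam
  have hlc : (lam : ℂ) ≠ 0 := by exact_mod_cast hl.ne'
  set s := ‖glue ξ τ‖ with hs
  have hs1 : 1 ≤ s := hξ.trans (norm_le_norm_glue ξ τ)
  set r := (symbolPoly m μ A (lam⁻¹ • ξ) 1).roots with hr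
  have hsepr : ∀ κ ∈ r, δ * s ≤ ‖(τ : ℂ) - lam * κ‖ := by
    intro κ hκ
    refine hsep lam hl.le ξ τ _ ?_
    rw [IsRoot, eval_symbolPoly_scale hA ξ hl, mul_div_cancel_left₀ _ hlc,
      (isRoot_of_mem_roots hκ).eq_zero, mul_zero]
  have hξ0 : lam⁻¹ • ξ ≠ 0 :=
    smul_ne_zero (inv_ne_zero hl.ne') (norm_pos_iff.1 (zero_lt_one.trans_le hξ))
  have hnorm : ∀ P : Multiset ℂ, ‖P.prod‖ = (P.map (‖·‖)).prod := fun P =>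
    map_multiset_prod (normHom : ℂ →*₀ ℝ) P
  rw [Multiset.map_map, hnorm, Multiset.map_map]
  have hcard : (r.filter p).card = μ + (m - μ) := by
    rw [← Multiset.countP_eq_card_filter, hcount _ hξ0]; omega
  have hx : b * (1 + s) ≤ lam + s := by
    have := min_le_left 1 lam0
    have := min_le_right 1 lam0
    nlinarith
  have base : ∀ z ∈ r.filter p, c * (b * (1 + s)) ≤
      ((‖·‖) ∘ (fun z => (τ : ℂ) - z) ∘ fun κ => (lam : ℂ) * κ) z := by
    intro z hz
    refine le_trans ?_ (hsepr z (Multiset.mem_of_mem_filter hz))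
    have h1 : c ≤ δ / 2 := (min_le_left _ _).trans (min_le_left _ _)
    have h2 : b ≤ 1 := min_le_left _ _
    calc c * (b * (1 + s)) ≤ δ / 2 * (1 * (1 + s)) := by gcongr
      _ ≤ δ * s := by nlinarith
  have fin : ∀ q : ℂ → Prop, ∀ [DecidablePred q], m - μ ≤ (r.filter p).countP q →
      (∀ z ∈ r.filter p, q z → c * (lam + s) ≤
        ((‖·‖) ∘ (fun z => (τ : ℂ) - z) ∘ fun κ => (lam : ℂ) * κ) z) →
      c ^ m * b ^ μ * prodWeight m μ s lam ≤ ((r.filter p).map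
        ((‖·‖) ∘ (fun z => (τ : ℂ) - z) ∘ fun κ => (lam : ℂ) * κ)).prod := by
    intro q _ hq1 hq2
    have := prod_map_ge_of_countP hc.le (by positivity) hx base hq2 hcard hq1
    rw [Nat.add_sub_cancel' hμ.le] at this
    refine le_trans (le_of_eq ?_) this
    rw [prodWeight, mul_pow]; ring
  by_cases hζ : ‖lam⁻¹ • ξ‖ < η
  · refine fin (fun z => c₁ < ‖z‖) ?_ ?_
    · rw [Multiset.countP_filter]
      exact hlarge _ hζ
    · intro z hz hzc
      have h1 := hsepr z (Multiset.mem_of_mem_filter hz)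
      change _ ≤ ‖(τ : ℂ) - lam * z‖
      set w := ‖(τ : ℂ) - lam * z‖ with hw
      have h2 : |τ| ≤ s := abs_le_norm_glue ξ τ
      have h3 : lam * ‖z‖ ≤ w + |τ| := by
        have := norm_sub_le (τ : ℂ) ((τ : ℂ) - lam * z)
        rw [sub_sub_cancel, norm_mul, Complex.norm_real, Complex.norm_real, Real.norm_eq_abs,
          Real.norm_eq_abs, abs_of_pos hl] at this
        linarith
      have h4 : s ≤ 1 / δ * w := by
        rw [one_div, ← div_eq_inv_mul, le_div_iff₀ hδ]; linarith
      -- A root λz with |z| > c₁ satisfies c₁λ ≤ |τ - λz| + |τ|, and |τ| ≤ s is bounded through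
      -- separation by |τ - λz|/δ.
      have h5 : lam ≤ 1 / c₁ * (w + 1 / δ * w) := by
        rw [one_div, ← div_eq_inv_mul, le_div_iff₀ hc₁]
        nlinarith
      have h6 : lam + s ≤ (1 / c₁ * (1 + 1 / δ) + 1 / δ) * w := by
        refine (add_le_add h5 h4).trans (le_of_eq ?_); ring
      have h7 : c ≤ (1 / c₁ * (1 + 1 / δ) + 1 / δ)⁻¹ := min_le_right _ _
      calc c * (lam + s) ≤ (1 / c₁ * (1 + 1 / δ) + 1 / δ)⁻¹ * ((1 / c₁ * (1 + 1 / δ) + 1 / δ) * w) := by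
            gcongr
        _ = w := by rw [inv_mul_cancel_left₀ (by positivity)]
  · refine fin (fun _ => True) ?_ ?_
    · rw [Multiset.countP_eq_card_filter, Multiset.filter_true, hcard]; omega
    · intro z hz _
      have h1 := hsepr z (Multiset.mem_of_mem_filter hz)
      change _ ≤ ‖(τ : ℂ) - lam * z‖
      refine le_trans ?_ h1
      have h2 : η * lam ≤ s := by
        rw [not_lt, norm_smul, norm_inv, Real.norm_eq_abs, abs_of_pos hl, ← div_eq_inv_mul,
          le_div_iff₀ hl] at hζ
        exact hζ.trans (norm_le_norm_glue ξ τ)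
      have h3 : c ≤ δ * η / (1 + η) := (min_le_left _ _).trans (min_le_right _ _)
      calc c * (lam + s) ≤ δ * η / (1 + η) * (lam + s) := by gcongr
        _ = δ * (η * lam + η * s) / (1 + η) := by ring
        _ ≤ δ * (s + η * s) / (1 + η) := by gcongr
        _ = δ * s := by field_simp

omit hμ hell hreg in
-- For |τ| ≥ 1/δ a tangential shift of length at most 1 is a relative perturbation of size δ of the
-- covector.
theorem exists_norm_symbol_sub_le {ε : ℝ} (hε : 0 < ε) : ∃ T > 0, ∀ lam > 0, ∀ (ξ : Rn d) (τ : ℝ),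
    ‖ξ‖ ≤ 1 → T ≤ |τ| → ‖symbol m μ A (glue ξ τ) lam - symbol m μ A (glue 0 τ) lam‖ ≤
      ε * prodWeight m μ ‖glue ξ τ‖ lam ^ 2 := by
  obtain ⟨δ, hδ, h⟩ := exists_norm_complexSymbol_sub_le hA hε
  refine ⟨1 / δ, by positivity, fun lam hlam ξ τ hξ hτ => ?_⟩
  have h1 := abs_le_norm_glue ξ τ
  rw [symbol_eq, symbol_eq, ofReal_glue, ofReal_glue]
  refine (h ‖glue ξ τ‖ lam _ _ hlam.le (complexGlue_ofReal_norm_le le_rfl)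
    (complexGlue_ofReal_norm_le (by rwa [norm_glue_zero_left])) ?_).trans ?_
  · rw [complexGlue_sub, sub_zero, sub_self]
    have : 1 ≤ δ * ‖glue ξ τ‖ := by
      rw [div_le_iff₀ hδ] at hτ
      nlinarith
    exact norm_complexGlue_le (hξ.trans this) (by rw [norm_zero]; positivity)
  · gcongr
    exact symbolSize_le_prodWeight_sq (norm_nonneg _) hlam

omit hA hμ hell hreg in
theorem prod_map_mul_left_sub (s : Multiset ℂ) {lam : ℝ} (hlam : 0 < lam) (τ : ℝ) :
    ‖((s.map fun κ => (lam : ℂ) * κ).map fun z => (τ : ℂ) - z).prod‖ =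
      lam ^ s.card * ‖(s.map fun κ => ((τ / lam : ℝ) : ℂ) - κ).prod‖ := by
  have hl : (lam : ℂ) ≠ 0 := by exact_mod_cast hlam.ne'
  have h2 : ((s.map fun κ => (lam : ℂ) * κ).map fun z => (τ : ℂ) - z) =
      s.map fun κ => lam * (((τ / lam : ℝ) : ℂ) - κ) := by
    rw [Multiset.map_map]
    refine Multiset.map_congr rfl fun κ _ => ?_
    simp only [Function.comp]
    push_cast
    field_simp
  rw [h2, Multiset.prod_map_mul, Multiset.map_const', Multiset.prod_replicate, norm_mul, norm_pow,
    Complex.norm_real, Real.norm_eq_abs, abs_of_pos hlam]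

omit hA hμ hell hreg in
theorem mul_one_add_abs_div {lam : ℝ} (hlam : 0 < lam) (τ : ℝ) (k : ℕ) :
    lam ^ k * (1 + |τ / lam|) ^ k = (lam + |τ|) ^ k := by
  rw [← mul_pow, abs_div, abs_of_pos hlam]
  congr 1
  field_simp

omit hμ hreg in
-- For |ξ'| ≤ 1 the roots near the origin are replaced by a fixed nonreal z₀ taken μ times. Then 1 +
-- |τ| and λ + |τ| are comparable with 1 + |ξ| and λ + |ξ|, the latter because λ ≥ λ₀.
theorem exists_prod_low_ge {lam0 : ℝ} (hlam0 : 0 < lam0) (p : ℂ → Prop) [DecidablePred p]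
    (hcount : (auxPoly m μ A).roots.countP p = m - μ) {z₀ : ℂ} (hz₀ : z₀.im ≠ 0) :
    ∃ c > 0, ∀ lam ≥ lam0, ∀ ξ : Rn d, ‖ξ‖ ≤ 1 → ∀ τ : ℝ,
      c * prodWeight m μ ‖glue ξ τ‖ lam ≤ ‖((Multiset.replicate μ z₀ +
        ((auxPoly m μ A).roots.filter p).map fun κ => (lam : ℂ) * κ).map
          fun z => (τ : ℂ) - z).prod‖ := by
  obtain ⟨c₁, hc₁, h1⟩ := exists_prod_ge (s := Multiset.replicate μ z₀) (by
    intro z hz; rwa [Multiset.eq_of_mem_replicate hz])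
  obtain ⟨c₂, hc₂, h2⟩ := exists_prod_ge (s := (auxPoly m μ A).roots.filter p) (by
    intro z hz; exact auxPoly_im_ne_zero hA hell z (Multiset.mem_of_mem_filter hz))
  rw [Multiset.card_replicate] at h1
  rw [← Multiset.countP_eq_card_filter, hcount] at h2
  refine ⟨c₁ * c₂ * ((1 / 2) ^ μ * (1 + 1 / lam0)⁻¹ ^ (m - μ)), by positivity,
    fun lam hlam ξ hξ τ => ?_⟩
  have hl : 0 < lam := hlam0.trans_le hlam
  rw [Multiset.map_add, Multiset.prod_add, norm_mul, prod_map_mul_left_sub _ hl,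
    ← Multiset.countP_eq_card_filter, hcount]
  have hs : ‖glue ξ τ‖ ≤ 1 + |τ| := (norm_glue_le ξ τ).trans (by linarith)
  have e1 : 1 / 2 * (1 + ‖glue ξ τ‖) ≤ 1 + |τ| := by linarith [abs_nonneg τ]
  have e2 : (1 + 1 / lam0)⁻¹ * (lam + ‖glue ξ τ‖) ≤ lam + |τ| := by
    rw [inv_mul_le_iff₀ (by positivity)]
    have : 1 ≤ 1 / lam0 * lam := by rw [one_div, ← div_eq_inv_mul, one_le_div hlam0]; exact hlam
    have h3 : 0 ≤ 1 / lam0 * |τ| := by positivity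
    nlinarith [abs_nonneg τ]
  have e3 := h2 (τ / lam)
  calc _ = (c₁ * (1 / 2 * (1 + ‖glue ξ τ‖)) ^ μ) *
        (c₂ * ((1 + 1 / lam0)⁻¹ * (lam + ‖glue ξ τ‖)) ^ (m - μ)) := by
        rw [prodWeight, mul_pow, mul_pow]; ring
    _ ≤ (c₁ * (1 + |τ|) ^ μ) * (c₂ * (lam + |τ|) ^ (m - μ)) := by gcongr
    _ = (c₁ * (1 + |τ|) ^ μ) * (lam ^ (m - μ) * (c₂ * (1 + |τ / lam|) ^ (m - μ))) := by
        rw [← mul_one_add_abs_div hl]; ring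
    _ ≤ _ := by
        gcongr
        exact h1 τ

omit hA hμ hell hreg in
-- Bernoulli: (τ²/(τ²+1))^μ ≥ 1 - μ/(τ²+1), and the last quotient is at most ε for |τ| large.
theorem sq_add_one_pow_sub_le {ε : ℝ} (hε : 0 < ε) : ∃ T > 0, ∀ τ : ℝ, T ≤ |τ| →
    ‖((τ : ℂ) ^ (2 * μ) - ((τ : ℂ) ^ 2 + 1) ^ μ)‖ ≤ ε * (1 + |τ|) ^ (2 * μ) := by
  refine ⟨1 + μ / ε, by positivity, fun τ hτ => ?_⟩
  have h0 : (τ : ℂ) ^ (2 * μ) - ((τ : ℂ) ^ 2 + 1) ^ μ = (((τ ^ 2) ^ μ - (τ ^ 2 + 1) ^ μ : ℝ) : ℂ) := by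
    push_cast; rw [pow_mul]
  have ht : 0 < τ ^ 2 + 1 := by positivity
  have h1 : (τ ^ 2) ^ μ ≤ (τ ^ 2 + 1) ^ μ := by gcongr; linarith
  have h2 := one_add_mul_le_pow (a := -(1 / (τ ^ 2 + 1))) (by
    have : 1 / (τ ^ 2 + 1) ≤ 1 := by rw [div_le_one ht]; nlinarith
    linarith) μ
  have h3 : (1 + -(1 / (τ ^ 2 + 1))) ^ μ * (τ ^ 2 + 1) ^ μ = (τ ^ 2) ^ μ := by
    rw [← mul_pow]; congr 1; field_simp; ring
  have h4 : 1 + μ / ε ≤ τ ^ 2 + 1 := by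
    rw [← sq_abs]
    have : 0 ≤ μ / ε := by positivity
    nlinarith
  have h5 : μ * (1 / (τ ^ 2 + 1)) ≤ ε := by
    rw [mul_one_div, div_le_iff₀ ht]
    have h6 : (μ : ℝ) = μ / ε * ε := by field_simp
    nlinarith
  have h7 : (τ ^ 2 + 1) ^ μ ≤ (1 + |τ|) ^ (2 * μ) := by
    rw [pow_mul]
    gcongr
    rw [← sq_abs]
    nlinarith [abs_nonneg τ]
  rw [h0, Complex.norm_real, Real.norm_eq_abs, abs_of_nonpos (by linarith)]
  have h8 : (τ ^ 2 + 1) ^ μ - (τ ^ 2) ^ μ ≤ ε * (τ ^ 2 + 1) ^ μ := by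
    rw [← h3]
    have : 0 < (τ ^ 2 + 1) ^ μ := by positivity
    nlinarith
  calc _ ≤ ε * (τ ^ 2 + 1) ^ μ := by linarith
    _ ≤ _ := by gcongr

omit hA hμ hell hreg in
theorem filter_im_neg_add_filter_im_pos {s : Multiset ℂ} (h : ∀ z ∈ s, z.im ≠ 0) :
    (s.filter fun z => z.im < 0) + (s.filter fun z => 0 < z.im) = s := by
  conv_rhs => rw [← Multiset.filter_add_not (fun z : ℂ => z.im < 0) s]
  congr 1
  refine Multiset.filter_congr fun z hz => ?_
  rw [not_lt]
  exact ⟨le_of_lt, fun h1 => lt_of_le_of_ne h1 (h z hz).symm⟩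

/-- The factors are (τ ± i)^μ times the products of τ - λκ over the roots κ of Q in one half-plane.
Their product differs from the symbol at ξ' = 0 only by (τ²+1)^μ in place of τ^(2μ). The error is
relatively small at high τ and of lower order at bounded τ. -/
theorem exists_low_factorization {lam0 : ℝ} (hlam0 : 0 < lam0) : ∃ c > 0, ∀ ε > 0, ∃ C > 0,
    ∀ lam ≥ lam0, ∀ ξ : Rn d, ‖ξ‖ ≤ 1 → ∃ s s' : Multiset ℂ, (∀ ζ ∈ s, ζ.im < 0) ∧ s'.card = m ∧
      ∀ τ : ℝ, c * prodWeight m μ ‖glue ξ τ‖ lam ≤ ‖(s.map fun ζ => (τ : ℂ) - ζ).prod‖ ∧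
        c * prodWeight m μ ‖glue ξ τ‖ lam ≤ ‖(s'.map fun ζ => (τ : ℂ) - ζ).prod‖ ∧
        ‖symbol m μ A (glue ξ τ) lam - MvPolynomial.eval (complexGlue (0 : Rn d) 1) (A (2 * m)) *
          ((s.map fun ζ => (τ : ℂ) - ζ).prod * (s'.map fun ζ => (τ : ℂ) - ζ).prod)‖ ≤
          prodWeight m μ ‖glue ξ τ‖ lam *
            (ε * prodWeight m μ ‖glue ξ τ‖ lam + C * lam ^ (m - μ)) := by
  have hneg := auxPoly_countP_neg hA hμ hell hreg
  obtain ⟨c₁, hc₁, h1⟩ := exists_prod_low_ge hA hell hlam0 (fun z => z.im < 0) hneg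
    (z₀ := -Complex.I) (by simp)
  obtain ⟨c₂, hc₂, h2⟩ := exists_prod_low_ge hA hell hlam0 (fun z => 0 < z.im) hreg
    (z₀ := Complex.I) (by simp)
  obtain ⟨C₀, hC₀, hC0⟩ := exists_norm_symbol_le hA
  obtain ⟨C₁, hC₁, hC1⟩ := exists_prod_le (auxPoly m μ A).roots
  set a := MvPolynomial.eval (complexGlue (0 : Rn d) 1) (A (2 * m)) with ha
  have ha0 : a ≠ 0 := leadingCoeff_ne_zero hμ hell
  refine ⟨min c₁ c₂, by positivity, fun ε hε => ?_⟩
  obtain ⟨T₁, hT₁, hT1⟩ := exists_norm_symbol_sub_le hA (half_pos hε)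
  obtain ⟨T₂, hT₂, hT2⟩ := sq_add_one_pow_sub_le (μ := μ)
    (show 0 < ε / 2 / (‖a‖ * C₁) by positivity)
  set T := max T₁ T₂ with hT
  -- For |τ| ≤ T the weight is at most K λ^(m-μ). The whole difference, bounded by (C₀ + ‖a‖C₁)
  -- times the squared weight, is then absorbed by the lower-order term.
  set K := (2 + T) ^ μ * (1 + (1 + T) / lam0) ^ (m - μ) with hK
  have hT0 : 0 < T := lt_max_of_lt_left hT₁
  have hK0 : 0 < K := by positivity
  refine ⟨(C₀ + ‖a‖ * C₁) * K, by positivity, fun lam hlam ξ hξ => ?_⟩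
  have hl : 0 < lam := hlam0.trans_le hlam
  refine ⟨Multiset.replicate μ (-Complex.I) +
    ((auxPoly m μ A).roots.filter fun z => z.im < 0).map fun κ => (lam : ℂ) * κ,
    Multiset.replicate μ Complex.I +
    ((auxPoly m μ A).roots.filter fun z => 0 < z.im).map fun κ => (lam : ℂ) * κ, ?_, ?_, ?_⟩
  · intro ζ hζ
    rcases Multiset.mem_add.1 hζ with h | h
    · rw [Multiset.eq_of_mem_replicate h]; simp
    · obtain ⟨κ, hκ, rfl⟩ := Multiset.mem_map.1 h
      have := (Multiset.mem_filter.1 hκ).2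
      rw [Complex.im_ofReal_mul]
      nlinarith
  · rw [Multiset.card_add, Multiset.card_replicate, Multiset.card_map,
      ← Multiset.countP_eq_card_filter]
    have : (auxPoly m μ A).roots.countP (fun z => 0 < z.im) = m - μ := hreg
    omega
  intro τ
  have e1 := h1 lam hlam ξ hξ τ
  have e2 := h2 lam hlam ξ hξ τ
  have hs0 : 0 ≤ ‖glue ξ τ‖ := norm_nonneg _
  have hsτ : |τ| ≤ ‖glue ξ τ‖ := abs_le_norm_glue ξ τ
  have hY := prodWeight_pos (m := m) (μ := μ) hs0 hl
  have hsym := hC0 lam hl ξ τ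
  refine ⟨(mul_le_mul_of_nonneg_right (min_le_left _ _) hY.le).trans e1,
    (mul_le_mul_of_nonneg_right (min_le_right _ _) hY.le).trans e2, ?_⟩
  set E := (((auxPoly m μ A).roots.map fun κ => (lam : ℂ) * κ).map fun z => (τ : ℂ) - z).prod
    with hE
  have hEle : ‖E‖ ≤ C₁ * (lam + |τ|) ^ (2 * (m - μ)) := by
    rw [hE, prod_map_mul_left_sub _ hl, auxPoly_card_roots hA hμ hell, ← mul_one_add_abs_div hl]
    have := hC1 (τ / lam)
    rw [auxPoly_card_roots hA hμ hell] at this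
    calc _ ≤ lam ^ (2 * (m - μ)) * (C₁ * (1 + |τ / lam|) ^ (2 * (m - μ))) := by gcongr
      _ = _ := by ring
  have hsq : ∀ x ≥ 0, x ≤ (1 + |τ|) ^ (2 * μ) → x * (lam + |τ|) ^ (2 * (m - μ)) ≤
      prodWeight m μ ‖glue ξ τ‖ lam ^ 2 := by
    intro x hx0 hx
    rw [prodWeight, mul_pow, ← pow_mul, ← pow_mul, mul_comm μ, mul_comm (m - μ)]
    calc _ ≤ (1 + |τ|) ^ (2 * μ) * (lam + |τ|) ^ (2 * (m - μ)) := by gcongr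
      _ ≤ _ := by gcongr
  have hprod : ((Multiset.replicate μ (-Complex.I) +
      ((auxPoly m μ A).roots.filter fun z => z.im < 0).map fun κ => (lam : ℂ) * κ).map
        fun z => (τ : ℂ) - z).prod * ((Multiset.replicate μ Complex.I +
      ((auxPoly m μ A).roots.filter fun z => 0 < z.im).map fun κ => (lam : ℂ) * κ).map
        fun z => (τ : ℂ) - z).prod = ((τ : ℂ) ^ 2 + 1) ^ μ * E := by
    have hf : ((auxPoly m μ A).roots.filter fun z => z.im < 0) +
        ((auxPoly m μ A).roots.filter fun z => 0 < z.im) = (auxPoly m μ A).roots :=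
      filter_im_neg_add_filter_im_pos (auxPoly_im_ne_zero hA hell)
    rw [hE]
    conv_rhs => rw [← hf]
    simp only [Multiset.map_add, Multiset.prod_add, Multiset.map_replicate,
      Multiset.prod_replicate]
    have h3 : (τ : ℂ) ^ 2 + 1 = (τ - -Complex.I) * (τ - Complex.I) := by
      ring_nf; rw [Complex.I_sq]; ring
    rw [h3, mul_pow]
    ring
  have hzero : symbol m μ A (glue 0 τ) lam = a * ((τ : ℂ) ^ (2 * μ) * E) := by
    rw [← eval_symbolPoly_ofReal, eval_symbolPoly_eq_prod hA hμ hell 0 hl, smul_zero,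
      auxPoly_roots hA hμ hell, ← ha, hE, Multiset.map_map]
    simp
  rw [hprod]
  rcases le_total T |τ| with hτ | hτ
  · have f1 := hT1 lam hl ξ τ hξ ((le_max_left _ _).trans hτ)
    have f2 := hT2 τ ((le_max_right _ _).trans hτ)
    have f3 : symbol m μ A (glue ξ τ) lam - a * (((τ : ℂ) ^ 2 + 1) ^ μ * E) =
        (symbol m μ A (glue ξ τ) lam - symbol m μ A (glue 0 τ) lam) +
          a * (((τ : ℂ) ^ (2 * μ) - ((τ : ℂ) ^ 2 + 1) ^ μ) * E) := by
      rw [hzero]; ring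
    have f4 : ‖a * (((τ : ℂ) ^ (2 * μ) - ((τ : ℂ) ^ 2 + 1) ^ μ) * E)‖ ≤
        ε / 2 * prodWeight m μ ‖glue ξ τ‖ lam ^ 2 := by
      rw [norm_mul, norm_mul]
      calc _ ≤ ‖a‖ * (ε / 2 / (‖a‖ * C₁) * (1 + |τ|) ^ (2 * μ) *
            (C₁ * (lam + |τ|) ^ (2 * (m - μ)))) := by gcongr
        _ = ε / 2 * ((1 + |τ|) ^ (2 * μ) * (lam + |τ|) ^ (2 * (m - μ))) := by
            field_simp
        _ ≤ _ := by
            gcongr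
            exact hsq _ (by positivity) le_rfl
    rw [f3]
    refine (norm_add_le _ _).trans ((add_le_add f1 f4).trans ?_)
    have : 0 ≤ prodWeight m μ ‖glue ξ τ‖ lam * ((C₀ + ‖a‖ * C₁) * K * lam ^ (m - μ)) := by
      positivity
    nlinarith
  · have hsT : ‖glue ξ τ‖ ≤ 1 + T := (norm_glue_le ξ τ).trans (by linarith)
    have g1 : prodWeight m μ ‖glue ξ τ‖ lam ≤ K * lam ^ (m - μ) := by
      have : lam + ‖glue ξ τ‖ ≤ (1 + (1 + T) / lam0) * lam := by
        have h4 : 1 + T ≤ (1 + T) / lam0 * lam := by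
          rw [div_mul_eq_mul_div, le_div_iff₀ hlam0]; gcongr
        linarith
      rw [prodWeight, hK, mul_assoc, ← mul_pow]
      exact mul_le_mul (pow_le_pow_left₀ (by positivity) (by linarith) _)
        (pow_le_pow_left₀ (by positivity) this _) (by positivity) (by positivity)
    have g2 : ‖a * (((τ : ℂ) ^ 2 + 1) ^ μ * E)‖ ≤
        ‖a‖ * C₁ * prodWeight m μ ‖glue ξ τ‖ lam ^ 2 := by
      rw [norm_mul, norm_mul, mul_assoc]
      have h5 : ‖((τ : ℂ) ^ 2 + 1) ^ μ‖ ≤ (1 + |τ|) ^ (2 * μ) := by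
        rw [norm_pow, pow_mul]
        refine pow_le_pow_left₀ (norm_nonneg _) ((norm_add_le _ _).trans ?_) _
        rw [norm_pow, Complex.norm_real, Real.norm_eq_abs, norm_one]
        nlinarith [abs_nonneg τ]
      refine mul_le_mul_of_nonneg_left ?_ (norm_nonneg _)
      calc _ ≤ ‖((τ : ℂ) ^ 2 + 1) ^ μ‖ * (C₁ * (lam + |τ|) ^ (2 * (m - μ))) :=
            mul_le_mul_of_nonneg_left hEle (norm_nonneg _)
        _ = C₁ * (‖((τ : ℂ) ^ 2 + 1) ^ μ‖ * (lam + |τ|) ^ (2 * (m - μ))) := by ring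
        _ ≤ _ := mul_le_mul_of_nonneg_left (hsq _ (norm_nonneg _) h5) hC₁.le
    refine (norm_sub_le _ _).trans ((add_le_add hsym g2).trans ?_)
    have : 0 ≤ ε * prodWeight m μ ‖glue ξ τ‖ lam := by positivity
    calc _ = prodWeight m μ ‖glue ξ τ‖ lam *
          ((C₀ + ‖a‖ * C₁) * prodWeight m μ ‖glue ξ τ‖ lam) := by ring
      _ ≤ prodWeight m μ ‖glue ξ τ‖ lam * ((C₀ + ‖a‖ * C₁) * (K * lam ^ (m - μ))) := by gcongr
      _ ≤ _ := by
          gcongr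
          rw [mul_assoc]
          linarith

/-- Up to an error of lower order, the symbol is the product of a factor with zeros in the lower
half-plane and of another factor, each of them comparable with the weight. -/
theorem exists_factorization (hprop : ProperlyElliptic m μ A) {lam0 : ℝ} (hlam0 : 0 < lam0) :
    ∃ c > 0, ∀ ε > 0, ∃ C > 0, ∀ lam ≥ lam0, ∀ ξ : Rn d, ∃ s s' : Multiset ℂ,
      (∀ ζ ∈ s, ζ.im < 0) ∧ s'.card = m ∧
      ∀ τ : ℝ, c * prodWeight m μ ‖glue ξ τ‖ lam ≤ ‖(s.map fun ζ => (τ : ℂ) - ζ).prod‖ ∧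
        c * prodWeight m μ ‖glue ξ τ‖ lam ≤ ‖(s'.map fun ζ => (τ : ℂ) - ζ).prod‖ ∧
        ‖symbol m μ A (glue ξ τ) lam - MvPolynomial.eval (complexGlue (0 : Rn d) 1) (A (2 * m)) *
          ((s.map fun ζ => (τ : ℂ) - ζ).prod * (s'.map fun ζ => (τ : ℂ) - ζ).prod)‖ ≤
          prodWeight m μ ‖glue ξ τ‖ lam *
            (ε * prodWeight m μ ‖glue ξ τ‖ lam + C * lam ^ (m - μ)) := by
  have hup : ∀ ζ : Rn d, ζ ≠ 0 → (symbolPoly m μ A ζ 1).roots.countP (fun z => 0 < z.im) = m :=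
    fun ζ hζ => hprop ζ hζ 1 zero_le_one
  have hlow : ∀ ζ : Rn d, ζ ≠ 0 →
      (symbolPoly m μ A ζ 1).roots.countP (fun z => z.im < 0) = m := by
    intro ζ hζ
    have h1 := countP_add_countP_roots hA hμ hell hζ zero_le_one
    have h2 := hup ζ hζ
    omega
  obtain ⟨η, hη, κ, hκ, hlarge⟩ := exists_countP_large hA hμ hell hreg
  obtain ⟨c₁, hc₁, h1⟩ := exists_prod_roots_ge hA hμ hell hlam0 _ hlow
    ⟨η, hη, κ, hκ, fun ζ hζ => (hlarge ζ hζ).2⟩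
  obtain ⟨c₂, hc₂, h2⟩ := exists_prod_roots_ge hA hμ hell hlam0 _ hup
    ⟨η, hη, κ, hκ, fun ζ hζ => (hlarge ζ hζ).1⟩
  obtain ⟨c₃, hc₃, h3⟩ := exists_low_factorization hA hμ hell hreg hlam0
  refine ⟨min c₃ (min c₁ c₂), by positivity, fun ε hε => ?_⟩
  obtain ⟨C, hC, h4⟩ := h3 ε hε
  refine ⟨C, hC, fun lam hlam ξ => ?_⟩
  have hl : 0 < lam := hlam0.trans_le hlam
  rcases le_total ‖ξ‖ 1 with hξ | hξ
  · obtain ⟨s, s', hs, hs', h5⟩ := h4 lam hlam ξ hξ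
    refine ⟨s, s', hs, hs', fun τ => ?_⟩
    have hY := prodWeight_pos (m := m) (μ := μ) (norm_nonneg (glue ξ τ)) hl
    have hmin := mul_le_mul_of_nonneg_right (min_le_left c₃ (min c₁ c₂)) hY.le
    exact ⟨hmin.trans (h5 τ).1, hmin.trans (h5 τ).2.1, (h5 τ).2.2⟩
  -- For |ξ'| ≥ 1 the lower and upper roots give an exact factorization, so the error term is zero.
  · have hξ0 : lam⁻¹ • ξ ≠ 0 :=
      smul_ne_zero (inv_ne_zero hl.ne') (norm_pos_iff.1 (zero_lt_one.trans_le hξ))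
    refine ⟨((symbolPoly m μ A (lam⁻¹ • ξ) 1).roots.filter fun z => z.im < 0).map
        fun κ => (lam : ℂ) * κ, ((symbolPoly m μ A (lam⁻¹ • ξ) 1).roots.filter
        fun z => 0 < z.im).map fun κ => (lam : ℂ) * κ, ?_, ?_, fun τ => ⟨?_, ?_, ?_⟩⟩
    · intro ζ hζ
      obtain ⟨κ, hκ, rfl⟩ := Multiset.mem_map.1 hζ
      have := (Multiset.mem_filter.1 hκ).2
      rw [Complex.im_ofReal_mul]
      nlinarith
    · rw [Multiset.card_map, ← Multiset.countP_eq_card_filter, hup _ hξ0]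
    · have hY := prodWeight_pos (m := m) (μ := μ) (norm_nonneg (glue ξ τ)) hl
      refine le_trans ?_ (h1 lam hlam ξ hξ τ)
      gcongr
      exact (min_le_right _ _).trans (min_le_left _ _)
    · have hY := prodWeight_pos (m := m) (μ := μ) (norm_nonneg (glue ξ τ)) hl
      refine le_trans ?_ (h2 lam hlam ξ hξ τ)
      gcongr
      exact (min_le_right _ _).trans (min_le_right _ _)
    · have hY := prodWeight_pos (m := m) (μ := μ) (norm_nonneg (glue ξ τ)) hl
      rw [← Multiset.prod_add, ← Multiset.map_add, ← Multiset.map_add,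
        filter_im_neg_add_filter_im_pos (im_ne_zero_of_mem_roots hell hξ0 zero_le_one),
        Multiset.map_map, ← eval_symbolPoly_ofReal, eval_symbolPoly_eq_prod hA hμ hell ξ hl]
      simp only [Function.comp_def, sub_self, norm_zero]
      positivity

end Factorization

/-! ### Comparison of the Newton polygon weights with products. -/

section Weights

variable {n d m μ : ℕ}

theorem Xi_nonneg {l : ℕ} {lam : ℝ} (hlam : 0 ≤ lam) (ξ : Rn n) : 0 ≤ Xi m μ l lam ξ :=
  Finset.sum_nonneg fun p _ => by positivity

theorem monomial_le_Xi {l i k : ℕ} {lam : ℝ} (hlam : 0 ≤ lam) (ξ : Rn n) (hk : k + μ ≤ m)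
    (hik : i + k + l ≤ m) : ‖ξ‖ ^ i * lam ^ k ≤ Xi m μ l lam ξ := by
  unfold Xi
  refine Finset.single_le_sum (f := fun p : ℕ × ℕ => ‖ξ‖ ^ p.1 * lam ^ p.2)
    (fun p _ => by positivity) (a := (i, k)) ?_
  simp only [Finset.mem_filter, Finset.mem_product, Finset.mem_range]
  omega

theorem pow_le_Xi (hμ : μ < m) {lam : ℝ} (hlam : 0 ≤ lam) (ξ : Rn n) :
    lam ^ (m - μ) ≤ Xi m μ 0 lam ξ := by
  simpa using monomial_le_Xi (m := m) (μ := μ) (l := 0) (i := 0) (k := m - μ) hlam ξ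
    (by omega) (by omega)

theorem Xi_pos (hμ : μ < m) {lam : ℝ} (hlam : 0 < lam) (ξ : Rn n) : 0 < Xi m μ 0 lam ξ :=
  lt_of_lt_of_le (by positivity) (pow_le_Xi hμ hlam.le ξ)

theorem continuous_Xi (m μ l : ℕ) (lam : ℝ) : Continuous fun ξ : Rn n => Xi m μ l lam ξ := by
  unfold Xi; fun_prop

/-- If i exceeds μ, the i - μ surplus factors x are traded for y ≥ x, and i + k ≤ m bounds the
resulting exponent of y by m - μ. -/
theorem monomial_le {x y : ℝ} (hx : 1 ≤ x) (hxy : x ≤ y) {i k : ℕ} (hk : k + μ ≤ m)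
    (hik : i + k ≤ m) : x ^ i * y ^ k ≤ x ^ μ * y ^ (m - μ) := by
  have hy : 1 ≤ y := hx.trans hxy
  have hx0 : 0 ≤ x := by linarith
  rcases le_total i μ with h | h
  · exact mul_le_mul (pow_le_pow_right₀ hx h) (pow_le_pow_right₀ hy (by omega)) (by positivity)
      (by positivity)
  · obtain ⟨j, rfl⟩ := Nat.exists_eq_add_of_le h
    calc x ^ (μ + j) * y ^ k ≤ x ^ μ * (y ^ j * y ^ k) := by
          rw [pow_add, mul_assoc]; gcongr
      _ ≤ _ := by
          rw [← pow_add]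
          gcongr
          omega

theorem exists_Xi_le {lam0 : ℝ} (hlam0 : 0 < lam0) : ∃ C > 0, ∀ lam ≥ lam0,
    ∀ ξ : Rn n, Xi m μ 0 lam ξ ≤ C * prodWeight m μ ‖ξ‖ lam := by
  -- Chosen so that 1 + |ξ| ≤ (λ+|ξ|)/b for λ ≥ λ₀; the loss is a power of 1/b.
  set b := min 1 lam0 with hb
  have hb0 : 0 < b := by positivity
  have hb1 : b ≤ 1 := min_le_left _ _
  set N := ((Finset.range (m + 1) ×ˢ Finset.range (m + 1)).filter
    (fun p => p.2 + μ ≤ m ∧ p.1 + p.2 + 0 ≤ m)).card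
  refine ⟨(N + 1) * b⁻¹ ^ (m - μ), by positivity, fun lam hlam ξ => ?_⟩
  have hl : 0 < lam := hlam0.trans_le hlam
  have hs := norm_nonneg ξ
  have hxy : 1 + ‖ξ‖ ≤ (lam + ‖ξ‖) / b := by
    rw [le_div_iff₀ hb0]
    have := min_le_right 1 lam0
    nlinarith
  have key : ∀ p ∈ (Finset.range (m + 1) ×ˢ Finset.range (m + 1)).filter
      (fun p => p.2 + μ ≤ m ∧ p.1 + p.2 + 0 ≤ m), ‖ξ‖ ^ p.1 * lam ^ p.2 ≤
        b⁻¹ ^ (m - μ) * prodWeight m μ ‖ξ‖ lam := by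
    intro p hp
    have hp' := (Finset.mem_filter.1 hp).2
    have h1 := monomial_le (m := m) (μ := μ) (by linarith) hxy hp'.1 hp'.2
    have h2 : lam ≤ (lam + ‖ξ‖) / b := by
      rw [le_div_iff₀ hb0]; nlinarith
    calc _ ≤ (1 + ‖ξ‖) ^ p.1 * ((lam + ‖ξ‖) / b) ^ p.2 := by
          gcongr
          linarith
      _ ≤ _ := h1
      _ = _ := by rw [prodWeight, div_pow, inv_pow]; ring
  unfold Xi
  refine (Finset.sum_le_card_nsmul _ _ _ key).trans ?_
  rw [nsmul_eq_mul, mul_assoc]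
  have hY := prodWeight_pos (m := m) (μ := μ) hs hl
  refine mul_le_mul_of_nonneg_right ?_ (by positivity)
  exact (lt_add_one _).le

theorem exists_prodWeight_le (hμ : μ < m) : ∃ C > 0, ∀ lam > 0,
    ∀ ξ : Rn n, prodWeight m μ ‖ξ‖ lam ≤ C * Xi m μ 0 lam ξ := by
  refine ⟨2 ^ μ * 2 ^ (m - μ) * 4, by positivity, fun lam hl ξ => ?_⟩
  have hs := norm_nonneg ξ
  have h2 : ∀ x y : ℝ, 0 ≤ x → 0 ≤ y → ∀ k : ℕ, (x + y) ^ k ≤ 2 ^ k * (x ^ k + y ^ k) := by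
    intro x y hx hy k
    refine (add_pow_le hx hy k).trans ?_
    have : (2 : ℝ) ^ (k - 1) ≤ 2 ^ k := pow_le_pow_right₀ one_le_two (Nat.sub_le _ _)
    gcongr
  have a1 := h2 1 ‖ξ‖ zero_le_one hs μ
  have a2 := h2 lam ‖ξ‖ hl.le hs (m - μ)
  -- Expanding the two binomials leaves four monomials, each of them a lattice point of the polygon.
  have b1 := monomial_le_Xi (m := m) (μ := μ) (l := 0) (i := 0) (k := m - μ) hl.le ξ
    (by omega) (by omega)
  have b2 := monomial_le_Xi (m := m) (μ := μ) (l := 0) (i := m - μ) (k := 0) hl.le ξ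
    (by omega) (by omega)
  have b3 := monomial_le_Xi (m := m) (μ := μ) (l := 0) (i := μ) (k := m - μ) hl.le ξ
    (by omega) (by omega)
  have b4 := monomial_le_Xi (m := m) (μ := μ) (l := 0) (i := μ + (m - μ)) (k := 0) hl.le ξ
    (by omega) (by omega)
  rw [pow_zero, one_mul] at b1
  rw [pow_zero, mul_one] at b2 b4
  rw [pow_add] at b4
  rw [one_pow] at a1
  calc prodWeight m μ ‖ξ‖ lam
      ≤ (2 ^ μ * (1 + ‖ξ‖ ^ μ)) * (2 ^ (m - μ) * (lam ^ (m - μ) + ‖ξ‖ ^ (m - μ))) := by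
        unfold prodWeight; gcongr
    _ = 2 ^ μ * 2 ^ (m - μ) * (lam ^ (m - μ) + ‖ξ‖ ^ (m - μ) + ‖ξ‖ ^ μ * lam ^ (m - μ) +
          ‖ξ‖ ^ μ * ‖ξ‖ ^ (m - μ)) := by ring
    _ ≤ 2 ^ μ * 2 ^ (m - μ) * (4 * Xi m μ 0 lam ξ) := by gcongr; linarith
    _ = _ := by ring

/-- Multiplication by |τ|^l moves the shifted polygon back: (i, k) becomes (i + l, k), a point of
the unshifted polygon. -/
theorem exists_Xi_mul_pow_le : ∃ C > 0, ∀ l : ℕ, ∀ lam > 0, ∀ (ξ : Rn d) (τ : ℝ),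
    Xi m μ l lam ξ * |τ| ^ l ≤ C * Xi m μ 0 lam (glue ξ τ) := by
  refine ⟨((m + 1) * (m + 1) : ℕ), by positivity, fun l lam hl ξ τ => ?_⟩
  conv_lhs => unfold Xi
  rw [Finset.sum_mul]
  refine (Finset.sum_le_card_nsmul _ _ (Xi m μ 0 lam (glue ξ τ)) fun p hp => ?_).trans ?_
  · have hp' := (Finset.mem_filter.1 hp).2
    refine le_trans ?_ (monomial_le_Xi (l := 0) (i := p.1 + l) hl.le (glue ξ τ) hp'.1 (by omega))
    rw [pow_add]
    have h1 := norm_le_norm_glue ξ τ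
    have h2 := abs_le_norm_glue ξ τ
    calc _ = ‖ξ‖ ^ p.1 * |τ| ^ l * lam ^ p.2 := by ring
      _ ≤ _ := by gcongr
  · rw [nsmul_eq_mul]
    have := Xi_nonneg (m := m) (μ := μ) (l := 0) hl.le (glue ξ τ)
    gcongr
    refine (Finset.card_filter_le _ _).trans ?_
    rw [Finset.card_product, Finset.card_range]

/-- Scale of the lift of the Dirichlet datum of order `i`. -/
def liftScale {n : ℕ} (μ i : ℕ) (lam : ℝ) (ξ : Rn n) : ℝ := if i + 1 ≤ μ then 1 + ‖ξ‖ else lam + ‖ξ‖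

theorem liftScale_pos {i : ℕ} {lam : ℝ} (hlam : 0 < lam) (ξ : Rn n) : 0 < liftScale μ i lam ξ := by
  unfold liftScale; split_ifs <;> positivity

theorem prodWeight_mono {s t lam : ℝ} (hs : 0 ≤ s) (hst : s ≤ t) (hlam : 0 < lam) :
    prodWeight m μ s lam ≤ prodWeight m μ t lam := by
  unfold prodWeight
  exact mul_le_mul (pow_le_pow_left₀ (by positivity) (by linarith) _)
    (pow_le_pow_left₀ (by positivity) (by linarith) _) (by positivity)
    (pow_nonneg (by linarith) _)

/-- The cost of a lift in frequency is weight times height σ^(-(i+1)) times the square root of a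
length σ. The resulting power of σ is -(j - 1/2) with j = i + 1, which is exactly the shift in the
boundary norm. -/
theorem exists_prodWeight_mul_le (hμ : μ < m) {lam0 : ℝ} (hlam0 : 0 < lam0) : ∃ C > 0, ∀ i < m,
    ∀ lam ≥ lam0, ∀ (ξ : Rn d) (τ : ℝ), |τ| ≤ liftScale μ i lam ξ →
      prodWeight m μ ‖glue ξ τ‖ lam * (liftScale μ i lam ξ ^ (i + 1))⁻¹ *
        liftScale μ i lam ξ ^ (1 / 2 : ℝ) ≤
        C * XiReal m μ (((i + 1 : ℕ) : ℝ) - 1 / 2) lam ξ := by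
  set K := 2 + 1 / lam0 with hK
  have hK0 : 0 < K := by positivity
  refine ⟨2 ^ μ * K ^ (m - μ) + K ^ μ * 2 ^ (m - μ), by positivity,
    fun i hi lam hlam ξ τ hτ => ?_⟩
  have hl : 0 < lam := hlam0.trans_le hlam
  have hs := norm_nonneg ξ
  have hw := prodWeight_mono (m := m) (μ := μ) (norm_nonneg _) (norm_glue_le ξ τ) hl
  have hab : 1 + ‖ξ‖ ≤ (1 + 1 / lam0) * (lam + ‖ξ‖) := by
    have h1 : 1 ≤ 1 / lam0 * lam := by rw [one_div, ← div_eq_inv_mul, one_le_div hlam0]; exact hlam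
    have h2 : 0 ≤ 1 / lam0 * ‖ξ‖ := by positivity
    nlinarith
  have hexp : ∀ σ : ℝ, 0 < σ → (σ ^ (i + 1))⁻¹ * σ ^ (1 / 2 : ℝ) =
      σ ^ (-(((i + 1 : ℕ) : ℝ) - 1 / 2)) := by
    intro σ hσ
    rw [← Real.rpow_natCast, ← Real.rpow_neg hσ.le, ← Real.rpow_add hσ]
    congr 1; ring
  rw [mul_assoc, hexp _ (liftScale_pos hl ξ)]
  unfold liftScale at hτ ⊢
  split_ifs at hτ ⊢ with h
  -- Here j ≤ μ and σ = 1 + |ξ'|: for |τ| ≤ σ both factors of the weight are bounded by multiples of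
  -- their values at τ = 0, and the power of σ lowers the first one.
  · have ha : 0 < 1 + ‖ξ‖ := by positivity
    have e1 : prodWeight m μ (‖ξ‖ + |τ|) lam ≤
        2 ^ μ * K ^ (m - μ) * ((1 + ‖ξ‖) ^ μ * (lam + ‖ξ‖) ^ (m - μ)) := by
      calc _ ≤ (2 * (1 + ‖ξ‖)) ^ μ * (K * (lam + ‖ξ‖)) ^ (m - μ) := by
            unfold prodWeight
            have h1 : 1 + (‖ξ‖ + |τ|) ≤ 2 * (1 + ‖ξ‖) := by linarith
            have h2 : lam + (‖ξ‖ + |τ|) ≤ K * (lam + ‖ξ‖) := by rw [hK]; linarith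
            exact mul_le_mul (pow_le_pow_left₀ (by positivity) h1 _)
              (pow_le_pow_left₀ (by positivity) h2 _) (by positivity) (by positivity)
        _ = _ := by rw [mul_pow, mul_pow]; ring
    have hij : ((i + 1 : ℕ) : ℝ) ≤ μ := by exact_mod_cast h
    have e2 : XiReal m μ (((i + 1 : ℕ) : ℝ) - 1 / 2) lam ξ =
        ((1 + ‖ξ‖) ^ μ * (lam + ‖ξ‖) ^ (m - μ)) *
          (1 + ‖ξ‖) ^ (-(((i + 1 : ℕ) : ℝ) - 1 / 2)) := by
      rw [XiReal, max_eq_left (by linarith), max_eq_left (by linarith), sub_eq_add_neg,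
        Real.rpow_add ha, Real.rpow_natCast, ← Nat.cast_sub hμ.le, Real.rpow_natCast]
      ring
    rw [e2]
    have e3 : 0 < (1 + ‖ξ‖) ^ (-(((i + 1 : ℕ) : ℝ) - 1 / 2)) := Real.rpow_pos_of_pos ha _
    calc _ ≤ 2 ^ μ * K ^ (m - μ) * ((1 + ‖ξ‖) ^ μ * (lam + ‖ξ‖) ^ (m - μ)) *
          (1 + ‖ξ‖) ^ (-(((i + 1 : ℕ) : ℝ) - 1 / 2)) := by gcongr; exact hw.trans e1
      _ ≤ (2 ^ μ * K ^ (m - μ) + K ^ μ * 2 ^ (m - μ)) *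
          ((1 + ‖ξ‖) ^ μ * (lam + ‖ξ‖) ^ (m - μ)) *
          (1 + ‖ξ‖) ^ (-(((i + 1 : ℕ) : ℝ) - 1 / 2)) := by
          gcongr
          exact le_add_of_nonneg_right (by positivity)
      _ = _ := by ring
  -- Here j > μ and σ = λ + |ξ'|: both factors are bounded by multiples of σ, so the weight
  -- collapses to σ^m.
  · have ha : 0 < lam + ‖ξ‖ := by positivity
    have e1 : prodWeight m μ (‖ξ‖ + |τ|) lam ≤ K ^ μ * 2 ^ (m - μ) * (lam + ‖ξ‖) ^ m := by
      calc _ ≤ (K * (lam + ‖ξ‖)) ^ μ * (2 * (lam + ‖ξ‖)) ^ (m - μ) := by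
            unfold prodWeight
            have h1 : 1 + (‖ξ‖ + |τ|) ≤ K * (lam + ‖ξ‖) := by rw [hK]; linarith
            have h2 : lam + (‖ξ‖ + |τ|) ≤ 2 * (lam + ‖ξ‖) := by linarith
            exact mul_le_mul (pow_le_pow_left₀ (by positivity) h1 _)
              (pow_le_pow_left₀ (by positivity) h2 _) (by positivity) (by positivity)
        _ = K ^ μ * 2 ^ (m - μ) * ((lam + ‖ξ‖) ^ μ * (lam + ‖ξ‖) ^ (m - μ)) := by
            rw [mul_pow, mul_pow]; ring
        _ = _ := by rw [← pow_add, Nat.add_sub_cancel' hμ.le]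
    have hij : (μ : ℝ) + 1 ≤ ((i + 1 : ℕ) : ℝ) := by
      have : μ + 1 ≤ i + 1 := by omega
      exact_mod_cast this
    have e2 : XiReal m μ (((i + 1 : ℕ) : ℝ) - 1 / 2) lam ξ =
        (lam + ‖ξ‖) ^ m * (lam + ‖ξ‖) ^ (-(((i + 1 : ℕ) : ℝ) - 1 / 2)) := by
      rw [XiReal, max_eq_right (by linarith), max_eq_right (by linarith), Real.rpow_zero, one_mul,
        sub_eq_add_neg, Real.rpow_add ha, Real.rpow_natCast]
    rw [e2]
    have e3 : 0 < (lam + ‖ξ‖) ^ (-(((i + 1 : ℕ) : ℝ) - 1 / 2)) := Real.rpow_pos_of_pos ha _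
    calc _ ≤ K ^ μ * 2 ^ (m - μ) * (lam + ‖ξ‖) ^ m *
          (lam + ‖ξ‖) ^ (-(((i + 1 : ℕ) : ℝ) - 1 / 2)) := by gcongr; exact hw.trans e1
      _ ≤ (2 ^ μ * K ^ (m - μ) + K ^ μ * 2 ^ (m - μ)) * (lam + ‖ξ‖) ^ m *
          (lam + ‖ξ‖) ^ (-(((i + 1 : ℕ) : ℝ) - 1 / 2)) := by
          gcongr
          exact le_add_of_nonneg_left (by positivity)
      _ = _ := by ring

end Weights

/-! ### Functions with prescribed moments. -/

section Lift

open Polynomial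

/-- The moment map on polynomials of degree < m is injective, since the integral of P² over [0,1] is
a combination of the moments of P. By finite dimension it is surjective. -/
theorem exists_polynomial_moments (m i : ℕ) (hi : i < m) : ∃ q : ℝ[X], ∀ k < m,
    ∫ x in (0 : ℝ)..1, x ^ k * q.eval x = if k = i then 1 else 0 := by
  let P : (Fin m → ℝ) →ₗ[ℝ] ℝ[X] := 
    { toFun := fun c => ∑ j, C (c j) * X ^ (j : ℕ)
      map_add' := fun c c' => by simp [add_mul, Finset.sum_add_distrib]
      map_smul' := fun r c => by simp [Finset.smul_sum, smul_eq_C_mul, mul_assoc] }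
  have hint : ∀ (k : ℕ) (q : ℝ[X]), IntervalIntegrable (fun x => x ^ k * q.eval x) volume 0 1 :=
    fun k q => ((continuous_pow k).mul q.continuous).intervalIntegrable _ _
  let L : (Fin m → ℝ) →ₗ[ℝ] (Fin m → ℝ) :=
    { toFun := fun c k => ∫ x in (0 : ℝ)..1, x ^ (k : ℕ) * (P c).eval x
      map_add' := fun c c' => by
        ext k
        simp only [map_add, eval_add, mul_add, Pi.add_apply]
        exact intervalIntegral.integral_add (hint _ _) (hint _ _)
      map_smul' := fun r c => by
        ext k
        simp only [map_smul, eval_smul, smul_eq_mul, RingHom.id_apply, Pi.smul_apply]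
        rw [← intervalIntegral.integral_const_mul]
        congr 1; ext x; ring }
  have hinj : Function.Injective L := by
    rw [← LinearMap.ker_eq_bot, LinearMap.ker_eq_bot']
    intro c hc
    have h1 : ∫ x in (0 : ℝ)..1, (P c).eval x * (P c).eval x = 0 := by
      have h2 : ∀ x, (P c).eval x * (P c).eval x =
          ∑ k, c k * (x ^ (k : ℕ) * (P c).eval x) := by
        intro x
        conv_lhs => lhs; simp only [P, LinearMap.coe_mk, AddHom.coe_mk, eval_finsetSum, eval_mul, eval_C, eval_pow, eval_X]
        rw [Finset.sum_mul]
        exact Finset.sum_congr rfl fun k _ => by ring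
      simp only [h2]
      rw [intervalIntegral.integral_finsetSum fun k _ => (hint _ _).const_mul _]
      refine Finset.sum_eq_zero fun k _ => ?_
      rw [intervalIntegral.integral_const_mul]
      have : L c k = 0 := by rw [hc]; rfl
      rw [show ∫ x in (0 : ℝ)..1, x ^ (k : ℕ) * (P c).eval x = L c k from rfl, this, mul_zero]
    have h3 : P c = 0 := by
      by_contra hne
      have hroot : ∃ x ∈ Set.Icc (0 : ℝ) 1, (P c).eval x ≠ 0 := by
        by_contra! h
        exact hne (eq_zero_of_infinite_isRoot _ ((Set.Icc_infinite zero_lt_one).mono h))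
      obtain ⟨x, hx, hx0⟩ := hroot
      have := intervalIntegral.integral_pos zero_lt_one
        ((P c).continuous.mul (P c).continuous).continuousOn
        (fun x _ => mul_self_nonneg ((P c).eval x)) ⟨x, hx, mul_self_pos.2 hx0⟩
      exact this.ne' h1
    ext k
    have h4 : (P c).coeff k = c k := by
      simp only [P, LinearMap.coe_mk, AddHom.coe_mk, finsetSum_coeff, coeff_C_mul, coeff_X_pow]
      rw [Finset.sum_eq_single k] <;> simp +contextual [Fin.ext_iff, eq_comm]
    rw [← h4, h3]; rfl
  obtain ⟨c, hc⟩ := LinearMap.injective_iff_surjective.1 hinj (Pi.single ⟨i, hi⟩ 1)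
  refine ⟨P c, fun k hk => ?_⟩
  have := congrFun hc ⟨k, hk⟩
  rw [show ∫ x in (0 : ℝ)..1, x ^ k * (P c).eval x = L c ⟨k, hk⟩ from rfl, this, Pi.single_apply]
  simp [Fin.ext_iff]

/-- Functions with prescribed moments, scaled to the size `σ`. -/
theorem exists_scaled_moments (m : ℕ) : ∃ M > 0, ∀ i < m, ∀ σ > 0, ∃ W : ℝ → ℂ, Measurable W ∧
    (∀ η, ‖W η‖ ≤ M * (σ ^ (i + 1))⁻¹) ∧
    (∀ η, η ∉ Set.Icc (0 : ℝ) (σ / (2 * Real.pi)) → W η = 0) ∧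
    ∀ k < m, ∫ η, ((2 * Real.pi * η : ℝ) : ℂ) ^ k * W η = if k = i then 1 else 0 := by
  choose! q hq using exists_polynomial_moments m
  have hbd : ∀ i, ∃ M, ∀ x ∈ Set.Icc (0 : ℝ) 1, |(q i).eval x| ≤ M := by
    intro i
    obtain ⟨M, hM⟩ := isCompact_Icc.exists_bound_of_continuousOn (q i).continuous.continuousOn
    exact ⟨M, hM⟩
  choose B hB using hbd
  set M := ∑ i ∈ Finset.range m, |B i| + 1
  have hpi := Real.pi_pos
  refine ⟨2 * Real.pi * M, by positivity, fun i hi σ hσ => ?_⟩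
  set f : ℝ → ℝ := (Set.Ioc (0 : ℝ) 1).indicator fun x => (q i).eval x with hf
  have hfm : Measurable f := ((q i).continuous.measurable).indicator measurableSet_Ioc
  set c := 2 * Real.pi / σ with hc
  have hc0 : 0 < c := by positivity
  -- Substituting 2πη = σx gives dη = σ/(2π) dx and (2πη)^k = σ^k x^k; the prefactor normalizes the
  -- i-th moment to 1.
  refine ⟨fun η => ((2 * Real.pi * (σ ^ (i + 1))⁻¹ * f (c * η) : ℝ) : ℂ), ?_, ?_, ?_, ?_⟩
  · exact Complex.measurable_ofReal.comp ((hfm.comp (measurable_const_mul c)).const_mul _)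
  · intro η
    have h1 : |f (c * η)| ≤ M := by
      by_cases h : c * η ∈ Set.Ioc (0 : ℝ) 1
      · rw [hf, Set.indicator_of_mem h]
        have h2 := hB i _ (Set.Ioc_subset_Icc_self h)
        have h3 := Finset.single_le_sum (f := fun i => |B i|) (fun i _ => abs_nonneg _)
          (Finset.mem_range.2 hi)
        have h4 := le_abs_self (B i)
        linarith
      · rw [hf, Set.indicator_of_notMem h, abs_zero]
        positivity
    rw [Complex.norm_real, Real.norm_eq_abs, abs_mul, abs_of_pos (by positivity)]
    calc _ ≤ 2 * Real.pi * (σ ^ (i + 1))⁻¹ * M := by gcongr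
      _ = _ := by ring
  · intro η hη
    have hf0 : f (c * η) = 0 := by
      rw [hf, Set.indicator_of_notMem]
      intro h
      refine hη ⟨((mul_pos_iff_of_pos_left hc0).1 h.1).le, ?_⟩
      rw [le_div_iff₀ (by positivity)]
      have := h.2
      rw [hc, div_mul_eq_mul_div, div_le_one hσ] at this
      linarith
    simp [hf0]
  · intro k hk
    have h1 : ∀ η : ℝ, ((2 * Real.pi * η : ℝ) : ℂ) ^ k *
        ((2 * Real.pi * (σ ^ (i + 1))⁻¹ * f (c * η) : ℝ) : ℂ) =
        ((2 * Real.pi * (σ ^ (i + 1))⁻¹ * σ ^ k * ((fun x => x ^ k * f x) (c * η)) : ℝ) : ℂ) := by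
      intro η
      rw [← Complex.ofReal_pow, ← Complex.ofReal_mul]
      congr 1
      have : 2 * Real.pi * η = σ * (c * η) := by rw [hc]; field_simp
      rw [this]
      simp only
      ring
    simp only [h1]
    rw [integral_complex_ofReal, integral_const_mul, Measure.integral_comp_mul_left (fun x => x ^ k * f x) c]
    have h2 : ∫ x, x ^ k * f x = if k = i then 1 else 0 := by
      rw [← hq i hi k hk, intervalIntegral.integral_of_le zero_le_one,
        ← integral_indicator measurableSet_Ioc]
      congr 1; ext x
      rw [hf, Set.indicator_mul_right]
    rw [h2]
    split_ifs with h
    · subst h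
      rw [hc, smul_eq_mul, mul_one, abs_of_pos (by positivity), pow_succ]
      have : 2 * Real.pi * (σ ^ k * σ)⁻¹ * σ ^ k * (2 * Real.pi / σ)⁻¹ = 1 := by field_simp
      rw [this]; simp
    · simp

end Lift

/-! ### The weight and the symbol on a fixed normal line; lifting boundary values. -/

section HalfLine

variable {d m μ : ℕ} {A : ℕ → MvPolynomial (Fin (d + 1)) ℂ}

theorem continuous_glue_two_pi (ξ : Rn d) : Continuous fun η : ℝ => glue ξ (2 * Real.pi * η) :=
  continuous_glue.comp (by fun_prop : Continuous fun η : ℝ => (ξ, 2 * Real.pi * η))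

theorem continuous_prodWeight (m μ : ℕ) (lam : ℝ) :
    Continuous fun s : ℝ => prodWeight m μ s lam := by
  unfold prodWeight; fun_prop

theorem continuous_symbol (m μ : ℕ) (A : ℕ → MvPolynomial (Fin (d + 1)) ℂ) (lam : ℝ) :
    Continuous fun ξ : Rn (d + 1) => symbol m μ A ξ lam := by
  unfold symbol
  refine continuous_finsetSum _ fun j _ => continuous_const.mul ?_
  refine (MvPolynomial.continuous_eval (A j)).comp (continuous_pi fun i => ?_)
  exact Complex.continuous_ofReal.comp (EuclideanSpace.proj i).continuous

/-- The weight on the Fourier side of the normal variable. -/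
def lineWeight (m μ : ℕ) (ξ : Rn d) (lam η : ℝ) : ℝ :=
  prodWeight m μ ‖glue ξ (2 * Real.pi * η)‖ lam

theorem lineWeight_pos (ξ : Rn d) {lam : ℝ} (hlam : 0 < lam) (η : ℝ) :
    0 < lineWeight m μ ξ lam η :=
  prodWeight_pos (norm_nonneg _) hlam

theorem continuous_lineWeight (m μ : ℕ) (ξ : Rn d) (lam : ℝ) :
    Continuous (lineWeight m μ ξ lam) :=
  (continuous_prodWeight m μ lam).comp (continuous_glue_two_pi ξ).norm

theorem one_le_Xi {n l : ℕ} (hμ : μ < m) (hl : l ≤ m) {lam : ℝ} (hlam : 0 ≤ lam) (ξ : Rn n) :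
    1 ≤ Xi m μ l lam ξ := by
  simpa using monomial_le_Xi (m := m) (μ := μ) (l := l) (i := 0) (k := 0) hlam ξ
    (by omega) (by omega)

theorem exists_Xi_mul_pow_le_lineWeight {lam0 : ℝ} (hlam0 : 0 < lam0) :
    ∃ C > 0, ∀ l : ℕ, ∀ lam ≥ lam0, ∀ (ξ : Rn d) (η : ℝ),
      Xi m μ l lam ξ * |2 * Real.pi * η| ^ l ≤ C * lineWeight m μ ξ lam η := by
  obtain ⟨C₁, hC₁, h1⟩ := exists_Xi_mul_pow_le (m := m) (μ := μ) (d := d)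
  obtain ⟨C₂, hC₂, h2⟩ := exists_Xi_le (m := m) (μ := μ) (n := d + 1) hlam0
  refine ⟨C₁ * C₂, by positivity, fun l lam hlam ξ η => ?_⟩
  refine (h1 l lam (hlam0.trans_le hlam) ξ (2 * Real.pi * η)).trans ?_
  refine (mul_le_mul_of_nonneg_left (h2 lam hlam _) hC₁.le).trans (le_of_eq ?_)
  rw [lineWeight]; ring

theorem memLp_pow_mul {lam0 : ℝ} (hlam0 : 0 < lam0) (hμ : μ < m) {lam : ℝ} (hlam : lam0 ≤ lam)
    (ξ : Rn d) {F : ℝ → ℂ} (hF : AEStronglyMeasurable F volume)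
    (h : MemLp (fun η => (lineWeight m μ ξ lam η : ℂ) * F η) 2) {l : ℕ} (hl : l ≤ m) :
    MemLp (fun η => ((2 * Real.pi * η : ℝ) : ℂ) ^ l * F η) 2 := by
  obtain ⟨C, hC, h1⟩ := exists_Xi_mul_pow_le_lineWeight (m := m) (μ := μ) (d := d) hlam0
  refine h.of_le_mul (c := C) ?_ (Eventually.of_forall fun η => ?_)
  · exact ((by fun_prop : Continuous fun η : ℝ =>
      ((2 * Real.pi * η : ℝ) : ℂ) ^ l).aestronglyMeasurable).mul hF
  · have hl0 := hlam0.trans_le hlam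
    have h2 := h1 l lam hlam ξ η
    have h3 := one_le_Xi hμ hl hl0.le ξ
    have h4 : 0 ≤ |2 * Real.pi * η| ^ l := by positivity
    rw [norm_mul, norm_pow, Complex.norm_real, Real.norm_eq_abs, norm_mul, Complex.norm_real,
      Real.norm_eq_abs, abs_of_pos (lineWeight_pos ξ hl0 η), ← mul_assoc]
    gcongr
    nlinarith

theorem lineWeight_le (ξ : Rn d) {lam : ℝ} (hlam : 0 < lam) (hμ : μ < m) (η : ℝ) :
    lineWeight m μ ξ lam η ≤ (1 + lam + ‖ξ‖) ^ m * (1 + |2 * Real.pi * η|) ^ m := by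
  set τ := 2 * Real.pi * η with hτ'
  set K := 1 + lam + ‖ξ‖ with hK
  have hξ := norm_nonneg ξ
  have hτ := abs_nonneg τ
  have h := norm_glue_le ξ τ
  have e1 : 1 + ‖glue ξ τ‖ ≤ K * (1 + |τ|) := by rw [hK]; nlinarith
  have e2 : lam + ‖glue ξ τ‖ ≤ K * (1 + |τ|) := by rw [hK]; nlinarith
  calc lineWeight m μ ξ lam η ≤ (K * (1 + |τ|)) ^ μ * (K * (1 + |τ|)) ^ (m - μ) := by
        unfold lineWeight prodWeight
        exact mul_le_mul (pow_le_pow_left₀ (by positivity) e1 _)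
          (pow_le_pow_left₀ (by positivity) e2 _) (by positivity) (by positivity)
    _ = _ := by rw [← pow_add, Nat.add_sub_cancel' hμ.le, mul_pow]

theorem memLp_lineWeight_mul (ξ : Rn d) {lam : ℝ} (hlam : 0 < lam) (hμ : μ < m) {F : ℝ → ℂ}
    (hF : MemLp F 2) (hF' : MemLp (fun η => ((2 * Real.pi * η : ℝ) : ℂ) ^ m * F η) 2) :
    MemLp (fun η => (lineWeight m μ ξ lam η : ℂ) * F η) 2 := by
  set K := 1 + lam + ‖ξ‖ with hK
  have hξ := norm_nonneg ξ
  refine MemLp.of_le_mul (c := K ^ m * 2 ^ m) (g := fun η => (‖F η‖ +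
    ‖((2 * Real.pi * η : ℝ) : ℂ) ^ m * F η‖ : ℝ)) (hF.norm.add hF'.norm) ?_
    (Eventually.of_forall fun η => ?_)
  · exact (Complex.continuous_ofReal.comp
      (continuous_lineWeight m μ ξ lam)).aestronglyMeasurable.mul hF.1
  · set τ := 2 * Real.pi * η
    have hτ := abs_nonneg τ
    have h1 : lineWeight m μ ξ lam η ≤ K ^ m * (1 + |τ|) ^ m := lineWeight_le ξ hlam hμ η
    have h2 : (1 + |τ|) ^ m ≤ 2 ^ m * (1 + |τ| ^ m) := by
      refine (add_pow_le zero_le_one hτ m).trans ?_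
      rw [one_pow]
      gcongr
      · exact one_le_two
      · exact Nat.sub_le _ _
    rw [norm_mul, Complex.norm_real, Real.norm_eq_abs, abs_of_pos (lineWeight_pos ξ hlam η),
      norm_mul, norm_pow, Complex.norm_real, Real.norm_eq_abs, Real.norm_eq_abs,
      abs_of_nonneg (by positivity)]
    calc _ ≤ K ^ m * (2 ^ m * (1 + |τ| ^ m)) * ‖F η‖ := by
          gcongr
          exact h1.trans (by gcongr)
      _ = _ := by ring

theorem fourierInv_memLp (ψ : 𝓢(ℝ, ℂ)) : MemLp (fun η => (𝓕⁻ ψ : 𝓢(ℝ, ℂ)) η) 2 :=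
  (𝓕⁻ ψ).memLp 2 volume

theorem memLp_lineWeight_mul_schwartz (ξ : Rn d) {lam : ℝ} (hlam : 0 < lam) (hμ : μ < m)
    (ψ : 𝓢(ℝ, ℂ)) :
    MemLp (fun η => (lineWeight m μ ξ lam η : ℂ) * (𝓕⁻ ψ : 𝓢(ℝ, ℂ)) η) 2 := by
  refine memLp_lineWeight_mul ξ hlam hμ (fourierInv_memLp ψ) ?_
  -- With all m zeros at 0 the product is (2πη)^m, so the weighted function is again the inverse
  -- transform of a Schwartz function.
  obtain ⟨χ, -, hχ⟩ := exists_fourierInv_eq_prod_mul (Multiset.replicate m 0) ψ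
  refine (fourierInv_memLp χ).congr_norm ?_ (Eventually.of_forall fun η => ?_)
  · exact ((by fun_prop : Continuous fun η : ℝ => ((2 * Real.pi * η : ℝ) : ℂ) ^ m).mul
      (𝓕⁻ ψ : 𝓢(ℝ, ℂ)).continuous).aestronglyMeasurable
  · rw [hχ]
    simp

theorem integrable_symbol_mul (hA : ∀ j ∈ Finset.Icc (2 * μ) (2 * m), (A j).IsHomogeneous j)
    (hμ : μ < m) (ξ : Rn d) {lam : ℝ} (hlam : 0 < lam) {F : ℝ → ℂ}
    (hFm : AEStronglyMeasurable F volume)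
    (hF : MemLp (fun η => (lineWeight m μ ξ lam η : ℂ) * F η) 2) (ψ : 𝓢(ℝ, ℂ)) :
    Integrable fun η => symbol m μ A (glue ξ (2 * Real.pi * η)) lam * F η *
      (𝓕⁻ ψ : 𝓢(ℝ, ℂ)) η := by
  obtain ⟨C, hC, h⟩ := exists_norm_symbol_le hA
  refine ((hF.integrable_mul (memLp_lineWeight_mul_schwartz ξ hlam hμ ψ)).norm.const_mul C).mono'
    ?_ (Eventually.of_forall fun η => ?_)
  · exact (((continuous_symbol m μ A lam).comp (continuous_glue_two_pi ξ)).aestronglyMeasurable.mul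
      hFm).mul (𝓕⁻ ψ : 𝓢(ℝ, ℂ)).continuous.aestronglyMeasurable
  · have h1 := h lam hlam ξ (2 * Real.pi * η)
    have h2 := lineWeight_pos (m := m) (μ := μ) ξ hlam η
    simp only [norm_mul, Pi.mul_apply, Complex.norm_real, Real.norm_eq_abs, abs_of_pos h2]
    calc _ ≤ C * lineWeight m μ ξ lam η ^ 2 * ‖F η‖ * ‖(𝓕⁻ ψ : 𝓢(ℝ, ℂ)) η‖ := by
          gcongr
          exact h1
      _ = _ := by ring

/-- For fixed ξ' the symbol is a polynomial in τ, so it acts as a differential operator in t and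
cannot move supports to the left. -/
theorem exists_fourierInv_eq_symbol_mul
    (hA : ∀ j ∈ Finset.Icc (2 * μ) (2 * m), (A j).IsHomogeneous j) (hμ : μ < m)
    (hell : NElliptic m μ A) (ξ : Rn d) {lam : ℝ} (hlam : 0 < lam) {ψ : 𝓢(ℝ, ℂ)}
    (hψ : VanishesLeft ψ) : ∃ χ : 𝓢(ℝ, ℂ), VanishesLeft χ ∧ ∀ η : ℝ,
      (𝓕⁻ χ : 𝓢(ℝ, ℂ)) η = symbol m μ A (glue ξ (2 * Real.pi * η)) lam * (𝓕⁻ ψ : 𝓢(ℝ, ℂ)) η := by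
  set a := MvPolynomial.eval (complexGlue (0 : Rn d) 1) (A (2 * m))
  obtain ⟨χ, hχ, h⟩ := exists_fourierInv_eq_prod_mul
    ((symbolPoly m μ A (lam⁻¹ • ξ) 1).roots.map fun κ => (lam : ℂ) * κ) ψ
  refine ⟨a • χ, ?_, fun η => ?_⟩
  · obtain ⟨b, hb, h1⟩ := hψ
    refine ⟨b, hb, fun t ht => ?_⟩
    suffices hmem : t ∉ tsupport χ by
      rw [smul_apply, image_eq_zero_of_notMem_tsupport hmem, smul_zero]
    intro hmem
    have h2 : tsupport ψ ⊆ Set.Ici b := by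
      refine closure_minimal (fun x hx => ?_) isClosed_Ici
      by_contra hxb
      exact hx (h1 x (not_le.1 hxb))
    exact absurd (h2 (hχ hmem)) (not_le.2 ht)
  · have h3 : (𝓕⁻ (a • χ) : 𝓢(ℝ, ℂ)) = a • (𝓕⁻ χ : 𝓢(ℝ, ℂ)) :=
      map_smul (FourierTransform.fourierInvCLM ℂ 𝓢(ℝ, ℂ)) a χ
    rw [h3, smul_apply, h, ← eval_symbolPoly_ofReal,
      eval_symbolPoly_eq_prod hA hμ hell ξ hlam, Multiset.map_map, smul_eq_mul, ← mul_assoc]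
    rfl

/-- Fourier pairing against `𝓕⁻ψ` sees only the positive half-line if `ψ` vanishes on the left. -/
theorem integral_symbol_mul_eq_zero
    (hA : ∀ j ∈ Finset.Icc (2 * μ) (2 * m), (A j).IsHomogeneous j) (hμ : μ < m)
    (hell : NElliptic m μ A) (ξ : Rn d) {lam : ℝ} (hlam : 0 < lam) {f F : ℝ → ℂ}
    (hF : IsFourierPair f F) (hf : ∀ t > 0, f t = 0) {ψ : 𝓢(ℝ, ℂ)} (hψ : VanishesLeft ψ) :
    ∫ η, symbol m μ A (glue ξ (2 * Real.pi * η)) lam * F η * (𝓕⁻ ψ : 𝓢(ℝ, ℂ)) η = 0 := by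
  obtain ⟨χ, hχ, h⟩ := exists_fourierInv_eq_symbol_mul hA hμ hell ξ hlam hψ
  have h1 : ∀ η, symbol m μ A (glue ξ (2 * Real.pi * η)) lam * F η * (𝓕⁻ ψ : 𝓢(ℝ, ℂ)) η =
      F η * (𝓕⁻ χ : 𝓢(ℝ, ℂ)) η := fun η => by rw [h]; ring
  simp only [h1]
  rw [← hF.integral_eq, FourierTransform.fourier_fourierInv_eq]
  obtain ⟨b, hb, h2⟩ := hχ
  rw [← integral_zero ℝ ℂ]
  congr 1; ext t
  rcases lt_or_ge t b with ht | ht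
  · rw [h2 t ht, mul_zero]
  · rw [hf t (hb.trans_le ht), zero_mul]

/-- The boundary values at t = 0 are moments of the transform, so a lift is a finite combination of
functions with prescribed moments, compactly supported in frequency. Each datum has its own scale
`liftScale`; this makes the cost equal to the boundary weight uniformly in ξ' and λ. -/
theorem exists_lift (hμ : μ < m) {lam0 : ℝ} (hlam0 : 0 < lam0) : ∃ C > 0, ∀ lam ≥ lam0,
    ∀ (ξ : Rn d) (t : ℕ → ℂ), ∃ W : ℝ → ℂ, Measurable W ∧
      MemLp (fun η => (lineWeight m μ ξ lam η : ℂ) * W η) 2 ∧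
      (∀ k < m, ∫ η, ((2 * Real.pi * η : ℝ) : ℂ) ^ k * W η = t k) ∧
      eLpNorm (fun η => (lineWeight m μ ξ lam η : ℂ) * W η) 2 volume ≤ ENNReal.ofReal C *
        ∑ i ∈ Finset.range m,
          ENNReal.ofReal (XiReal m μ (((i + 1 : ℕ) : ℝ) - 1 / 2) lam ξ) * ‖t i‖ₑ := by
  obtain ⟨M, hM, hW⟩ := exists_scaled_moments m
  obtain ⟨C, hC, hle⟩ := exists_prodWeight_mul_le (d := d) (m := m) (μ := μ) hμ hlam0
  refine ⟨M * C, by positivity, fun lam hlam ξ t => ?_⟩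
  have hl : 0 < lam := hlam0.trans_le hlam
  choose! W hWm hWb hWs hWi using fun i hi => hW i hi (liftScale μ i lam ξ) (liftScale_pos hl ξ)
  have hpi := Real.pi_pos
  have hmeas : ∀ i < m, AEStronglyMeasurable (W i) volume :=
    fun i hi => (hWm i hi).aestronglyMeasurable
  have hYm := (Complex.continuous_ofReal.comp (continuous_lineWeight m μ ξ lam))
  have hnorm : ∀ i < m, eLpNorm (fun η => (lineWeight m μ ξ lam η : ℂ) * W i η) 2 volume ≤
      ENNReal.ofReal (M * C) *
        ENNReal.ofReal (XiReal m μ (((i + 1 : ℕ) : ℝ) - 1 / 2) lam ξ) := by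
    intro i hi
    set σ := liftScale μ i lam ξ with hσ
    have hσ0 : 0 < σ := liftScale_pos hl ξ
    set S := Set.Icc (0 : ℝ) (σ / (2 * Real.pi)) with hS
    have e1 : (fun η => (lineWeight m μ ξ lam η : ℂ) * W i η) =
        S.indicator fun η => (lineWeight m μ ξ lam η : ℂ) * W i η := by
      ext η
      by_cases h : η ∈ S
      · rw [Set.indicator_of_mem h]
      · rw [Set.indicator_of_notMem h, hWs i hi η h, mul_zero]
    rw [e1, eLpNorm_indicator_eq_eLpNorm_restrict measurableSet_Icc]
    set X := XiReal m μ (((i + 1 : ℕ) : ℝ) - 1 / 2) lam ξ with hX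
    have hb : ∀ᵐ η ∂volume.restrict S, ‖(lineWeight m μ ξ lam η : ℂ) * W i η‖ ≤
        M * C * X * (σ ^ (1 / 2 : ℝ))⁻¹ := by
      refine (ae_restrict_iff' measurableSet_Icc).2 (Eventually.of_forall fun η hη => ?_)
      have h1 : |2 * Real.pi * η| ≤ σ := by
        rw [abs_of_nonneg (mul_nonneg (by positivity) hη.1)]
        have := hη.2
        rw [le_div_iff₀ (by positivity)] at this
        linarith
      have h2 := hle i hi lam hlam ξ _ h1
      have hr : 0 < σ ^ (1 / 2 : ℝ) := Real.rpow_pos_of_pos hσ0 _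
      rw [norm_mul, Complex.norm_real, Real.norm_eq_abs, abs_of_pos (lineWeight_pos ξ hl η),
        ← div_eq_mul_inv, le_div_iff₀ hr]
      have h3 := lineWeight_pos (m := m) (μ := μ) ξ hl η
      calc lineWeight m μ ξ lam η * ‖W i η‖ * σ ^ (1 / 2 : ℝ)
          ≤ lineWeight m μ ξ lam η * (M * (σ ^ (i + 1))⁻¹) * σ ^ (1 / 2 : ℝ) := by
            gcongr
            exact hWb i hi η
        _ = M * (lineWeight m μ ξ lam η * (σ ^ (i + 1))⁻¹ * σ ^ (1 / 2 : ℝ)) := by ring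
        _ ≤ M * (C * X) := mul_le_mul_of_nonneg_left h2 hM.le
        _ = _ := by ring
    -- Supremum times the square root of the measure of the support; this square root is at most
    -- σ^(1/2) and cancels the power of σ in `hb`.
    refine (eLpNorm_le_of_ae_bound hb).trans ?_
    have h4 : (volume.restrict S) Set.univ ≤ ENNReal.ofReal σ := by
      rw [Measure.restrict_apply_univ, hS, Real.volume_Icc, sub_zero]
      refine ENNReal.ofReal_le_ofReal (div_le_self hσ0.le ?_)
      nlinarith [Real.pi_gt_three]
    have h5 : ((volume.restrict S) Set.univ) ^ ((2 : ℝ≥0∞).toReal)⁻¹ ≤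
        ENNReal.ofReal (σ ^ (1 / 2 : ℝ)) := by
      rw [ENNReal.toReal_ofNat, ← ENNReal.ofReal_rpow_of_pos hσ0, one_div]
      gcongr
    have hr : 0 < σ ^ (1 / 2 : ℝ) := Real.rpow_pos_of_pos hσ0 _
    calc _ ≤ ENNReal.ofReal (σ ^ (1 / 2 : ℝ)) *
          ENNReal.ofReal (M * C * X * (σ ^ (1 / 2 : ℝ))⁻¹) := by gcongr
      _ = ENNReal.ofReal (M * C * X) := by
          rw [← ENNReal.ofReal_mul hr.le]
          congr 1; field_simp
      _ = _ := by rw [ENNReal.ofReal_mul (by positivity)]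
  have hmem : ∀ i < m, MemLp (fun η => (lineWeight m μ ξ lam η : ℂ) * W i η) 2 := fun i hi =>
    ⟨hYm.aestronglyMeasurable.mul (hmeas i hi), (hnorm i hi).trans_lt
      (ENNReal.mul_lt_top ENNReal.ofReal_lt_top ENNReal.ofReal_lt_top)⟩
  have hsum : (fun η => (lineWeight m μ ξ lam η : ℂ) * ∑ i ∈ Finset.range m, t i * W i η) =
      ∑ i ∈ Finset.range m, t i • fun η => (lineWeight m μ ξ lam η : ℂ) * W i η := by
    ext η
    rw [Finset.sum_apply, Finset.mul_sum]
    refine Finset.sum_congr rfl fun i _ => ?_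
    rw [Pi.smul_apply, smul_eq_mul]; ring
  refine ⟨fun η => ∑ i ∈ Finset.range m, t i * W i η, ?_, ?_, ?_, ?_⟩
  · exact Finset.measurable_sum _ fun i hi => (hWm i (Finset.mem_range.1 hi)).const_mul _
  · rw [hsum]
    exact memLp_finsetSum' _ fun i hi => (hmem i (Finset.mem_range.1 hi)).const_smul _
  · intro k hk
    have hint : ∀ i < m, Integrable fun η => ((2 * Real.pi * η : ℝ) : ℂ) ^ k * W i η := by
      intro i hi
      refine integrable_of_memLp_mul (memLp_pow_mul hlam0 hμ hlam ξ (hmeas i hi) (hmem i hi)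
        hk.le) ?_
      refine (memLp_pow_mul hlam0 hμ hlam ξ (hmeas i hi) (hmem i hi) (l := k + 1) hk).ae_eq
        (Eventually.of_forall fun η => ?_)
      simp only [pow_succ]; ring
    have e : ∀ η : ℝ, ((2 * Real.pi * η : ℝ) : ℂ) ^ k * ∑ i ∈ Finset.range m, t i * W i η =
        ∑ i ∈ Finset.range m, t i * (((2 * Real.pi * η : ℝ) : ℂ) ^ k * W i η) := by
      intro η
      rw [Finset.mul_sum]
      exact Finset.sum_congr rfl fun i _ => by ring
    simp only [e]
    rw [integral_finsetSum _ fun i hi => (hint i (Finset.mem_range.1 hi)).const_mul _]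
    rw [Finset.sum_eq_single k]
    · rw [integral_const_mul, hWi k hk k hk, if_pos rfl, mul_one]
    · intro i hi hik
      rw [integral_const_mul, hWi i (Finset.mem_range.1 hi) k hk, if_neg hik.symm, mul_zero]
    · exact fun h => absurd (Finset.mem_range.2 hk) h
  · rw [hsum, Finset.mul_sum]
    refine (eLpNorm_sum_le (fun i hi => ((hmem i (Finset.mem_range.1 hi)).const_smul _).1)
      (by norm_num)).trans (Finset.sum_le_sum fun i hi => ?_)
    rw [eLpNorm_const_smul, ← mul_assoc, mul_comm]
    gcongr
    exact hnorm i (Finset.mem_range.1 hi)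

end HalfLine

/-! ### The a priori estimate for a fixed tangential frequency. -/

section HalfLineEstimate

variable {d m μ : ℕ} {A : ℕ → MvPolynomial (Fin (d + 1)) ℂ}

theorem eLpNorm_le_add_four {α : Type*} [MeasurableSpace α] {ν : Measure α} {f g₁ g₂ g₃ g₄ : α → ℂ}
    {c₁ c₂ c₃ c₄ : ℝ} (h₁ : AEStronglyMeasurable g₁ ν) (h₂ : AEStronglyMeasurable g₂ ν)
    (h₃ : AEStronglyMeasurable g₃ ν) (h₄ : AEStronglyMeasurable g₄ ν)
    (h : ∀ x, ‖f x‖ ≤ c₁ * ‖g₁ x‖ + c₂ * ‖g₂ x‖ + c₃ * ‖g₃ x‖ + c₄ * ‖g₄ x‖) :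
    eLpNorm f 2 ν ≤ ENNReal.ofReal c₁ * eLpNorm g₁ 2 ν + ENNReal.ofReal c₂ * eLpNorm g₂ 2 ν +
      ENNReal.ofReal c₃ * eLpNorm g₃ 2 ν + ENNReal.ofReal c₄ * eLpNorm g₄ 2 ν := by
  have hc : ∀ (c : ℝ) (g : α → ℂ), eLpNorm (fun x => c * ‖g x‖) 2 ν ≤
      ENNReal.ofReal |c| * eLpNorm g 2 ν := by
    intro c g
    refine eLpNorm_le_mul_eLpNorm_of_ae_le_mul (Eventually.of_forall fun x => ?_) 2
    rw [norm_mul, norm_norm, Real.norm_eq_abs]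
  have hm : ∀ (c : ℝ) {g : α → ℂ}, AEStronglyMeasurable g ν →
      AEStronglyMeasurable (fun x => c * ‖g x‖) ν := fun c g hg => hg.norm.const_mul c
  have hpos : ∀ (c : ℝ) (g : α → ℂ), eLpNorm (fun x => max c 0 * ‖g x‖) 2 ν ≤
      ENNReal.ofReal c * eLpNorm g 2 ν := by
    intro c g
    refine (hc _ g).trans (le_of_eq ?_)
    rw [abs_of_nonneg (le_max_right _ _), ENNReal.ofReal_max, ENNReal.ofReal_zero,
      max_eq_left zero_le]
  have h' : ∀ x, ‖f x‖ ≤ max c₁ 0 * ‖g₁ x‖ + max c₂ 0 * ‖g₂ x‖ + max c₃ 0 * ‖g₃ x‖ +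
      max c₄ 0 * ‖g₄ x‖ := fun x => (h x).trans (by gcongr <;> exact le_max_left _ _)
  refine (eLpNorm_mono_real h').trans ?_
  refine (eLpNorm_add_le (((hm _ h₁).add (hm _ h₂)).add (hm _ h₃)) (hm _ h₄) (by norm_num)).trans
    (add_le_add ?_ (hpos _ _))
  refine (eLpNorm_add_le ((hm _ h₁).add (hm _ h₂)) (hm _ h₃) (by norm_num)).trans
    (add_le_add ?_ (hpos _ _))
  exact (eLpNorm_add_le (hm _ h₁) (hm _ h₂) (by norm_num)).trans
    (add_le_add (hpos _ _) (hpos _ _))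

theorem eLpNorm_ofReal_mul {α : Type*} [MeasurableSpace α] {ν : Measure α} {c : ℝ} (hc : 0 ≤ c)
    (f : α → ℂ) : eLpNorm (fun x => (c : ℂ) * f x) 2 ν = ENNReal.ofReal c * eLpNorm f 2 ν := by
  have := eLpNorm_const_smul (μ := ν) (p := 2) (c : ℂ) f
  rw [← ofReal_norm, Complex.norm_real, Real.norm_eq_abs, abs_of_nonneg hc] at this
  exact this

theorem absorb_half {x R : ℝ≥0∞} {c : ℝ} (hc : 0 < c) (hx : x ≠ ∞)
    (h : ENNReal.ofReal c * x ≤ R + ENNReal.ofReal (c / 2) * x) : x ≤ ENNReal.ofReal (2 / c) * R := by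
  have h1 : ENNReal.ofReal c = ENNReal.ofReal (c / 2) + ENNReal.ofReal (c / 2) := by
    rw [← ENNReal.ofReal_add (by positivity) (by positivity)]; congr 1; ring
  rw [h1, add_mul] at h
  have h2 := (ENNReal.add_le_add_iff_right (ENNReal.mul_ne_top ENNReal.ofReal_ne_top hx)).1 h
  calc x = ENNReal.ofReal (2 / c) * (ENNReal.ofReal (c / 2) * x) := by
        rw [← mul_assoc, ← ENNReal.ofReal_mul (by positivity)]
        have : 2 / c * (c / 2) = 1 := by field_simp
        rw [this, ENNReal.ofReal_one, one_mul]
    _ ≤ _ := by gcongr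

theorem memLp_prod_mul (s : Multiset ℂ) {F : ℝ → ℂ} (hF : MemLp F 2)
    (hF' : MemLp (fun η => ((2 * Real.pi * η : ℝ) : ℂ) ^ s.card * F η) 2) :
    MemLp (fun η : ℝ => (s.map fun ζ => ((2 * Real.pi * η : ℝ) - ζ : ℂ)).prod * F η) 2 := by
  obtain ⟨c, hc, h⟩ := exists_prod_le s
  have hcont : Continuous fun η : ℝ => (s.map fun ζ => ((2 * Real.pi * η : ℝ) - ζ : ℂ)).prod :=
    continuous_multiset_prod s fun ζ _ => by fun_prop
  refine MemLp.of_le_mul (c := c * 2 ^ s.card) (g := fun η => (‖F η‖ +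
    ‖((2 * Real.pi * η : ℝ) : ℂ) ^ s.card * F η‖ : ℝ)) (hF.norm.add hF'.norm)
    (hcont.aestronglyMeasurable.mul hF.1) (Eventually.of_forall fun η => ?_)
  have hτ := abs_nonneg (2 * Real.pi * η)
  have h2 : (1 + |2 * Real.pi * η|) ^ s.card ≤ 2 ^ s.card * (1 + |2 * Real.pi * η| ^ s.card) := by
    refine (add_pow_le zero_le_one hτ _).trans ?_
    rw [one_pow]
    gcongr
    · exact one_le_two
    · exact Nat.sub_le _ _
  rw [norm_mul, norm_mul, norm_pow, Complex.norm_real, Real.norm_eq_abs, Real.norm_eq_abs,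
    abs_of_nonneg (by positivity)]
  calc _ ≤ c * (2 ^ s.card * (1 + |2 * Real.pi * η| ^ s.card)) * ‖F η‖ := by
        gcongr
        exact (h _).trans (by gcongr)
    _ = _ := by ring

/-- All moments of order `< m` of `U` vanish, so cutting off at `t = 0` commutes with `m`
derivatives. -/
theorem isFourierPair_indicator_pow {u : ℕ → ℝ → ℂ} {U Z : ℝ → ℂ}
    (hu : ∀ l ≤ m, IsFourierPair (u l) fun η => ((2 * Real.pi * η : ℝ) : ℂ) ^ l * U η)
    (h0 : ∀ k < m, ∫ η, ((2 * Real.pi * η : ℝ) : ℂ) ^ k * U η = 0)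
    (hZ : IsFourierPair ((Set.Ioi 0).indicator (u 0)) Z) {l : ℕ} (hl : l ≤ m) :
    IsFourierPair ((Set.Ioi 0).indicator (u l)) fun η => ((2 * Real.pi * η : ℝ) : ℂ) ^ l * Z η := by
  induction l with
  | zero => simpa using hZ
  | succ l ih =>
    refine ((hu l (by omega)).indicator_deriv ((hu (l + 1) hl).congr (ae_eq_refl _) ?_)
      (h0 l (by omega)) (ih (by omega))).congr (ae_eq_refl _) ?_
    all_goals exact Eventually.of_forall fun η => by simp only [pow_succ]; ring

/-- The a priori estimate on the half-line, for a fixed tangential frequency. -/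
theorem exists_halfLine_estimate
    (hA : ∀ j ∈ Finset.Icc (2 * μ) (2 * m), (A j).IsHomogeneous j) (hμ : μ < m)
    (hell : NElliptic m μ A) (hreg : DegeneratesRegularly m μ A) (hprop : ProperlyElliptic m μ A)
    {lam0 : ℝ} (hlam0 : 0 < lam0) : ∃ C > 0, ∀ lam ≥ lam0, ∀ (ξ : Rn d) (V G : ℝ → ℂ)
      (v : ℕ → ℝ → ℂ),
      (∀ l ≤ m, IsFourierPair (v l) fun η => ((2 * Real.pi * η : ℝ) : ℂ) ^ l * V η) →
      MemLp (fun η => (lineWeight m μ ξ lam η : ℂ) * V η) 2 →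
      MemLp (fun η => ((lineWeight m μ ξ lam η)⁻¹ : ℂ) * G η) 2 →
      (∀ ψ : 𝓢(ℝ, ℂ), VanishesLeft ψ → ∫ η, (G η -
        symbol m μ A (glue ξ (2 * Real.pi * η)) lam * V η) * (𝓕⁻ ψ : 𝓢(ℝ, ℂ)) η = 0) →
      ∀ l ≤ m, ENNReal.ofReal (Xi m μ l lam ξ) *
          eLpNorm ((Set.Ioi 0).indicator (v l)) 2 volume ≤ ENNReal.ofReal C *
        (eLpNorm (fun η => ((lineWeight m μ ξ lam η)⁻¹ : ℂ) * G η) 2 volume +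
        ∑ i ∈ Finset.range m, ENNReal.ofReal (XiReal m μ (((i + 1 : ℕ) : ℝ) - 1 / 2) lam ξ) *
          ‖∫ η, ((2 * Real.pi * η : ℝ) : ℂ) ^ i * V η‖ₑ +
        ENNReal.ofReal (lam ^ (m - μ)) * eLpNorm ((Set.Ioi 0).indicator (v 0)) 2 volume) := by
  obtain ⟨c, hc, hfac⟩ := exists_factorization hA hμ hell hreg hprop hlam0
  obtain ⟨C₀, hC₀, hsym⟩ := exists_norm_symbol_le hA
  obtain ⟨CL, hCL, hlift⟩ := exists_lift (d := d) hμ hlam0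
  obtain ⟨CX, hCX, hXi⟩ := exists_Xi_mul_pow_le_lineWeight (m := m) (μ := μ) (d := d) hlam0
  set a := MvPolynomial.eval (complexGlue (0 : Rn d) 1) (A (2 * m)) with ha
  have ha0 : 0 < ‖a‖ := norm_pos_iff.2 (leadingCoeff_ne_zero hμ hell)
  set K := (‖a‖ * c)⁻¹ with hK
  have hK0 : 0 < K := by positivity
  -- Division by aS costs the factor K, so the main error contributes Kε = c/2 times the norm of YZ,
  -- half of the lower bound c for S'Z.
  set ε := ‖a‖ * c * (c / 2) with hε
  have hε0 : 0 < ε := by positivity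
  have hKε : K * ε = c / 2 := by rw [hK, hε]; field_simp
  obtain ⟨C₁, hC₁, hfac⟩ := hfac ε hε0
  set E : ℝ → ℝ≥0∞ := ENNReal.ofReal
  set Ctot : ℝ≥0∞ := E CX * (E (2 / c) * (E K + E (K * C₀) * E CL + E (K * C₁) * (1 + E CL))) +
    E CX * E CL with hCtot
  have hCtop : Ctot ≠ ∞ := by
    have h : ∀ x, E x ≠ ∞ := fun x => ENNReal.ofReal_ne_top
    simp [hCtot, ENNReal.mul_eq_top, h]
  refine ⟨Ctot.toReal + 1, by positivity, fun lam hlam ξ V G v hv hV hG hann l hl => ?_⟩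
  have hl0 : 0 < lam := hlam0.trans_le hlam
  obtain ⟨s, s', hs, hs', hss⟩ := hfac lam hlam ξ
  set Y := lineWeight m μ ξ lam with hY
  have hYpos : ∀ η, 0 < Y η := lineWeight_pos ξ hl0
  have hYcont : Continuous fun η => (Y η : ℂ) :=
    Complex.continuous_ofReal.comp (continuous_lineWeight m μ ξ lam)
  set p : ℝ → ℂ := fun η => symbol m μ A (glue ξ (2 * Real.pi * η)) lam with hp
  have hpcont : Continuous p := (continuous_symbol m μ A lam).comp (continuous_glue_two_pi ξ)
  have hVm : AEStronglyMeasurable V volume := by simpa using (hv 0 (Nat.zero_le _)).memLp_right.1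
  have hGm : AEStronglyMeasurable G volume := by
    refine (hYcont.aestronglyMeasurable.mul hG.1).congr (Eventually.of_forall fun η => ?_)
    have : (Y η : ℂ) ≠ 0 := by exact_mod_cast (hYpos η).ne'
    simp only [Pi.mul_apply]
    field_simp
  set t : ℕ → ℂ := fun i => ∫ η, ((2 * Real.pi * η : ℝ) : ℂ) ^ i * V η with ht
  -- W has the same moments of order < m as V, hence the same boundary values; U = V - W has none.
  obtain ⟨W, hWm, hYW, hWt, hWle⟩ := hlift lam hlam ξ t
  set B := ∑ i ∈ Finset.range m,
    ENNReal.ofReal (XiReal m μ (((i + 1 : ℕ) : ℝ) - 1 / 2) lam ξ) * ‖t i‖ₑ with hB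
  have hWpow : ∀ l ≤ m, MemLp (fun η => ((2 * Real.pi * η : ℝ) : ℂ) ^ l * W η) 2 := fun l hl =>
    memLp_pow_mul hlam0 hμ hlam ξ hWm.aestronglyMeasurable hYW hl
  choose! w hw using fun l hl => IsFourierPair.exists_left (hWpow l hl)
  set U : ℝ → ℂ := fun η => V η - W η with hU
  set u : ℕ → ℝ → ℂ := fun l x => v l x - w l x with hu
  have hUu : ∀ l ≤ m, IsFourierPair (u l) fun η => ((2 * Real.pi * η : ℝ) : ℂ) ^ l * U η :=
    fun l hl => ((hv l hl).sub (hw l hl)).congr (ae_eq_refl _)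
      (Eventually.of_forall fun η => by simp only [hU]; ring)
  have hint : ∀ {F : ℝ → ℂ}, (∀ l ≤ m, MemLp (fun η => ((2 * Real.pi * η : ℝ) : ℂ) ^ l * F η) 2) →
      ∀ k < m, Integrable fun η => ((2 * Real.pi * η : ℝ) : ℂ) ^ k * F η := by
    intro F hF k hk
    refine integrable_of_memLp_mul (hF k hk.le) ((hF (k + 1) hk).ae_eq ?_)
    exact Eventually.of_forall fun η => by simp only [pow_succ]; ring
  have hU0 : ∀ k < m, ∫ η, ((2 * Real.pi * η : ℝ) : ℂ) ^ k * U η = 0 := by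
    intro k hk
    simp only [hU, mul_sub]
    rw [integral_sub (hint (fun l hl => (hv l hl).memLp_right) k hk) (hint hWpow k hk), hWt k hk,
      sub_self]
  have hu0 := hUu 0 (Nat.zero_le _)
  -- Z depends on the extension of u only through its values for t > 0 and through W. This keeps
  -- norms of the arbitrary extension V out of the result.
  obtain ⟨Z, hZ⟩ := IsFourierPair.exists_right (hu0.memLp_left.indicator measurableSet_Ioi)
  have hZpow : ∀ l ≤ m, IsFourierPair ((Set.Ioi 0).indicator (u l))
      fun η => ((2 * Real.pi * η : ℝ) : ℂ) ^ l * Z η := fun l hl =>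
    isFourierPair_indicator_pow hUu hU0 hZ hl
  have hYZ : MemLp (fun η => (Y η : ℂ) * Z η) 2 :=
    memLp_lineWeight_mul ξ hl0 hμ hZ.memLp_right (hZpow m le_rfl).memLp_right
  have hPZ : MemLp (fun η : ℝ => (s'.map fun ζ => ((2 * Real.pi * η : ℝ) - ζ : ℂ)).prod * Z η) 2 :=
    memLp_prod_mul s' hZ.memLp_right (by rw [hs']; exact (hZpow m le_rfl).memLp_right)
  set S : ℝ → ℂ := fun η => (s.map fun ζ => ((2 * Real.pi * η : ℝ) - ζ : ℂ)).prod with hS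
  set S' : ℝ → ℂ := fun η => (s'.map fun ζ => ((2 * Real.pi * η : ℝ) - ζ : ℂ)).prod with hS'
  have hSge : ∀ η, c * Y η ≤ ‖S η‖ := fun η => (hss (2 * Real.pi * η)).1
  have hS'ge : ∀ η, c * Y η ≤ ‖S' η‖ := fun η => (hss (2 * Real.pi * η)).2.1
  have hSS' : ∀ η, ‖p η - a * (S η * S' η)‖ ≤ Y η * (ε * Y η + C₁ * lam ^ (m - μ)) :=
    fun η => (hss (2 * Real.pi * η)).2.2
  have hple : ∀ η, ‖p η‖ ≤ C₀ * Y η ^ 2 := fun η => hsym lam hl0 ξ _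
  have hScont : Continuous S := continuous_multiset_prod s fun ζ _ => by fun_prop
  have hSne : ∀ η, S η ≠ 0 := fun η =>
    norm_pos_iff.1 ((mul_pos hc (hYpos η)).trans_le (hSge η))
  have hane : a ≠ 0 := norm_pos_iff.1 ha0
  set P : ℝ → ℂ := fun η => (a * S η)⁻¹ with hP
  have hPcont : Continuous P := (continuous_const.mul hScont).inv₀ fun η => mul_ne_zero hane (hSne η)
  have hPle : ∀ η, ‖P η‖ ≤ K * (Y η)⁻¹ := by
    intro η
    rw [hP, norm_inv, norm_mul, hK, ← mul_inv, mul_assoc]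
    have := hYpos η
    gcongr
    exact hSge η
  -- Residual after division by the factor aS. It is square integrable because Y⁻¹G, YW and YZ are,
  -- while |P| ≤ K/Y and |p| ≤ C₀Y².
  set k : ℝ → ℂ := fun η => P η * (G η - p η * W η - p η * Z η) with hk
  have hZm := hZ.memLp_right.1
  have hkm : MemLp k 2 := by
    have e : k = fun η => P η * G η - P η * (p η * W η) - P η * (p η * Z η) := by
      ext η; rw [hk]; ring
    have hpF : ∀ {F : ℝ → ℂ}, AEStronglyMeasurable F volume → MemLp (fun η => (Y η : ℂ) * F η) 2 →
        MemLp (fun η => P η * (p η * F η)) 2 := by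
      intro F hFm hF
      refine hF.of_le_mul (c := K * C₀)
        (hPcont.aestronglyMeasurable.mul (hpcont.aestronglyMeasurable.mul hFm))
        (Eventually.of_forall fun η => ?_)
      have h1 := hYpos η
      rw [norm_mul, norm_mul, norm_mul, Complex.norm_real, Real.norm_eq_abs, abs_of_pos h1]
      calc _ ≤ K * (Y η)⁻¹ * (C₀ * Y η ^ 2 * ‖F η‖) := by
            gcongr
            exacts [hPle η, hple η]
        _ = _ := by field_simp
    rw [e]
    refine (MemLp.sub ?_ (hpF hWm.aestronglyMeasurable hYW)).sub (hpF hZm hYZ)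
    refine hG.of_le_mul (c := K) (hPcont.aestronglyMeasurable.mul hGm)
      (Eventually.of_forall fun η => ?_)
    have h1 := hYpos η
    have h2 : ‖((Y η : ℂ))⁻¹‖ = (Y η)⁻¹ := by
      rw [norm_inv, Complex.norm_real, Real.norm_eq_abs, abs_of_pos h1]
    rw [norm_mul, norm_mul, h2, ← mul_assoc]
    exact mul_le_mul_of_nonneg_right (hPle η) (norm_nonneg _)
  -- Up to the factor a⁻¹, Sk is (G - pV) + p(U - Z). The first part annihilates ψ by hypothesis; in
  -- the second, U - Z is the transform of a function that vanishes for t > 0, and p acts as a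
  -- differential operator.
  have hk0 : ∀ ψ : 𝓢(ℝ, ℂ), VanishesLeft ψ → ∫ η : ℝ, (S η * k η) * 𝓕⁻ ψ η = 0 := by
    intro ψ hψ
    have hUZ := hu0.sub hZ
    simp only [pow_zero, one_mul] at hUZ
    have e1 := integral_symbol_mul_eq_zero hA hμ hell ξ hl0 hUZ (fun t ht => by
      rw [Set.indicator_of_mem (show t ∈ Set.Ioi 0 from ht), sub_self]) hψ
    have e2 := hann ψ hψ
    have hGV : Integrable fun η => (G η - p η * V η) * (𝓕⁻ ψ : 𝓢(ℝ, ℂ)) η := by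
      have f1 := hG.integrable_mul (memLp_lineWeight_mul_schwartz ξ hl0 hμ ψ)
      have f2 := integrable_symbol_mul hA hμ ξ hl0 hVm hV ψ
      refine (f1.sub f2).congr (Eventually.of_forall fun η => ?_)
      have h1 : (Y η : ℂ) ≠ 0 := by exact_mod_cast (hYpos η).ne'
      have h2 : (Y η : ℂ)⁻¹ * G η * ((Y η : ℂ) * (𝓕⁻ ψ : 𝓢(ℝ, ℂ)) η) =
          G η * (𝓕⁻ ψ : 𝓢(ℝ, ℂ)) η := by field_simp
      simp only [Pi.sub_apply, Pi.mul_apply]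
      rw [h2]; ring
    have hUZi : Integrable fun η => p η * (U η - Z η) * (𝓕⁻ ψ : 𝓢(ℝ, ℂ)) η := by
      refine integrable_symbol_mul hA hμ ξ hl0 hUZ.memLp_right.1 ?_ ψ
      refine ((hV.sub hYW).sub hYZ).ae_eq (Eventually.of_forall fun η => ?_)
      simp only [hU, Pi.sub_apply]; ring
    have e3 : ∀ η, (S η * k η) * 𝓕⁻ ψ η = a⁻¹ * ((G η - p η * V η) * (𝓕⁻ ψ : 𝓢(ℝ, ℂ)) η +
        p η * (U η - Z η) * (𝓕⁻ ψ : 𝓢(ℝ, ℂ)) η) := by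
      intro η
      have h1 : S η * k η = a⁻¹ * (G η - p η * W η - p η * Z η) := by
        have := hSne η
        simp only [hk, hP]
        field_simp
      rw [h1]
      simp only [hU]
      ring
    simp only [e3]
    rw [integral_const_mul, integral_add hGV hUZi, e2, e1, add_zero, mul_zero]
  have hmain := eLpNorm_prod_mul_le s s' hs hZ (by
    refine Eventually.of_forall fun t ht => ?_
    rw [Set.indicator_of_notMem]
    exact not_lt.2 ht.le) hPZ hkm hk0
  set NG := eLpNorm (fun η => ((Y η)⁻¹ : ℂ) * G η) 2 volume with hNG
  set NW := eLpNorm (fun η => (Y η : ℂ) * W η) 2 volume with hNW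
  set NY := eLpNorm (fun η => (Y η : ℂ) * Z η) 2 volume with hNY
  set NZ := eLpNorm Z 2 volume with hNZ
  set N0 := eLpNorm ((Set.Ioi 0).indicator (v 0)) 2 volume with hN0
  have hrhs : eLpNorm (fun η : ℝ => S' η * Z η + k η) 2 volume ≤
      E K * NG + E (K * C₀) * NW + E (K * ε) * NY + E (K * C₁ * lam ^ (m - μ)) * NZ := by
    refine eLpNorm_le_add_four hG.1 hYW.1 hYZ.1 hZm fun η => ?_
    have h1 := hYpos η
    -- Since P a S = 1, the term S'Z cancels the leading part aSS'Z of pZ, and only the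
    -- factorization error acts on Z.
    have e : S' η * Z η + k η = P η * G η - P η * (p η * W η) -
        P η * ((p η - a * (S η * S' η)) * Z η) := by
      have := hSne η
      simp only [hk, hP]
      field_simp
      ring
    rw [e]
    refine (norm_sub_le _ _).trans ((add_le_add (norm_sub_le _ _) le_rfl).trans ?_)
    simp only [norm_mul, norm_inv, Complex.norm_real, Real.norm_eq_abs, abs_of_pos h1]
    calc _ ≤ K * (Y η)⁻¹ * ‖G η‖ + K * (Y η)⁻¹ * (C₀ * Y η ^ 2 * ‖W η‖) +
          K * (Y η)⁻¹ * (Y η * (ε * Y η + C₁ * lam ^ (m - μ)) * ‖Z η‖) := by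
          have := hPle η
          have := hple η
          have := hSS' η
          gcongr
      _ = _ := by field_simp; ring
  have hlow : E c * NY ≤ eLpNorm (fun η : ℝ => S' η * Z η) 2 volume := by
    have h1 : NY ≤ E c⁻¹ * eLpNorm (fun η : ℝ => S' η * Z η) 2 volume := by
      refine eLpNorm_le_mul_eLpNorm_of_ae_le_mul (Eventually.of_forall fun η => ?_) 2
      have h2 := hS'ge η
      rw [norm_mul, norm_mul, Complex.norm_real, Real.norm_eq_abs, abs_of_pos (hYpos η),
        ← mul_assoc]
      gcongr
      rw [← div_eq_inv_mul, le_div_iff₀ hc]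
      linarith
    calc E c * NY ≤ E c * (E c⁻¹ * eLpNorm (fun η : ℝ => S' η * Z η) 2 volume) := by gcongr
      _ = _ := by
        rw [← mul_assoc, ← ENNReal.ofReal_mul hc.le, mul_inv_cancel₀ hc.ne', ENNReal.ofReal_one,
          one_mul]
  -- Absorption needs the norm of YZ to be finite, which is where the m square integrable
  -- derivatives of the cut-off enter.
  have hNYle : NY ≤ E (2 / c) * (E K * NG + E (K * C₀) * NW + E (K * C₁ * lam ^ (m - μ)) * NZ) := by
    refine absorb_half hc hYZ.eLpNorm_ne_top (hlow.trans ((hmain.trans hrhs).trans (le_of_eq ?_)))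
    rw [hKε]; ring
  have hFl : ∀ F : ℝ → ℂ, E (Xi m μ l lam ξ) *
      eLpNorm (fun η => ((2 * Real.pi * η : ℝ) : ℂ) ^ l * F η) 2 volume ≤
        E CX * eLpNorm (fun η => (Y η : ℂ) * F η) 2 volume := by
    intro F
    have h0 := Xi_nonneg (m := m) (μ := μ) (l := l) hl0.le ξ
    have e : E (Xi m μ l lam ξ) *
        eLpNorm (fun η => ((2 * Real.pi * η : ℝ) : ℂ) ^ l * F η) 2 volume =
        eLpNorm (fun η => (Xi m μ l lam ξ : ℂ) * (((2 * Real.pi * η : ℝ) : ℂ) ^ l * F η))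
          2 volume := (eLpNorm_ofReal_mul h0 _).symm
    rw [e]
    refine eLpNorm_le_mul_eLpNorm_of_ae_le_mul (Eventually.of_forall fun η => ?_) 2
    rw [norm_mul, norm_mul, norm_pow, norm_mul, Complex.norm_real, Complex.norm_real,
      Complex.norm_real, Real.norm_eq_abs, Real.norm_eq_abs, Real.norm_eq_abs, abs_of_nonneg h0,
      abs_of_pos (hYpos η), ← mul_assoc, ← mul_assoc]
    exact mul_le_mul_of_nonneg_right (hXi l lam hlam ξ η) (norm_nonneg _)
  have hlamW : E (lam ^ (m - μ)) * eLpNorm W 2 volume ≤ NW := by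
    rw [← eLpNorm_ofReal_mul (by positivity)]
    refine eLpNorm_mono fun η => ?_
    rw [norm_mul, norm_mul, Complex.norm_real, Complex.norm_real, Real.norm_eq_abs,
      Real.norm_eq_abs, abs_of_pos (hYpos η), abs_of_nonneg (by positivity)]
    exact mul_le_mul_of_nonneg_right (pow_le_prodWeight (norm_nonneg _) hl0) (norm_nonneg _)
  have hcut : ∀ l ≤ m, eLpNorm ((Set.Ioi 0).indicator (w l)) 2 volume ≤
      eLpNorm (fun η => ((2 * Real.pi * η : ℝ) : ℂ) ^ l * W η) 2 volume := by
    intro l hl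
    rw [(hw l hl).eLpNorm_eq]
    exact eLpNorm_indicator_le _
  have hindm : ∀ {f F : ℝ → ℂ}, IsFourierPair f F →
      AEStronglyMeasurable ((Set.Ioi 0).indicator f) volume := fun h =>
    (h.memLp_left.indicator measurableSet_Ioi).1
  -- The cut-off of u is the difference of the cut-offs of v and w, so only the half-line norm of v
  -- appears.
  have hNZle : NZ ≤ N0 + eLpNorm W 2 volume := by
    rw [hNZ, hZ.eLpNorm_eq]
    have e : (Set.Ioi 0).indicator (u 0) =
        (Set.Ioi 0).indicator (v 0) - (Set.Ioi 0).indicator (w 0) := by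
      ext x; by_cases hx : x ∈ Set.Ioi (0 : ℝ) <;> simp [hx, hu]
    rw [e]
    refine (eLpNorm_sub_le (hindm (hv 0 (Nat.zero_le _))) (hindm (hw 0 (Nat.zero_le _)))
      (by norm_num)).trans (add_le_add le_rfl ?_)
    simpa using hcut 0 (Nat.zero_le _)
  have hlamZ : E (lam ^ (m - μ)) * NZ ≤ E (lam ^ (m - μ)) * N0 + NW := by
    calc _ ≤ E (lam ^ (m - μ)) * (N0 + eLpNorm W 2 volume) := by gcongr
      _ ≤ _ := by rw [mul_add]; gcongr
  have hvl : eLpNorm ((Set.Ioi 0).indicator (v l)) 2 volume ≤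
      eLpNorm (fun η => ((2 * Real.pi * η : ℝ) : ℂ) ^ l * Z η) 2 volume +
      eLpNorm (fun η => ((2 * Real.pi * η : ℝ) : ℂ) ^ l * W η) 2 volume := by
    have e : (Set.Ioi 0).indicator (v l) =
        (Set.Ioi 0).indicator (u l) + (Set.Ioi 0).indicator (w l) := by
      ext x; by_cases hx : x ∈ Set.Ioi (0 : ℝ) <;> simp [hx, hu]
    rw [e, (hZpow l hl).eLpNorm_eq]
    exact (eLpNorm_add_le (hindm (hUu l hl)) (hindm (hw l hl)) (by norm_num)).trans
      (add_le_add le_rfl (hcut l hl))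
  set T := NG + B + E (lam ^ (m - μ)) * N0 with hT
  have hNW : NW ≤ E CL * T := hWle.trans (by
    rw [hT]; gcongr; exact le_add_right le_add_self)
  have hlast : E (K * C₁ * lam ^ (m - μ)) * NZ ≤ E (K * C₁) * ((1 + E CL) * T) := by
    have e : E (K * C₁ * lam ^ (m - μ)) = E (K * C₁) * E (lam ^ (m - μ)) :=
      ENNReal.ofReal_mul (by positivity)
    rw [e, mul_assoc]
    refine mul_le_mul_right (hlamZ.trans ?_) _
    rw [add_mul, one_mul]
    gcongr
    exact le_add_self
  calc E (Xi m μ l lam ξ) * eLpNorm ((Set.Ioi 0).indicator (v l)) 2 volume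
      ≤ E CX * NY + E CX * NW := by
        refine (mul_le_mul_right hvl _).trans ?_
        rw [mul_add]
        exact add_le_add (hFl Z) (hFl W)
    _ ≤ E CX * (E (2 / c) * (E K * T + E (K * C₀) * (E CL * T) + E (K * C₁) * ((1 + E CL) * T))) +
        E CX * (E CL * T) := by
        gcongr
        refine hNYle.trans ?_
        gcongr
        rw [hT]
        exact le_add_right le_self_add
    _ = Ctot * T := by rw [hCtot]; ring
    _ ≤ E (Ctot.toReal + 1) * T := by
        gcongr
        rw [← ENNReal.ofReal_toReal hCtop]
        exact ENNReal.ofReal_le_ofReal (by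
          rw [ENNReal.toReal_ofReal ENNReal.toReal_nonneg]; linarith)

end HalfLineEstimate

/-! ### Distributions given by functions; differential operators on the Fourier side. -/

section Representation

variable {n : ℕ} {Ω : Set (Rn n)} {T T' : 𝓢'(Rn n, ℂ)} {f g F : Rn n → ℂ}

/-- Integrability against a bump function equal to 1 near a point is local integrability there. -/
theorem RepresentedOn.locallyIntegrableOn (h : RepresentedOn Ω T f) (hΩ : IsOpen Ω) :
    LocallyIntegrableOn f Ω := by
  intro x hx
  obtain ⟨r, hr, hball⟩ := Metric.isOpen_iff.1 hΩ x hx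
  let b : ContDiffBump x := ⟨r / 4, r / 2, by positivity, by linarith⟩
  have hbc : HasCompactSupport fun y => (b y : ℂ) :=
    b.hasCompactSupport.comp_left (g := fun r : ℝ => (r : ℂ)) Complex.ofReal_zero
  have hbs : ContDiff ℝ (⊤ : ℕ∞) fun y => (b y : ℂ) := Complex.ofRealCLM.contDiff.comp b.contDiff
  have hsupp : tsupport (fun y => (b y : ℂ)) ⊆ Ω := by
    have h1 : tsupport (fun y => (b y : ℂ)) ⊆ tsupport b := by
      refine closure_mono fun y hy => ?_
      simpa using hy
    refine h1.trans ?_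
    rw [b.tsupport_eq]
    exact (Metric.closedBall_subset_ball (show r / 2 < r by linarith)).trans hball
  have h2 := (h (hbc.toSchwartzMap hbs) hsupp).1
  refine ⟨Metric.ball x (r / 4) ∩ Ω, inter_mem (mem_nhdsWithin_of_mem_nhds
    (Metric.ball_mem_nhds x (by positivity))) self_mem_nhdsWithin, ?_⟩
  · refine (h2.mono_set Set.inter_subset_right).congr_fun (fun y hy => ?_)
      (Metric.isOpen_ball.inter hΩ).measurableSet
    change f y * (b y : ℂ) = f y
    rw [b.one_of_mem_closedBall (Metric.ball_subset_closedBall hy.1), Complex.ofReal_one, mul_one]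

theorem RepresentedOn.ae_eq (h : RepresentedOn Ω T f) (h' : RepresentedOn Ω T g)
    (hΩ : IsOpen Ω) : ∀ᵐ x, x ∈ Ω → f x = g x := by
  have h1 : ∀ᵐ x ∂(volume.restrict Ω), x ∈ Ω → f x - g x = 0 := by
    have hl := (h.locallyIntegrableOn hΩ).sub (h'.locallyIntegrableOn hΩ)
    refine ae_eq_zero_of_integral_schwartz hΩ
      (fun x hx => (hl x hx).mono_measure Measure.restrict_le_self) fun φ _ hφ => ?_
    have e1 := h φ hφ
    have e2 := h' φ hφ
    simp only [sub_mul]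
    rw [integral_sub e1.1 e2.1, ← e1.2, ← e2.2, sub_self]
  rw [ae_restrict_iff' hΩ.measurableSet] at h1
  filter_upwards [h1] with x hx hxΩ
  exact sub_eq_zero.1 (hx hxΩ hxΩ)

theorem RepresentedOn.restrict (h : RepresentedOn Set.univ T f) (hΩ : MeasurableSet Ω) :
    RepresentedOn Ω T f := by
  intro φ hφ
  obtain ⟨h1, h2⟩ := h φ (Set.subset_univ _)
  refine ⟨h1.mono_set (Set.subset_univ _), ?_⟩
  rw [h2, setIntegral_univ, ← integral_indicator hΩ]
  congr 1; ext x
  by_cases hx : x ∈ Ω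
  · rw [Set.indicator_of_mem hx]
  · rw [Set.indicator_of_notMem hx, image_eq_zero_of_notMem_tsupport fun h' => hx (hφ h'), mul_zero]

theorem RepresentedOn.aestronglyMeasurable (h : RepresentedOn Set.univ T f) :
    AEStronglyMeasurable f volume :=
  (locallyIntegrableOn_univ.1 (h.locallyIntegrableOn isOpen_univ)).aestronglyMeasurable

theorem RepresentedOn.congr (h : RepresentedOn Ω T f) (hfg : f =ᵐ[volume] g) :
    RepresentedOn Ω T g := by
  intro φ hφ
  obtain ⟨h1, h2⟩ := h φ hφ
  have h3 : (fun x => f x * φ x) =ᵐ[volume.restrict Ω] fun x => g x * φ x :=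
    EventuallyEq.mul (ae_restrict_of_ae hfg) (ae_eq_refl _)
  exact ⟨h1.congr h3, h2.trans (integral_congr_ae h3)⟩

theorem RepresentedOn.smul (h : RepresentedOn Ω T f) (c : ℂ) :
    RepresentedOn Ω (c • T) fun x => c * f x := by
  intro φ hφ
  obtain ⟨h1, h2⟩ := h φ hφ
  simp only [mul_assoc]
  refine ⟨h1.const_mul c, ?_⟩
  rw [integral_const_mul, ← h2]
  rfl

theorem RepresentedOn.sum {ι : Type*} (s : Finset ι) {T : ι → 𝓢'(Rn n, ℂ)} {f : ι → Rn n → ℂ}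
    (h : ∀ i ∈ s, RepresentedOn Ω (T i) (f i)) :
    RepresentedOn Ω (∑ i ∈ s, T i) fun x => ∑ i ∈ s, f i x := by
  intro φ hφ
  simp only [Finset.sum_mul]
  refine ⟨integrable_finsetSum _ fun i hi => (h i hi φ hφ).1, ?_⟩
  rw [integral_finsetSum _ fun i hi => (h i hi φ hφ).1, sum_apply]
  exact Finset.sum_congr rfl fun i hi => (h i hi φ hφ).2

theorem RepresentedOn.fourier (h : RepresentedOn Set.univ T f) (hf : IsFourierPair f F) :
    RepresentedOn Set.univ (𝓕 T) F := by
  intro φ _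
  obtain ⟨-, h2⟩ := h (𝓕 φ) (Set.subset_univ _)
  rw [setIntegral_univ] at h2 ⊢
  refine ⟨(hf.memLp_right.integrable_mul (φ.memLp 2 volume)).integrableOn, ?_⟩
  rw [TemperedDistribution.fourier_apply, h2, hf.integral_eq]

theorem RepresentedOn.of_fourier (h : RepresentedOn Set.univ (𝓕 T) F) (hf : IsFourierPair f F) :
    RepresentedOn Set.univ T f := by
  intro φ _
  obtain ⟨-, h2⟩ := h (𝓕⁻ φ) (Set.subset_univ _)
  rw [setIntegral_univ] at h2 ⊢
  refine ⟨(hf.memLp_left.integrable_mul (φ.memLp 2 volume)).integrableOn, ?_⟩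
  rw [TemperedDistribution.fourier_apply, FourierTransform.fourier_fourierInv_eq] at h2
  rw [h2, ← hf.integral_eq, FourierTransform.fourier_fourierInv_eq]

theorem exists_representedOn (hf : MemLp f 2 volume) :
    ∃ T : 𝓢'(Rn n, ℂ), RepresentedOn Set.univ T f := by
  refine ⟨Lp.toTemperedDistribution hf.toLp, fun φ _ => ?_⟩
  rw [setIntegral_univ]
  refine ⟨(hf.integrable_mul (φ.memLp 2 volume)).integrableOn, ?_⟩
  rw [Lp.toTemperedDistribution_apply]
  refine integral_congr_ae ?_
  filter_upwards [hf.coeFn_toLp] with x hx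
  rw [hx, smul_eq_mul, mul_comm]

theorem funSobolevNorm_le (hf : IsFourierPair f F) (σ : Rn n → ℝ) :
    funSobolevNorm σ f ≤ eLpNorm (fun η => (σ ((2 * Real.pi) • η) : ℂ) * F η) 2 volume := by
  obtain ⟨T, hT⟩ := exists_representedOn hf.memLp_left
  exact (iInf₂_le T hT).trans (iInf₂_le F (hT.fourier hf))

/-- The transform has a unique representative up to null sets, so the infima in the definition range
over equal values. -/
theorem le_funSobolevNorm (hf : IsFourierPair f F) (σ : Rn n → ℝ) :
    eLpNorm (fun η => (σ ((2 * Real.pi) • η) : ℂ) * F η) 2 volume ≤ funSobolevNorm σ f := by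
  refine le_iInf₂ fun T hT => le_iInf₂ fun G hG => le_of_eq (eLpNorm_congr_ae ?_)
  filter_upwards [hG.ae_eq (hT.fourier hf) isOpen_univ] with x hx
  rw [hx (Set.mem_univ x)]

theorem hasTemperateGrowth_coord (i : Fin n) :
    (fun η : Rn n => ((2 * Real.pi * η i : ℝ) : ℂ)).HasTemperateGrowth := by
  have h : (fun η : Rn n => ((2 * Real.pi * η i : ℝ) : ℂ)) =
      (Complex.ofRealCLM.comp ((2 * Real.pi) • EuclideanSpace.proj i : Rn n →L[ℝ] ℝ) : Rn n → ℂ) := by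
    ext η; simp
  rw [h]
  exact ContinuousLinearMap.hasTemperateGrowth _

theorem fourier_D (i : Fin n) (T : 𝓢'(Rn n, ℂ)) :
    𝓕 (D i T) = TemperedDistribution.smulLeftCLM ℂ
      (fun η : Rn n => ((2 * Real.pi * η i : ℝ) : ℂ)) (𝓕 T) := by
  have h1 : 𝓕 (D i T) = (-Complex.I) • 𝓕 (LineDeriv.lineDerivOp
      (EuclideanSpace.single i (1 : ℝ)) T : 𝓢'(Rn n, ℂ)) :=
    map_smul (FourierTransform.fourierCLM ℂ 𝓢'(Rn n, ℂ)) (-Complex.I) _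
  have hg : (fun η : Rn n =>
      ((inner ℝ η (EuclideanSpace.single i (1 : ℝ)) : ℝ) : ℂ)).HasTemperateGrowth := by
    fun_prop
  have hg' : (fun η : Rn n => ((2 * Real.pi * η i : ℝ) : ℂ)) = (2 * Real.pi : ℂ) •
      fun η : Rn n => ((inner ℝ η (EuclideanSpace.single i (1 : ℝ)) : ℝ) : ℂ) := by
    ext η
    rw [Pi.smul_apply, EuclideanSpace.inner_single_right]
    simp
  rw [h1, TemperedDistribution.fourier_lineDerivOp_eq, smul_smul, hg',
    TemperedDistribution.smulLeftCLM_smul hg]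
  have : -Complex.I * (2 * Real.pi * Complex.I) = 2 * Real.pi := by
    linear_combination (-2 * Real.pi : ℂ) * Complex.I_mul_I
  rw [this]
  rfl

theorem RepresentedOn.fourier_D (h : RepresentedOn Set.univ (𝓕 T) F) (i : Fin n) :
    RepresentedOn Set.univ (𝓕 (D i T)) fun η => ((2 * Real.pi * η i : ℝ) : ℂ) * F η := by
  intro φ _
  have h1 := h (SchwartzMap.smulLeftCLM ℂ (fun η : Rn n => ((2 * Real.pi * η i : ℝ) : ℂ)) φ)
    (Set.subset_univ _)
  simp only [SchwartzMap.smulLeftCLM_apply_apply (hasTemperateGrowth_coord i), smul_eq_mul] at h1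
  have h2 : ∀ η : Rn n, ((2 * Real.pi * η i : ℝ) : ℂ) * F η * φ η =
      F η * (((2 * Real.pi * η i : ℝ) : ℂ) * φ η) := fun η => by ring
  simp only [h2]
  rw [NewtonHalfSpace.fourier_D, TemperedDistribution.smulLeftCLM_apply_apply]
  exact h1

theorem RepresentedOn.fourier_D_pow (h : RepresentedOn Set.univ (𝓕 T) F) (i : Fin n) (k : ℕ) :
    RepresentedOn Set.univ (𝓕 ((D i ^ k) T)) fun η => ((2 * Real.pi * η i : ℝ) : ℂ) ^ k * F η := by
  induction k with
  | zero => simpa using h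
  | succ k ih =>
    rw [pow_succ']
    refine (ih.fourier_D i).congr (Eventually.of_forall fun η => ?_)
    simp only [pow_succ]; ring

theorem RepresentedOn.fourier_Dpow (h : RepresentedOn Set.univ (𝓕 T) F) (α : Fin n →₀ ℕ) :
    RepresentedOn Set.univ (𝓕 (Dpow α T))
      fun η => (∏ i, ((2 * Real.pi * η i : ℝ) : ℂ) ^ α i) * F η := by
  have key : ∀ l : List (Fin n), RepresentedOn Set.univ
      (𝓕 ((l.map fun i => D i ^ α i).prod T))
      fun η => (l.map fun i => ((2 * Real.pi * η i : ℝ) : ℂ) ^ α i).prod * F η := by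
    intro l
    induction l with
    | nil => simpa using h
    | cons i l ih =>
      refine (ih.fourier_D_pow i (α i)).congr (Eventually.of_forall fun η => ?_)
      simp only [List.map_cons, List.prod_cons]; ring
  refine (key (List.finRange n)).congr (Eventually.of_forall fun η => ?_)
  simp only
  rw [← List.prod_ofFn, List.ofFn_eq_map]

theorem RepresentedOn.fourier_smul (h : RepresentedOn Set.univ (𝓕 T) F) (c : ℂ) :
    RepresentedOn Set.univ (𝓕 (c • T)) fun η => c * F η := by
  rw [show 𝓕 (c • T) = c • 𝓕 T from map_smul (FourierTransform.fourierCLM ℂ 𝓢'(Rn n, ℂ)) c T]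
  exact h.smul c

theorem RepresentedOn.fourier_sum {ι : Type*} (s : Finset ι) {T : ι → 𝓢'(Rn n, ℂ)}
    {F : ι → Rn n → ℂ} (h : ∀ i ∈ s, RepresentedOn Set.univ (𝓕 (T i)) (F i)) :
    RepresentedOn Set.univ (𝓕 (∑ i ∈ s, T i)) fun η => ∑ i ∈ s, F i η := by
  rw [show 𝓕 (∑ i ∈ s, T i) = ∑ i ∈ s, 𝓕 (T i) from
    map_sum (FourierTransform.fourierCLM ℂ 𝓢'(Rn n, ℂ)) T s]
  exact RepresentedOn.sum s h

theorem RepresentedOn.fourier_diffOp (h : RepresentedOn Set.univ (𝓕 T) F)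
    (p : MvPolynomial (Fin n) ℂ) : RepresentedOn Set.univ (𝓕 (diffOp p T))
      fun η => MvPolynomial.eval (fun i => ((2 * Real.pi * η i : ℝ) : ℂ)) p * F η := by
  refine (RepresentedOn.fourier_sum p.support fun α _ =>
    (h.fourier_Dpow α).fourier_smul (p.coeff α)).congr (Eventually.of_forall fun η => ?_)
  simp only
  rw [MvPolynomial.eval_eq', Finset.sum_mul]
  exact Finset.sum_congr rfl fun α _ => by ring

/-- On the Fourier side the operator pencil is multiplication by its symbol. -/
theorem RepresentedOn.fourier_pencil (h : RepresentedOn Set.univ (𝓕 T) F) (m μ : ℕ)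
    (A : ℕ → MvPolynomial (Fin n) ℂ) (lam : ℝ) :
    RepresentedOn Set.univ (𝓕 (pencil m μ A lam T))
      fun η => symbol m μ A ((2 * Real.pi) • η) lam * F η := by
  refine (RepresentedOn.fourier_sum _ fun j _ =>
    (h.fourier_diffOp (A j)).fourier_smul ((lam : ℂ) ^ (2 * m - j))).congr
    (Eventually.of_forall fun η => ?_)
  simp only
  rw [symbol, Finset.sum_mul]
  refine Finset.sum_congr rfl fun j _ => ?_
  rw [mul_assoc]
  rfl

end Representation

/-! ### Tensor products of tangential and normal test functions. -/

section Tensor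

variable {d : ℕ}

/-- The decay is measured in L x, since L need not be injective. For the two coordinate projections
the product of such weights dominates |y|, which suffices for the tensor product. -/
theorem norm_iteratedFDeriv_comp_clm_le {E F : Type*} [NormedAddCommGroup E] [NormedSpace ℝ E]
    [NormedAddCommGroup F] [NormedSpace ℝ F] (a : 𝓢(F, ℂ)) (L : E →L[ℝ] F) (k i : ℕ) :
    ∃ C, 0 ≤ C ∧ ∀ x, (1 + ‖L x‖) ^ k * ‖iteratedFDeriv ℝ i (fun x => a (L x)) x‖ ≤ C := by
  set B := 2 ^ k * (Finset.Iic (k, i)).sup (fun m => SchwartzMap.seminorm ℝ m.1 m.2) a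
  refine ⟨B * ‖L‖ ^ i, by positivity, fun x => ?_⟩
  have h1 : iteratedFDeriv ℝ i (fun x => a (L x)) x =
      (iteratedFDeriv ℝ i a (L x)).compContinuousLinearMap fun _ => L :=
    L.iteratedFDeriv_comp_right (a.smooth ⊤) x (i := i) (by exact_mod_cast le_top)
  have h2 := SchwartzMap.one_add_le_sup_seminorm_apply (𝕜 := ℝ) (m := (k, i)) le_rfl le_rfl a (L x)
  rw [h1]
  calc _ ≤ (1 + ‖L x‖) ^ k * (‖iteratedFDeriv ℝ i a (L x)‖ * ‖L‖ ^ i) := by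
        gcongr
        refine (ContinuousMultilinearMap.norm_compContinuousLinearMap_le _ _).trans (le_of_eq ?_)
        simp
    _ = (1 + ‖L x‖) ^ k * ‖iteratedFDeriv ℝ i a (L x)‖ * ‖L‖ ^ i := by ring
    _ ≤ _ := by gcongr

/-- The tensor product of two Schwartz functions. -/
def tensor (a : 𝓢(Rn d, ℂ)) (ψ : 𝓢(ℝ, ℂ)) : 𝓢(Rn (d + 1), ℂ) where
  toFun y := a ((glueEquiv d).symm y).1 * ψ ((glueEquiv d).symm y).2
  smooth' := ((a.smooth ⊤).comp (contDiff_fst.comp (glueEquiv d).symm.contDiff)).mul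
    ((ψ.smooth ⊤).comp (contDiff_snd.comp (glueEquiv d).symm.contDiff))
  decay' := by
    intro k n
    let P : Rn (d + 1) →L[ℝ] Rn d := (ContinuousLinearMap.fst ℝ (Rn d) ℝ).comp
      ((glueEquiv d).symm : Rn (d + 1) →L[ℝ] Rn d × ℝ)
    let q : Rn (d + 1) →L[ℝ] ℝ := (ContinuousLinearMap.snd ℝ (Rn d) ℝ).comp
      ((glueEquiv d).symm : Rn (d + 1) →L[ℝ] Rn d × ℝ)
    choose C₁ hC₁ h1 using fun i => norm_iteratedFDeriv_comp_clm_le a P k i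
    choose C₂ hC₂ h2 using fun i => norm_iteratedFDeriv_comp_clm_le ψ q k i
    refine ⟨∑ i ∈ Finset.range (n + 1), n.choose i * (C₁ i * C₂ (n - i)), fun y => ?_⟩
    have hy : ‖y‖ ≤ (1 + ‖P y‖) * (1 + ‖q y‖) := by
      have e : y = glue (P y) (q y) := by
        have := (glueEquiv d).apply_symm_apply y
        rw [glueEquiv_apply] at this
        exact this.symm
      conv_lhs => rw [e]
      refine (norm_glue_le _ _).trans ?_
      rw [← Real.norm_eq_abs]
      nlinarith [norm_nonneg (P y), norm_nonneg (q y)]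
    have hm := norm_iteratedFDeriv_mul_le (𝕜 := ℝ) (N := ((⊤ : ℕ∞) : WithTop ℕ∞))
      (f := fun y => a (P y)) (g := fun y => ψ (q y)) ((a.smooth ⊤).comp P.contDiff)
      ((ψ.smooth ⊤).comp q.contDiff) y (n := n) (by exact_mod_cast le_top)
    calc _ ≤ ((1 + ‖P y‖) * (1 + ‖q y‖)) ^ k * ∑ i ∈ Finset.range (n + 1), (n.choose i : ℝ) *
          ‖iteratedFDeriv ℝ i (fun y => a (P y)) y‖ *
          ‖iteratedFDeriv ℝ (n - i) (fun y => ψ (q y)) y‖ := by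
          gcongr
          exact hm
      _ = ∑ i ∈ Finset.range (n + 1), (n.choose i : ℝ) *
          (((1 + ‖P y‖) ^ k * ‖iteratedFDeriv ℝ i (fun y => a (P y)) y‖) *
          ((1 + ‖q y‖) ^ k * ‖iteratedFDeriv ℝ (n - i) (fun y => ψ (q y)) y‖)) := by
          rw [Finset.mul_sum, mul_pow]
          exact Finset.sum_congr rfl fun i _ => by ring
      _ ≤ _ := by
          gcongr with i hi
          · exact hC₁ i
          · exact h1 i y
          · exact h2 (n - i) y

theorem tensor_glue (a : 𝓢(Rn d, ℂ)) (ψ : 𝓢(ℝ, ℂ)) (x : Rn d) (t : ℝ) :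
    tensor a ψ (glue x t) = a x * ψ t := by
  have h : (glueEquiv d).symm (glue x t) = (x, t) := by
    rw [← glueEquiv_apply (x, t), ContinuousLinearEquiv.symm_apply_apply]
  change a ((glueEquiv d).symm (glue x t)).1 * ψ ((glueEquiv d).symm (glue x t)).2 = _
  rw [h]

theorem exists_eq_glue (y : Rn (d + 1)) : ∃ (x : Rn d), y = glue x (y (Fin.last d)) := by
  obtain ⟨⟨x, t⟩, rfl⟩ := (glueEquiv d).surjective y
  rw [glueEquiv_apply, glue_last]
  exact ⟨x, rfl⟩

theorem tsupport_tensor_subset (a : 𝓢(Rn d, ℂ)) {ψ : 𝓢(ℝ, ℂ)} (hψ : VanishesLeft ψ) :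
    tsupport (tensor a ψ) ⊆ halfSpace d := by
  obtain ⟨b, hb, h⟩ := hψ
  have hcl : IsClosed {y : Rn (d + 1) | b ≤ y (Fin.last d)} :=
    isClosed_le continuous_const (EuclideanSpace.proj (Fin.last d)).continuous
  have hsub : tsupport (tensor a ψ) ⊆ {y : Rn (d + 1) | b ≤ y (Fin.last d)} := by
    refine closure_minimal (fun y hy => ?_) hcl
    by_contra hlt
    obtain ⟨x, hx⟩ := exists_eq_glue y
    refine hy ?_
    rw [hx, tensor_glue, h _ (not_le.1 hlt), mul_zero]
  exact fun y hy => hb.trans_le (hsub hy)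

theorem fourierInv_tensor (a : 𝓢(Rn d, ℂ)) (ψ : 𝓢(ℝ, ℂ)) (x : Rn d) (η : ℝ) :
    (𝓕⁻ (tensor a ψ) : 𝓢(Rn (d + 1), ℂ)) (glue x η) =
      (𝓕⁻ a : 𝓢(Rn d, ℂ)) x * (𝓕⁻ ψ : 𝓢(ℝ, ℂ)) η := by
  rw [SchwartzMap.fourierInv_coe, SchwartzMap.fourierInv_coe, SchwartzMap.fourierInv_coe,
    Real.fourierInv_eq, Real.fourierInv_eq, Real.fourierInv_eq,
    ← measurePreserving_glue.integral_comp measurableEmbedding_glue, ← integral_prod_mul]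
  congr 1; ext p
  rw [tensor_glue, inner_glue, AddChar.map_add_eq_mul, Circle.smul_def, Circle.smul_def,
    Circle.smul_def, Circle.coe_mul, smul_eq_mul, smul_eq_mul, smul_eq_mul]
  have : inner ℝ p.2 η = p.2 * η := by simp [mul_comm]
  rw [this]
  ring

end Tensor

/-! ### From an equation in the half-space to equations on normal lines. -/

section Slices

variable {d m μ : ℕ}

/-- The weight on the Fourier side of the whole space. -/
def spaceWeight (m μ : ℕ) (lam : ℝ) (y : Rn (d + 1)) : ℝ :=
  prodWeight m μ ‖(2 * Real.pi) • y‖ lam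

theorem spaceWeight_glue (m μ : ℕ) (lam : ℝ) (x : Rn d) (η : ℝ) :
    spaceWeight m μ lam (glue x η) = lineWeight m μ ((2 * Real.pi) • x) lam η := by
  rw [spaceWeight, lineWeight, smul_glue]

theorem spaceWeight_pos {lam : ℝ} (hlam : 0 < lam) (y : Rn (d + 1)) :
    0 < spaceWeight m μ lam y := prodWeight_pos (norm_nonneg _) hlam

theorem continuous_spaceWeight (m μ : ℕ) (lam : ℝ) :
    Continuous (spaceWeight m μ lam : Rn (d + 1) → ℝ) :=
  (continuous_prodWeight m μ lam).comp (by fun_prop)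

theorem memLp_spaceWeight_mul (hμ : μ < m) {lam : ℝ} (hlam : 0 < lam) (φ : 𝓢(Rn (d + 1), ℂ)) :
    MemLp (fun y => (spaceWeight m μ lam y : ℂ) * φ y) 2 := by
  have hg : (fun y : Rn (d + 1) => (((1 + ‖y‖ ^ 2) ^ m : ℝ) : ℂ)).HasTemperateGrowth := by
    have h1 : (fun y : Rn (d + 1) => ((1 + ‖y‖ ^ 2) ^ m : ℝ)).HasTemperateGrowth :=
      ((Function.HasTemperateGrowth.const (E := Rn (d + 1)) (1 : ℝ)).add
        (Function.hasTemperateGrowth_norm_sq (H := Rn (d + 1)))).pow m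
    exact Complex.ofRealCLM.hasTemperateGrowth.comp h1
  set K := 2 * (1 + lam + 2 * Real.pi) with hK
  have hpi := Real.pi_pos
  refine ((SchwartzMap.smulLeftCLM ℂ (fun y : Rn (d + 1) => (((1 + ‖y‖ ^ 2) ^ m : ℝ) : ℂ))
    φ).memLp 2 volume).of_le_mul (c := K ^ m) ?_ (Eventually.of_forall fun y => ?_)
  · exact ((Complex.continuous_ofReal.comp (continuous_spaceWeight m μ lam)).mul
      φ.continuous).aestronglyMeasurable
  · rw [SchwartzMap.smulLeftCLM_apply_apply hg, smul_eq_mul, norm_mul, norm_mul, Complex.norm_real,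
      Complex.norm_real, Real.norm_eq_abs, Real.norm_eq_abs, abs_of_pos (spaceWeight_pos hlam y),
      abs_of_nonneg (by positivity), ← mul_assoc, ← mul_pow]
    have hr := norm_nonneg y
    have hn : ‖(2 * Real.pi) • y‖ = 2 * Real.pi * ‖y‖ := by
      rw [norm_smul, Real.norm_eq_abs, abs_of_pos (by positivity)]
    have e0 : 1 + ‖y‖ ≤ 2 * (1 + ‖y‖ ^ 2) := by nlinarith [sq_nonneg (‖y‖ - 1)]
    have e1 : 1 + ‖(2 * Real.pi) • y‖ ≤ K * (1 + ‖y‖ ^ 2) := by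
      rw [hn, hK]
      calc _ ≤ (1 + lam + 2 * Real.pi) * (1 + ‖y‖) := by nlinarith
        _ ≤ (1 + lam + 2 * Real.pi) * (2 * (1 + ‖y‖ ^ 2)) := by gcongr
        _ = _ := by ring
    have e2 : lam + ‖(2 * Real.pi) • y‖ ≤ K * (1 + ‖y‖ ^ 2) := by
      rw [hn, hK]
      calc _ ≤ (1 + lam + 2 * Real.pi) * (1 + ‖y‖) := by nlinarith
        _ ≤ (1 + lam + 2 * Real.pi) * (2 * (1 + ‖y‖ ^ 2)) := by gcongr
        _ = _ := by ring
    gcongr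
    calc spaceWeight m μ lam y ≤ (K * (1 + ‖y‖ ^ 2)) ^ μ * (K * (1 + ‖y‖ ^ 2)) ^ (m - μ) := by
          unfold spaceWeight prodWeight
          exact mul_le_mul (pow_le_pow_left₀ (by positivity) e1 _)
            (pow_le_pow_left₀ (by positivity) e2 _) (by positivity) (by positivity)
      _ = _ := by rw [← pow_add, Nat.add_sub_cancel' hμ.le]

variable {h : Rn (d + 1) → ℂ} {lam : ℝ}

theorem integrable_mul_schwartz (hμ : μ < m) (hlam : 0 < lam)
    (hh : MemLp (fun y => ((spaceWeight m μ lam y)⁻¹ : ℂ) * h y) 2) (φ : 𝓢(Rn (d + 1), ℂ)) :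
    Integrable fun y => h y * φ y := by
  refine (hh.integrable_mul (memLp_spaceWeight_mul hμ hlam φ)).congr
    (Eventually.of_forall fun y => ?_)
  have : (spaceWeight m μ lam y : ℂ) ≠ 0 := by exact_mod_cast (spaceWeight_pos hlam y).ne'
  simp only [Pi.mul_apply]
  field_simp

/-- Testing with the tensor product of 𝓕a and ψ, whose inverse transform is a ⊗ 𝓕⁻ψ, and using
Fubini shows that the slice integral, as a function of x, represents the zero distribution. -/
theorem ae_integral_slice_eq_zero (hμ : μ < m) (hlam : 0 < lam)
    (hh : MemLp (fun y => ((spaceWeight m μ lam y)⁻¹ : ℂ) * h y) 2)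
    (h0 : ∀ φ : 𝓢(Rn (d + 1), ℂ), tsupport φ ⊆ halfSpace d →
      ∫ y, h y * (𝓕⁻ φ : 𝓢(Rn (d + 1), ℂ)) y = 0) {ψ : 𝓢(ℝ, ℂ)} (hψ : VanishesLeft ψ) :
    ∀ᵐ x : Rn d, ∫ η, h (glue x η) * (𝓕⁻ ψ : 𝓢(ℝ, ℂ)) η = 0 := by
  set b : Rn d → ℂ := fun x => ∫ η, h (glue x η) * (𝓕⁻ ψ : 𝓢(ℝ, ℂ)) η with hb
  have hrep : RepresentedOn Set.univ (0 : 𝓢'(Rn d, ℂ)) b := by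
    intro a _
    have h1 := integrable_mul_schwartz hμ hlam hh (𝓕⁻ (tensor (𝓕 a) ψ) : 𝓢(Rn (d + 1), ℂ))
    have h2 := measurePreserving_glue.integrable_comp_of_integrable h1
    have h3 := h0 _ (tsupport_tensor_subset (𝓕 a) hψ)
    rw [← measurePreserving_glue.integral_comp measurableEmbedding_glue] at h3
    have e : ∀ p : Rn d × ℝ, h (glue p.1 p.2) *
        (𝓕⁻ (tensor (𝓕 a) ψ) : 𝓢(Rn (d + 1), ℂ)) (glue p.1 p.2) =
        a p.1 * (h (glue p.1 p.2) * (𝓕⁻ ψ : 𝓢(ℝ, ℂ)) p.2) := by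
      intro p
      rw [fourierInv_tensor, FourierTransform.fourierInv_fourier_eq]; ring
    simp only [Function.comp_def, e] at h2 h3
    have e' : ∀ x, b x * a x = ∫ η, a x * (h (glue x η) * (𝓕⁻ ψ : 𝓢(ℝ, ℂ)) η) := by
      intro x
      rw [integral_const_mul, mul_comm]
    rw [setIntegral_univ]
    simp only [e']
    refine ⟨h2.integral_prod_left.integrableOn, ?_⟩
    rw [← integral_prod _ h2, h3]
    rfl
  have hrep0 : RepresentedOn Set.univ (0 : 𝓢'(Rn d, ℂ)) fun _ => 0 := by
    intro a _
    simp
  filter_upwards [hrep.ae_eq hrep0 isOpen_univ] with x hx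
  exact hx (Set.mem_univ x)

/-- A single null set works for all test functions. -/
theorem ae_forall_integral_slice_eq_zero (hμ : μ < m) (hlam : 0 < lam)
    (hh : MemLp (fun y => ((spaceWeight m μ lam y)⁻¹ : ℂ) * h y) 2)
    (h0 : ∀ φ : 𝓢(Rn (d + 1), ℂ), tsupport φ ⊆ halfSpace d →
      ∫ y, h y * (𝓕⁻ φ : 𝓢(Rn (d + 1), ℂ)) y = 0) :
    ∀ᵐ x : Rn d, ∀ ψ : 𝓢(ℝ, ℂ), VanishesLeft ψ →
      ∫ η, h (glue x η) * (𝓕⁻ ψ : 𝓢(ℝ, ℂ)) η = 0 := by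
  -- This is (1 + |2πη|)^m. It does not depend on x but dominates every line weight up to an
  -- x-dependent factor, so one weighted L₂ topology on test functions serves all slices.
  set ω : ℝ → ℝ := lineWeight m 0 (0 : Rn 0) 1 with hω
  have hm : 0 < m := by omega
  have hωpos : ∀ η, 0 < ω η := lineWeight_pos _ zero_lt_one
  have hmem : ∀ ψ : 𝓢(ℝ, ℂ), MemLp (fun η => (ω η : ℂ) * (𝓕⁻ ψ : 𝓢(ℝ, ℂ)) η) 2 := fun ψ =>
    memLp_lineWeight_mul_schwartz _ zero_lt_one hm ψ
  let e : {ψ : 𝓢(ℝ, ℂ) // VanishesLeft ψ} → Lp ℂ 2 (volume : Measure ℝ) := fun ψ =>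
    (hmem ψ).toLp
  have : SecondCountableTopology (Lp ℂ 2 (volume : Measure ℝ)) := by
    have : Fact ((2 : ℝ≥0∞) ≠ ∞) := ⟨by norm_num⟩
    infer_instance
  -- Countably many test functions are dense in the weighted norm. Their null sets are united, and
  -- the remaining test functions follow by continuity of the pairing.
  obtain ⟨S, hS, hSc, hSd⟩ := (TopologicalSpace.IsSeparable.of_separableSpace
    (Set.range e)).exists_countable_dense_subset
  have : Nonempty {ψ : 𝓢(ℝ, ℂ) // VanishesLeft ψ} := ⟨⟨0, 1, one_pos, fun t _ => rfl⟩⟩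
  choose! ψS hψS using fun s (hs : s ∈ S) => hS hs
  have hall : ∀ᵐ x : Rn d, ∀ s ∈ S,
      ∫ η, h (glue x η) * (𝓕⁻ (ψS s : 𝓢(ℝ, ℂ)) : 𝓢(ℝ, ℂ)) η = 0 :=
    (ae_ball_iff hSc).2 fun s _ => ae_integral_slice_eq_zero hμ hlam hh h0 (ψS s).2
  filter_upwards [hall, memLp_slice_left (MemLp.comp_glue hh)] with x hx hx2 ψ hψ
  set k : ℝ → ℂ := fun η => ((ω η)⁻¹ : ℂ) * h (glue x η) with hk
  have hωcont : Continuous ω := continuous_lineWeight _ _ _ _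
  have hωne : ∀ η, (ω η : ℂ) ≠ 0 := fun η => by exact_mod_cast (hωpos η).ne'
  have hkL : MemLp k 2 := by
    refine hx2.of_le_mul (c := (1 + lam + ‖(2 * Real.pi) • x‖) ^ m) ?_
      (Eventually.of_forall fun η => ?_)
    · have e1 : k = fun η => ((ω η)⁻¹ : ℂ) * ((spaceWeight m μ lam (glue x η) : ℂ) *
          (((spaceWeight m μ lam (glue x η))⁻¹ : ℂ) * h (glue x η))) := by
        ext η
        have : (spaceWeight m μ lam (glue x η) : ℂ) ≠ 0 := by
          exact_mod_cast (spaceWeight_pos hlam _).ne'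
        rw [hk]
        field_simp
      rw [e1]
      refine (((Complex.continuous_ofReal.comp hωcont).inv₀ hωne).aestronglyMeasurable).mul
        (Continuous.aestronglyMeasurable ?_ |>.mul hx2.1)
      simp only [spaceWeight_glue]
      exact Complex.continuous_ofReal.comp (continuous_lineWeight _ _ _ _)
    · have h1 := lineWeight_le (μ := μ) ((2 * Real.pi) • x) hlam hμ η
      have h2 : ω η = (1 + |2 * Real.pi * η|) ^ m := by
        rw [hω, lineWeight, norm_glue_zero_left, prodWeight, pow_zero, one_mul, Nat.sub_zero]
      have h3 := spaceWeight_pos (m := m) (μ := μ) hlam (glue x η)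
      rw [← spaceWeight_glue, ← h2] at h1
      rw [hk, norm_mul, norm_mul, norm_inv, norm_inv, Complex.norm_real, Complex.norm_real,
        Real.norm_eq_abs, Real.norm_eq_abs, abs_of_pos (hωpos η), abs_of_pos h3, ← mul_assoc]
      gcongr
      rw [inv_le_iff_one_le_mul₀ (hωpos η), mul_assoc, ← div_eq_inv_mul, ← mul_div_assoc,
        one_le_div h3]
      exact h1
  have hpair : ∀ ψ : 𝓢(ℝ, ℂ), ∫ η, h (glue x η) * (𝓕⁻ ψ : 𝓢(ℝ, ℂ)) η =
      ∫ η, k η * ((ω η : ℂ) * (𝓕⁻ ψ : 𝓢(ℝ, ℂ)) η) := by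
    intro ψ
    congr 1; ext η
    have := hωne η
    rw [hk]
    field_simp
  obtain ⟨s, hsS, hs⟩ := mem_closure_iff_seq_limit.1 (hSd ⟨⟨ψ, hψ⟩, rfl⟩)
  have hlim : Tendsto (fun j => eLpNorm ((fun η => (ω η : ℂ) *
      (𝓕⁻ (ψS (s j) : 𝓢(ℝ, ℂ)) : 𝓢(ℝ, ℂ)) η) - fun η => (ω η : ℂ) * (𝓕⁻ ψ : 𝓢(ℝ, ℂ)) η) 2 volume)
      atTop (𝓝 0) := by
    have h1 := (Lp.tendsto_Lp_iff_tendsto_eLpNorm'' (fi := atTop) (fun j η => (ω η : ℂ) *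
      (𝓕⁻ (ψS (s j) : 𝓢(ℝ, ℂ)) : 𝓢(ℝ, ℂ)) η) (fun j => hmem (ψS (s j)))
      (fun η => (ω η : ℂ) * (𝓕⁻ ψ : 𝓢(ℝ, ℂ)) η) (hmem ψ)).1
    refine h1 ?_
    convert hs using 2 with j
    exact hψS (s j) (hsS j)
  have h4 := tendsto_integral_mul hkL (hmem ψ) (fun j => hmem (ψS (s j))) hlim
  rw [hpair]
  refine tendsto_nhds_unique h4 ?_
  simp only [← hpair]
  exact tendsto_const_nhds.congr fun j => (hx (s j) (hsS j)).symm

end Slices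

/-! ### Boundary values expressed by the Fourier transform. -/

section Trace

variable {d : ℕ}

theorem ae_glue {p : Rn (d + 1) → Prop} (h : ∀ᵐ y, p y) :
    ∀ᵐ z : Rn d × ℝ ∂(volume.prod volume), p (glue z.1 z.2) :=
  measurePreserving_glue.quasiMeasurePreserving.ae h

theorem ae_ae_glue {p : Rn (d + 1) → Prop} (h : ∀ᵐ y, p y) :
    ∀ᵐ t : ℝ, ∀ᵐ x : Rn d, p (glue x t) := by
  have h1 := (Measure.measurePreserving_swap (μ := (volume : Measure ℝ))
    (ν := (volume : Measure (Rn d)))).quasiMeasurePreserving.ae (ae_glue h)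
  exact Measure.ae_ae_of_ae_prod h1

theorem glue_mem_halfSpace {x : Rn d} {t : ℝ} : glue x t ∈ halfSpace d ↔ 0 < t := by
  change 0 < glue x t (Fin.last d) ↔ _
  rw [glue_last]

theorem isOpen_halfSpace : IsOpen (halfSpace d) :=
  isOpen_lt continuous_const (EuclideanSpace.proj (Fin.last d)).continuous

theorem frequently_nhdsGT_of_ae {p : ℝ → Prop} (h : ∀ᵐ t, p t) : ∃ᶠ t in 𝓝[>] (0 : ℝ), p t := by
  intro hn
  obtain ⟨ε, hε, hs⟩ := mem_nhdsGT_iff_exists_Ioo_subset.1 hn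
  have h0 : volume (Set.Ioo (0 : ℝ) ε) = 0 := measure_mono_null hs (by
    simpa [ae_iff] using h)
  rw [Real.volume_Ioo, ENNReal.ofReal_eq_zero] at h0
  have : (0 : ℝ) < ε := hε
  linarith

theorem stronglyMeasurable_fourierInv_slice {F : Rn (d + 1) → ℂ} (hF : StronglyMeasurable F) :
    StronglyMeasurable fun p : Rn d × ℝ => 𝓕⁻ (fun η => F (glue p.1 η)) p.2 := by
  simp only [Real.fourierInv_eq]
  refine StronglyMeasurable.integral_prod_right
    (f := fun (q : Rn d × ℝ) (η : ℝ) => Real.fourierChar (inner ℝ η q.2) • F (glue q.1 η)) ?_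
  refine StronglyMeasurable.smul (f := fun z : (Rn d × ℝ) × ℝ =>
    Real.fourierChar (inner ℝ z.2 z.1.2)) (g := fun z => F (glue z.1.1 z.2)) ?_ ?_
  · have : Continuous fun z : (Rn d × ℝ) × ℝ => inner ℝ z.2 z.1.2 := by fun_prop
    exact (Real.continuous_fourierChar.comp this).stronglyMeasurable
  · have : Continuous fun z : (Rn d × ℝ) × ℝ => glue z.1.1 z.2 :=
      continuous_glue.comp ((continuous_fst.comp continuous_fst).prodMk continuous_snd)
    exact hF.comp_measurable this.measurable

theorem continuous_fourierInv_of_integrable {f : ℝ → ℂ} (hf : Integrable f) :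
    Continuous (𝓕⁻ f) := by
  have : (𝓕⁻ f) = fun t => 𝓕 f (-t) := by
    ext t; rw [Real.fourierInv_eq_fourier_neg]
  rw [this]
  exact (continuous_fourier_of_integrable hf).comp continuous_neg

/-- The boundary value of `v` on the Fourier side. -/
theorem IsTrace.ae_eq_integral {v : 𝓢'(Rn (d + 1), ℂ)} {g G : Rn d → ℂ} {f F : Rn (d + 1) → ℂ}
    (hg : IsTrace v g) (hG : IsFourierPair g G) (hv : RepresentedOn Set.univ v f)
    (hf : IsFourierPair f F) (hF : StronglyMeasurable F)
    (hint : ∀ᵐ x : Rn d, Integrable fun η => F (glue x η)) :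
    G =ᵐ[volume] fun x => ∫ η, F (glue x η) := by
  obtain ⟨H, hHm, hHL, hH1, hH2⟩ := hf.exists_partial
  obtain ⟨-, h, hh, hlim⟩ := hg
  -- The version of the partial transform given by the inversion integral, which for almost every x
  -- is continuous in t; its value at t = 0 is the integral of F over the normal line.
  set E : Rn d × ℝ → ℂ := fun p => 𝓕⁻ (fun η => F (glue p.1 η)) p.2 with hE
  have hEm : StronglyMeasurable E := stronglyMeasurable_fourierInv_slice hF
  have hslice : ∀ᵐ x : Rn d, ∀ᵐ t : ℝ, H (x, t) = E (x, t) := by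
    filter_upwards [hint, hH2] with x hx hx2
    exact hx2.left_unique (IsFourierPair.of_integrable_right hx hx2.memLp_right)
  have hslice' : ∀ᵐ t : ℝ, ∀ᵐ x : Rn d, H (x, t) = E (x, t) :=
    (Measure.ae_ae_comm (p := fun x t => H (x, t) = E (x, t))
      (measurableSet_eq_fun hHm.measurable hEm.measurable)).1 hslice
  have hfh : ∀ᵐ t : ℝ, ∀ᵐ x : Rn d, glue x t ∈ halfSpace d → h (glue x t) = f (glue x t) :=
    ae_ae_glue (hh.ae_eq (hv.restrict isOpen_halfSpace.measurableSet) isOpen_halfSpace)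
  -- The identities hold only for almost every t, so heights s_k → 0+ are selected at which all of
  -- them hold.
  obtain ⟨s, hs, hgood⟩ := exists_seq_forall_of_frequently
    ((frequently_nhdsGT_of_ae (hslice'.and (hfh.and hH1))).and_eventually self_mem_nhdsWithin)
  have hnorm : ∀ k, eLpNorm (fun x => H (x, s k) - G x) 2 volume =
      eLpNorm (fun x => h (glue x (s k)) - g x) 2 volume := by
    intro k
    obtain ⟨⟨-, h2, h3⟩, h4⟩ := hgood k
    rw [(h3.sub hG).eLpNorm_eq]
    refine eLpNorm_congr_ae ?_
    filter_upwards [h2] with x hx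
    rw [hx (glue_mem_halfSpace.2 h4)]
  have hae : ∀ᵐ x : Rn d, ∀ k, H (x, s k) = E (x, s k) :=
    ae_all_iff.2 fun k => (hgood k).1.1
  have hs0 : Tendsto s atTop (𝓝 0) := hs.mono_right nhdsWithin_le_nhds
  -- H(·, s_k) tends to G in L₂ by Plancherel and the definition of the trace, and to E(·, 0)
  -- pointwise almost everywhere; Fatou's lemma identifies the limits.
  have hzero : eLpNorm (fun x => E (x, 0) - G x) 2 volume ≤ 0 := by
    refine (Lp.eLpNorm_lim_le_liminf_eLpNorm (f := fun k x => H (x, s k) - G x) (fun k => ?_)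
      (fun x => E (x, 0) - G x) ?_).trans ?_
    · exact ((hHm.comp_measurable measurable_prodMk_right).aestronglyMeasurable).sub
        hG.memLp_right.1
    · filter_upwards [hae, hint] with x hx hx2
      have hc : Continuous fun t => E (x, t) := continuous_fourierInv_of_integrable hx2
      simp only [hx]
      exact ((hc.tendsto 0).comp hs0).sub_const _
    · simp only [hnorm]
      exact ((hlim.comp hs).liminf_eq).le
  have hz := (eLpNorm_eq_zero_iff (((hEm.comp_measurable
    measurable_prodMk_right).aestronglyMeasurable).sub hG.memLp_right.1) (by norm_num)).1
    (le_antisymm hzero zero_le)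
  filter_upwards [hz] with x hx
  have e : E (x, 0) = ∫ η, F (glue x η) := by
    rw [hE]
    simp [Real.fourierInv_eq]
  rw [← e]
  exact (sub_eq_zero.1 hx).symm

theorem le_traceNorm {v : 𝓢'(Rn (d + 1), ℂ)} {f F : Rn (d + 1) → ℂ}
    (hv : RepresentedOn Set.univ v f) (hf : IsFourierPair f F) (hF : StronglyMeasurable F)
    (hint : ∀ᵐ x : Rn d, Integrable fun η => F (glue x η)) (σ : Rn d → ℝ) :
    eLpNorm (fun x => (σ ((2 * Real.pi) • x) : ℂ) * ∫ η, F (glue x η)) 2 volume ≤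
      traceNorm σ v := by
  refine le_iInf₂ fun g hg => ?_
  obtain ⟨G, hG⟩ := IsFourierPair.exists_right hg.1
  refine le_trans (le_of_eq (eLpNorm_congr_ae ?_)) (le_funSobolevNorm hG σ)
  filter_upwards [hg.ae_eq_integral hG hv hf hF hint] with x hx
  rw [hx]

end Trace

/-! ### L₂ norms of extended nonnegative functions. -/

section Norms

variable {α β : Type*} [MeasurableSpace α] [MeasurableSpace β] {κ : Measure α} {ν : Measure β}

theorem eLpNorm_two_sq_ennreal {f : α → ℝ≥0∞} : eLpNorm f 2 κ ^ 2 = ∫⁻ x, f x ^ 2 ∂κ := by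
  have := eLpNorm_nnreal_pow_eq_lintegral (μ := κ) (f := f) (p := 2) (by norm_num)
  simpa using this

theorem eLpNorm_const_mul_ennreal {f : α → ℝ≥0∞} {c : ℝ≥0∞} (hc : c ≠ ∞) :
    eLpNorm (fun x => c * f x) 2 κ = c * eLpNorm f 2 κ := by
  refine (ENNReal.pow_right_strictMono two_ne_zero).injective ?_
  simp only [mul_pow, eLpNorm_two_sq_ennreal]
  rw [lintegral_const_mul' _ _ (by simp [hc])]

theorem eLpNorm_le_of_ae_le {ι : Type*} (s : Finset ι) {a f g : α → ℝ≥0∞} {t : ι → α → ℝ≥0∞}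
    {C c : ℝ≥0∞} (hC : C ≠ ∞) (hc : c ≠ ∞) (hf : AEMeasurable f κ) (hg : AEMeasurable g κ)
    (ht : ∀ i ∈ s, AEMeasurable (t i) κ)
    (h : ∀ᵐ x ∂κ, a x ≤ C * (f x + ∑ i ∈ s, t i x + c * g x)) :
    eLpNorm a 2 κ ≤ C * (eLpNorm f 2 κ + ∑ i ∈ s, eLpNorm (t i) 2 κ + c * eLpNorm g 2 κ) := by
  have hs : AEMeasurable (∑ i ∈ s, t i) κ := Finset.aemeasurable_sum s ht
  have h1 : eLpNorm a 2 κ ≤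
      eLpNorm (fun x => C * ((f + ∑ i ∈ s, t i) + fun x => c * g x) x) 2 κ := by
    refine eLpNorm_mono_enorm_ae ?_
    filter_upwards [h] with x hx
    simpa using hx
  rw [eLpNorm_const_mul_ennreal hC] at h1
  refine h1.trans (mul_le_mul_right ?_ C)
  refine (eLpNorm_add_le (hf.add hs).aestronglyMeasurable (hg.const_mul c).aestronglyMeasurable
    one_le_two).trans ?_
  rw [eLpNorm_const_mul_ennreal hc]
  gcongr
  refine (eLpNorm_add_le hf.aestronglyMeasurable hs.aestronglyMeasurable one_le_two).trans ?_
  gcongr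
  exact eLpNorm_sum_le (fun i hi => (ht i hi).aestronglyMeasurable) one_le_two

theorem sum_sq_rpow_half_le {ι : Type*} (s : Finset ι) {b : ι → ℝ≥0∞} {B : ℝ≥0∞}
    (h : ∀ i ∈ s, b i ≤ B) : (∑ i ∈ s, b i ^ 2) ^ (1 / 2 : ℝ) ≤ s.card * B := by
  have h1 : ∑ i ∈ s, b i ^ 2 ≤ (s.card * B) ^ 2 := by
    calc _ ≤ ∑ i ∈ s, B ^ 2 := Finset.sum_le_sum fun i hi => pow_le_pow_left₀ zero_le (h i hi) 2
      _ = s.card * B ^ 2 := by rw [Finset.sum_const, nsmul_eq_mul]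
      _ ≤ (s.card : ℝ≥0∞) ^ 2 * B ^ 2 := by
        gcongr
        exact_mod_cast Nat.le_self_pow two_ne_zero _
      _ = _ := (mul_pow _ _ _).symm
  calc _ ≤ (((s.card : ℝ≥0∞) * B) ^ 2) ^ (1 / 2 : ℝ) := ENNReal.rpow_le_rpow h1 (by norm_num)
    _ = _ := by
      rw [← ENNReal.rpow_natCast, ← ENNReal.rpow_mul]
      norm_num

variable [SFinite ν]

theorem aemeasurable_eLpNorm_slice {f : α × β → ℂ} (hf : AEStronglyMeasurable f (κ.prod ν)) :
    AEMeasurable (fun a => eLpNorm (fun b => f (a, b)) 2 ν) κ := by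
  have h := (aemeasurable_eLpNorm_left hf).pow_const (1 / 2 : ℝ)
  refine h.congr (Eventually.of_forall fun a => ?_)
  simp only
  rw [← ENNReal.rpow_natCast, ← ENNReal.rpow_mul]
  norm_num

theorem eLpNorm_eLpNorm_slice {f : α × β → ℂ} (hf : AEStronglyMeasurable f (κ.prod ν)) :
    eLpNorm (fun a => eLpNorm (fun b => f (a, b)) 2 ν) 2 κ = eLpNorm f 2 (κ.prod ν) := by
  refine (ENNReal.pow_right_strictMono two_ne_zero).injective ?_
  simp only [eLpNorm_two_sq_ennreal]
  rw [lintegral_eLpNorm_sq_left hf]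

end Norms

/-! ### Half-space norms through half-line norms of partial transforms. -/

section HalfSpaceNorms

variable {d m μ : ℕ}

theorem eLpNorm_comp_glue {f : Rn (d + 1) → ℂ} (hf : AEStronglyMeasurable f volume) :
    eLpNorm (fun p : Rn d × ℝ => f (glue p.1 p.2)) 2 (volume.prod volume) = eLpNorm f 2 volume :=
  eLpNorm_comp_measurePreserving hf measurePreserving_glue

/-- The norm of `L₂(ℝ₊)` of the slices of a partial Fourier transform. -/
def halfLineNorm (H : Rn d × ℝ → ℂ) (x : Rn d) : ℝ≥0∞ :=
  eLpNorm ((Set.Ioi 0).indicator fun t => H (x, t)) 2 volume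

theorem halfLineNorm_eq (H : Rn d × ℝ → ℂ) (x : Rn d) :
    halfLineNorm H x = eLpNorm (fun t => H (x, t)) 2 (volume.restrict (Set.Ioi 0)) :=
  eLpNorm_indicator_eq_eLpNorm_restrict measurableSet_Ioi

theorem aemeasurable_halfLineNorm {H : Rn d × ℝ → ℂ} (hH : StronglyMeasurable H) :
    AEMeasurable (halfLineNorm H) volume := by
  rw [funext (halfLineNorm_eq H)]
  exact aemeasurable_eLpNorm_slice hH.aestronglyMeasurable

/-- The half-space norm is controlled by the norms on the half-lines. -/
theorem lintegral_funSobolevNorm_le {u : Rn (d + 1) → ℂ} {H : Rn d × ℝ → ℂ}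
    (hH : StronglyMeasurable H) {σ : Rn d → ℝ} (hσ : Continuous σ) (hσ0 : ∀ ξ, 0 ≤ σ ξ)
    (h : ∀ᵐ t : ℝ, IsFourierPair (fun x => u (glue x t)) fun x => H (x, t)) :
    ∫⁻ t in Set.Ioi (0 : ℝ), funSobolevNorm σ (fun x => u (glue x t)) ^ 2 ≤
      eLpNorm (fun x => ENNReal.ofReal (σ ((2 * Real.pi) • x)) * halfLineNorm H x) 2 volume ^ 2 := by
  set K : Rn d × ℝ → ℂ := fun p => (σ ((2 * Real.pi) • p.1) : ℂ) * H p with hK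
  have hKm : StronglyMeasurable K := by
    refine StronglyMeasurable.mul (Continuous.stronglyMeasurable ?_) hH
    fun_prop
  calc _ ≤ ∫⁻ t in Set.Ioi (0 : ℝ), eLpNorm (fun x => K (x, t)) 2 volume ^ 2 := by
        refine lintegral_mono_ae (ae_restrict_of_ae ?_)
        filter_upwards [h] with t ht
        exact pow_le_pow_left₀ zero_le (funSobolevNorm_le ht σ) 2
    _ = eLpNorm K 2 (volume.prod (volume.restrict (Set.Ioi 0))) ^ 2 :=
        lintegral_eLpNorm_sq_right hKm.aestronglyMeasurable
    _ = ∫⁻ x, eLpNorm (fun t => K (x, t)) 2 (volume.restrict (Set.Ioi 0)) ^ 2 :=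
        (lintegral_eLpNorm_sq_left hKm.aestronglyMeasurable).symm
    _ = _ := by
        rw [eLpNorm_two_sq_ennreal]
        simp only [hK, eLpNorm_ofReal_mul (hσ0 _), halfLineNorm_eq]

/-- Plancherel on almost every horizontal slice and Tonelli. Representatives of v on the half-space
agree almost everywhere, so the infimum plays no role. -/
theorem eLpNorm_halfLineNorm_le {v : 𝓢'(Rn (d + 1), ℂ)} {u : Rn (d + 1) → ℂ} {H : Rn d × ℝ → ℂ}
    (hH : StronglyMeasurable H) (hv : RepresentedOn Set.univ v u)
    (h : ∀ᵐ t : ℝ, IsFourierPair (fun x => u (glue x t)) fun x => H (x, t)) :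
    eLpNorm (halfLineNorm H) 2 volume ≤ halfSpaceL2Norm v := by
  refine le_iInf₂ fun f hf => ?_
  have hum := hv.aestronglyMeasurable
  have e1 : eLpNorm f 2 (volume.restrict (halfSpace d)) =
      eLpNorm u 2 (volume.restrict (halfSpace d)) := by
    refine eLpNorm_congr_ae ?_
    refine (ae_restrict_iff' isOpen_halfSpace.measurableSet).2 ?_
    exact hf.ae_eq (hv.restrict isOpen_halfSpace.measurableSet) isOpen_halfSpace
  have hpre : (fun p : Rn d × ℝ => glue p.1 p.2) ⁻¹' halfSpace d =
      Set.univ ×ˢ Set.Ioi (0 : ℝ) := by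
    ext p
    simp [glue_mem_halfSpace]
  have e2 : eLpNorm u 2 (volume.restrict (halfSpace d)) =
      eLpNorm (fun p : Rn d × ℝ => u (glue p.1 p.2)) 2
        (volume.prod (volume.restrict (Set.Ioi 0))) := by
    have hmp := measurePreserving_glue.restrict_preimage
      (isOpen_halfSpace (d := d)).measurableSet
    rw [hpre, ← Measure.prod_restrict, Measure.restrict_univ] at hmp
    exact (eLpNorm_comp_measurePreserving hum.restrict hmp).symm
  have hum' : AEStronglyMeasurable (fun p : Rn d × ℝ => u (glue p.1 p.2))
      (volume.prod (volume.restrict (Set.Ioi 0))) := by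
    have h1 := hum.comp_quasiMeasurePreserving measurePreserving_glue.quasiMeasurePreserving
    refine h1.mono_measure ?_
    exact Measure.prod_mono le_rfl Measure.restrict_le_self
  rw [e1, e2]
  refine le_of_eq ((ENNReal.pow_right_strictMono two_ne_zero).injective ?_)
  simp only [funext (halfLineNorm_eq H)]
  rw [eLpNorm_eLpNorm_slice hH.aestronglyMeasurable,
    ← lintegral_eLpNorm_sq_right hH.aestronglyMeasurable, ← lintegral_eLpNorm_sq_right hum']
  refine lintegral_congr_ae (ae_restrict_of_ae ?_)
  filter_upwards [h] with t ht
  rw [ht.eLpNorm_eq]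

end HalfSpaceNorms

/-! ### Integration of the half-line estimates over the tangential frequencies. -/

section HalfSpaceEstimate

variable {d m μ : ℕ} {A : ℕ → MvPolynomial (Fin (d + 1)) ℂ} {lam : ℝ}
  {u : 𝓢'(Rn (d + 1), ℂ)} {U : Rn (d + 1) → ℂ}

theorem MemSobolevSpace.exists_fourier (hμ : μ < m) (hlam : 0 < lam)
    (hu : MemSobolevSpace (Xi m μ 0 lam) u) : ∃ U : Rn (d + 1) → ℂ, StronglyMeasurable U ∧
      RepresentedOn Set.univ (𝓕 u) U ∧ MemLp (fun y => (spaceWeight m μ lam y : ℂ) * U y) 2 := by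
  rw [MemSobolevSpace, sobolevNorm] at hu
  simp only [iInf_lt_iff] at hu
  obtain ⟨g, hg, hfin⟩ := hu
  have hgm := hg.aestronglyMeasurable
  obtain ⟨C, hC, hle⟩ := exists_prodWeight_le (n := d + 1) hμ
  -- A strongly measurable representative is needed for the measurability in x of slices and
  -- boundary integrals.
  refine ⟨hgm.mk, hgm.stronglyMeasurable_mk, hg.congr hgm.ae_eq_mk, ?_⟩
  have h1 : MemLp (fun η : Rn (d + 1) => (Xi m μ 0 lam ((2 * Real.pi) • η) : ℂ) * g η) 2 := by
    refine ⟨?_, hfin⟩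
    have hc := continuous_Xi (n := d + 1) m μ 0 lam
    refine (Continuous.aestronglyMeasurable ?_).mul hgm
    fun_prop
  refine h1.of_le_mul (c := C) ?_ ?_
  · exact (Complex.continuous_ofReal.comp (continuous_spaceWeight m μ lam)).aestronglyMeasurable.mul
      hgm.stronglyMeasurable_mk.aestronglyMeasurable
  · filter_upwards [hgm.ae_eq_mk] with y hy
    rw [← hy, norm_mul, norm_mul, Complex.norm_real, Complex.norm_real, Real.norm_eq_abs,
      Real.norm_eq_abs, abs_of_pos (spaceWeight_pos hlam y), abs_of_pos (Xi_pos hμ hlam _),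
      ← mul_assoc]
    exact mul_le_mul_of_nonneg_right (hle lam hlam _) (norm_nonneg _)

/-- Multiplication by the symbol of `D_n^l`. -/
def normalPow (l : ℕ) (U : Rn (d + 1) → ℂ) (y : Rn (d + 1)) : ℂ :=
  ((2 * Real.pi * y (Fin.last d) : ℝ) : ℂ) ^ l * U y

theorem normalPow_glue (l : ℕ) (U : Rn (d + 1) → ℂ) (x : Rn d) (η : ℝ) :
    normalPow l U (glue x η) = ((2 * Real.pi * η : ℝ) : ℂ) ^ l * U (glue x η) := by
  rw [normalPow, glue_last]

theorem stronglyMeasurable_normalPow (l : ℕ) (hU : StronglyMeasurable U) :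
    StronglyMeasurable (normalPow l U) := by
  have h : Continuous fun y : Rn (d + 1) => ((2 * Real.pi * y (Fin.last d) : ℝ) : ℂ) ^ l := by
    fun_prop
  exact h.stronglyMeasurable.mul hU

theorem memLp_normalPow (hμ : μ < m) (hlam : 0 < lam) (hUm : StronglyMeasurable U)
    (hU : MemLp (fun y => (spaceWeight m μ lam y : ℂ) * U y) 2) {l : ℕ} (hl : l ≤ m) :
    MemLp (normalPow l U) 2 := by
  obtain ⟨C, hC, hle⟩ := exists_Xi_mul_pow_le_lineWeight (d := d) (m := m) (μ := μ) hlam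
  refine hU.of_le_mul (c := C) ?_ (Eventually.of_forall fun y => ?_)
  · exact (stronglyMeasurable_normalPow l hUm).aestronglyMeasurable
  · obtain ⟨x, hx⟩ := exists_eq_glue y
    have h1 := hle l lam le_rfl ((2 * Real.pi) • x) (y (Fin.last d))
    rw [← spaceWeight_glue, ← hx] at h1
    have h2 := one_le_Xi hμ hl hlam.le ((2 * Real.pi) • x)
    rw [normalPow, norm_mul, norm_mul, norm_pow, Complex.norm_real, Complex.norm_real, Real.norm_eq_abs,
      Real.norm_eq_abs, abs_of_pos (spaceWeight_pos hlam y), ← mul_assoc]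
    refine mul_le_mul_of_nonneg_right (le_trans ?_ h1) (norm_nonneg _)
    exact le_mul_of_one_le_left (by positivity) h2

/-- Pairing with 𝓕⁻φ undoes the transform and returns the value of g - f at φ. -/
theorem integral_sub_mul_fourierInv_eq_zero {f : 𝓢'(Rn (d + 1), ℂ)} {g : 𝓢'(Rn (d + 1), ℂ)}
    {F G : Rn (d + 1) → ℂ} (hF : RepresentedOn Set.univ (𝓕 f) F)
    (hG : RepresentedOn Set.univ (𝓕 g) G)
    (h : Distribution.IsVanishingOn (g - f) (halfSpace d)) {φ : 𝓢(Rn (d + 1), ℂ)}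
    (hφ : tsupport φ ⊆ halfSpace d) :
    ∫ y, (G y - F y) * (𝓕⁻ φ : 𝓢(Rn (d + 1), ℂ)) y = 0 := by
  obtain ⟨i1, e1⟩ := hF (𝓕⁻ φ) (Set.subset_univ _)
  obtain ⟨i2, e2⟩ := hG (𝓕⁻ φ) (Set.subset_univ _)
  rw [TemperedDistribution.fourier_apply, FourierTransform.fourier_fourierInv_eq,
    setIntegral_univ] at e1 e2
  rw [integrableOn_univ] at i1 i2
  have h0 : g φ - f φ = 0 := h φ hφ
  simp only [sub_mul]
  rw [integral_sub i2 i1, ← e1, ← e2, h0]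

theorem memLp_inv_spaceWeight_mul_symbol_mul
    (hA : ∀ j ∈ Finset.Icc (2 * μ) (2 * m), (A j).IsHomogeneous j) (hlam : 0 < lam)
    (hUm : StronglyMeasurable U) (hU : MemLp (fun y => (spaceWeight m μ lam y : ℂ) * U y) 2) :
    MemLp (fun y => ((spaceWeight m μ lam y)⁻¹ : ℂ) *
      (symbol m μ A ((2 * Real.pi) • y) lam * U y)) 2 := by
  obtain ⟨C, hC, hle⟩ := exists_norm_symbol_le hA
  have hw0 : ∀ y : Rn (d + 1), (spaceWeight m μ lam y : ℂ) ≠ 0 := fun y => by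
    exact_mod_cast (spaceWeight_pos hlam y).ne'
  refine hU.of_le_mul (c := C) ?_ (Eventually.of_forall fun y => ?_)
  · refine (Continuous.aestronglyMeasurable ?_).mul ((Continuous.aestronglyMeasurable ?_).mul
      hUm.aestronglyMeasurable)
    · exact (Complex.continuous_ofReal.comp (continuous_spaceWeight m μ lam)).inv₀ hw0
    · exact (continuous_symbol m μ A lam).comp (by fun_prop)
  · obtain ⟨x, hx⟩ := exists_eq_glue ((2 * Real.pi) • y)
    have h1 := hle lam hlam x (((2 * Real.pi) • y) (Fin.last d))
    rw [← hx] at h1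
    have hw := spaceWeight_pos (m := m) (μ := μ) hlam y
    rw [norm_mul, norm_mul, norm_mul, norm_inv, Complex.norm_real, Real.norm_eq_abs,
      abs_of_pos hw, ← mul_assoc, ← mul_assoc]
    refine mul_le_mul_of_nonneg_right ?_ (norm_nonneg _)
    rw [inv_mul_le_iff₀ hw]
    refine h1.trans (le_of_eq ?_)
    rw [spaceWeight]; ring

theorem sobolevNorm_inv_le {C : ℝ} (hμ : μ < m) (hlam : 0 < lam) (hC : 0 < C)
    (hle : ∀ ξ : Rn (d + 1), Xi m μ 0 lam ξ ≤ C * prodWeight m μ ‖ξ‖ lam)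
    (G : Rn (d + 1) → ℂ) :
    eLpNorm (fun y => ((spaceWeight m μ lam y)⁻¹ : ℂ) * G y) 2 volume ≤ ENNReal.ofReal C *
      eLpNorm (fun y => (((Xi m μ 0 lam ((2 * Real.pi) • y))⁻¹ : ℝ) : ℂ) * G y) 2 volume := by
  rw [← eLpNorm_ofReal_mul hC.le]
  refine eLpNorm_mono fun y => ?_
  have hw := spaceWeight_pos (m := m) (μ := μ) hlam y
  have hX := Xi_pos hμ hlam ((2 * Real.pi) • y)
  rw [norm_mul, norm_mul, norm_mul, norm_inv, Complex.norm_real, Complex.norm_real,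
    Complex.norm_real, Real.norm_eq_abs, Real.norm_eq_abs, Real.norm_eq_abs, abs_of_pos hw,
    abs_of_pos hC, abs_of_pos (inv_pos.2 hX), ← mul_assoc]
  refine mul_le_mul_of_nonneg_right ?_ (norm_nonneg _)
  rw [← div_eq_mul_inv, le_div_iff₀ hX, inv_mul_le_iff₀ hw]
  exact (hle _).trans (le_of_eq (mul_comm _ _))

theorem continuous_XiReal {n : ℕ} (m μ : ℕ) {r : ℝ} (hlam : 0 < lam) :
    Continuous fun ξ : Rn n => XiReal m μ r lam ξ := by
  have h1 : ∀ ξ : Rn n, 1 + ‖ξ‖ ≠ 0 := fun ξ => by positivity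
  have h2 : ∀ ξ : Rn n, lam + ‖ξ‖ ≠ 0 := fun ξ => by positivity
  exact ((continuous_const.add continuous_norm).rpow_const fun ξ => Or.inl (h1 ξ)).mul
    ((continuous_const.add continuous_norm).rpow_const fun ξ => Or.inl (h2 ξ))

/-- The normal derivatives of `u` and their partial Fourier transforms. -/
theorem exists_normal_derivatives (hμ : μ < m) (hlam : 0 < lam)
    (hUr : RepresentedOn Set.univ (𝓕 u) U) (hUm : StronglyMeasurable U)
    (hU : MemLp (fun y => (spaceWeight m μ lam y : ℂ) * U y) 2) :
    ∃ (w : ℕ → Rn (d + 1) → ℂ) (H : ℕ → Rn d × ℝ → ℂ), ∀ l ≤ m, StronglyMeasurable (H l) ∧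
      RepresentedOn Set.univ ((D (Fin.last d) ^ l) u) (w l) ∧
      IsFourierPair (w l) (normalPow l U) ∧
      (∀ᵐ t : ℝ, IsFourierPair (fun x => w l (glue x t)) fun x => H l (x, t)) ∧
      ∀ᵐ x : Rn d, IsFourierPair (fun t => H l (x, t))
        fun η => ((2 * Real.pi * η : ℝ) : ℂ) ^ l * U (glue x η) := by
  have hex : ∀ l, ∃ (w : Rn (d + 1) → ℂ) (H : Rn d × ℝ → ℂ), l ≤ m → StronglyMeasurable H ∧
      RepresentedOn Set.univ ((D (Fin.last d) ^ l) u) w ∧ IsFourierPair w (normalPow l U) ∧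
      (∀ᵐ t : ℝ, IsFourierPair (fun x => w (glue x t)) fun x => H (x, t)) ∧
      ∀ᵐ x : Rn d, IsFourierPair (fun t => H (x, t))
        fun η => ((2 * Real.pi * η : ℝ) : ℂ) ^ l * U (glue x η) := by
    intro l
    by_cases hl : l ≤ m
    · obtain ⟨w, hw⟩ := IsFourierPair.exists_left (memLp_normalPow hμ hlam hUm hU hl)
      obtain ⟨H, h1, -, h2, h3⟩ := hw.exists_partial
      simp only [normalPow_glue] at h3
      exact ⟨w, H, fun _ => ⟨h1, (hUr.fourier_D_pow (Fin.last d) l).of_fourier hw, hw, h2, h3⟩⟩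
    · exact ⟨0, 0, fun h => absurd h hl⟩
  choose w H h using hex
  exact ⟨w, H, h⟩

/-- The norms of the slices of the right-hand side. -/
def sliceNorm (m μ : ℕ) (lam : ℝ) (G : Rn (d + 1) → ℂ) (x : Rn d) : ℝ≥0∞ :=
  eLpNorm (fun η => ((lineWeight m μ ((2 * Real.pi) • x) lam η)⁻¹ : ℂ) * G (glue x η)) 2 volume

/-- The boundary values on the Fourier side, with their weights. -/
def boundaryTerm (m μ : ℕ) (lam : ℝ) (U : Rn (d + 1) → ℂ) (i : ℕ) (x : Rn d) : ℂ :=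
  (XiReal m μ (((i + 1 : ℕ) : ℝ) - 1 / 2) lam ((2 * Real.pi) • x) : ℂ) *
    ∫ η, normalPow i U (glue x η)

theorem aemeasurable_sliceNorm {G : Rn (d + 1) → ℂ}
    (hG : MemLp (fun y => ((spaceWeight m μ lam y)⁻¹ : ℂ) * G y) 2) :
    AEMeasurable (sliceNorm m μ lam G) volume := by
  have h := aemeasurable_eLpNorm_slice (MemLp.comp_glue hG).1
  simp only [spaceWeight_glue] at h
  exact h

theorem eLpNorm_sliceNorm {G : Rn (d + 1) → ℂ}
    (hG : MemLp (fun y => ((spaceWeight m μ lam y)⁻¹ : ℂ) * G y) 2) :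
    eLpNorm (sliceNorm m μ lam G) 2 volume =
      eLpNorm (fun y => ((spaceWeight m μ lam y)⁻¹ : ℂ) * G y) 2 volume := by
  have h := eLpNorm_eLpNorm_slice (MemLp.comp_glue hG).1
  rw [eLpNorm_comp_glue hG.1] at h
  rw [← h]
  simp only [spaceWeight_glue]
  rfl

theorem stronglyMeasurable_boundaryTerm (hlam : 0 < lam) (hU : StronglyMeasurable U) (i : ℕ) :
    StronglyMeasurable (boundaryTerm m μ lam U i) := by
  have h1 : StronglyMeasurable fun x : Rn d => ∫ η, normalPow i U (glue x η) :=
    ((stronglyMeasurable_normalPow i hU).comp_measurable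
      continuous_glue.measurable).integral_prod_right'
  have h2 := continuous_XiReal (n := d) (r := ((i + 1 : ℕ) : ℝ) - 1 / 2) m μ hlam
  have h3 : Continuous fun x : Rn d =>
      (XiReal m μ (((i + 1 : ℕ) : ℝ) - 1 / 2) lam ((2 * Real.pi) • x) : ℂ) :=
    Complex.continuous_ofReal.comp (h2.comp (continuous_const_smul _))
  exact h3.stronglyMeasurable.mul h1

theorem enorm_boundaryTerm (hlam : 0 < lam) (U : Rn (d + 1) → ℂ) (i : ℕ) (x : Rn d) :
    ‖boundaryTerm m μ lam U i x‖ₑ =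
      ENNReal.ofReal (XiReal m μ (((i + 1 : ℕ) : ℝ) - 1 / 2) lam ((2 * Real.pi) • x)) *
        ‖∫ η, ((2 * Real.pi * η : ℝ) : ℂ) ^ i * U (glue x η)‖ₑ := by
  have h : 0 ≤ XiReal m μ (((i + 1 : ℕ) : ℝ) - 1 / 2) lam ((2 * Real.pi) • x) := by
    unfold XiReal
    positivity
  rw [boundaryTerm, enorm_mul, ← ofReal_norm, Complex.norm_real, Real.norm_eq_abs, abs_of_nonneg h]
  simp only [normalPow_glue]

theorem eLpNorm_boundaryTerm_le {w : Rn (d + 1) → ℂ} {H₀ H₁ : Rn d × ℝ → ℂ} {i : ℕ}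
    (hUm : StronglyMeasurable U) (hwr : RepresentedOn Set.univ ((D (Fin.last d) ^ i) u) w)
    (hw : IsFourierPair w (normalPow i U))
    (h0 : ∀ᵐ x : Rn d, IsFourierPair (fun t => H₀ (x, t))
        fun η => ((2 * Real.pi * η : ℝ) : ℂ) ^ i * U (glue x η))
    (h1 : ∀ᵐ x : Rn d, IsFourierPair (fun t => H₁ (x, t))
        fun η => ((2 * Real.pi * η : ℝ) : ℂ) ^ (i + 1) * U (glue x η)) :
    eLpNorm (boundaryTerm m μ lam U i) 2 volume ≤
      traceNorm (XiReal m μ (((i + 1 : ℕ) : ℝ) - 1 / 2) lam) ((D (Fin.last d) ^ i) u) := by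
  refine le_traceNorm hwr hw (stronglyMeasurable_normalPow i hUm) ?_ _
  filter_upwards [h0, h1] with x hx0 hx1
  simp only [normalPow_glue]
  refine integrable_of_memLp_mul hx0.memLp_right (hx1.memLp_right.ae_eq ?_)
  exact Eventually.of_forall fun η => by simp only [pow_succ]; ring

/-- The half-line estimate applied at the frequency 2πx. Each of its hypotheses holds for almost
every x, by Fubini for the integrability and by the common null set for the equation. -/
theorem exists_slice_estimate (hA : ∀ j ∈ Finset.Icc (2 * μ) (2 * m), (A j).IsHomogeneous j)
    (hμ : μ < m) (hell : NElliptic m μ A) (hreg : DegeneratesRegularly m μ A)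
    (hprop : ProperlyElliptic m μ A) {lam0 : ℝ} (hlam0 : 0 < lam0) :
    ∃ C > 0, ∀ lam ≥ lam0, ∀ (U G : Rn (d + 1) → ℂ) (H : ℕ → Rn d × ℝ → ℂ),
      StronglyMeasurable U → MemLp (fun y => (spaceWeight m μ lam y : ℂ) * U y) 2 →
      MemLp (fun y => ((spaceWeight m μ lam y)⁻¹ : ℂ) * G y) 2 →
      (∀ l ≤ m, ∀ᵐ x : Rn d, IsFourierPair (fun t => H l (x, t))
        fun η => ((2 * Real.pi * η : ℝ) : ℂ) ^ l * U (glue x η)) →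
      (∀ φ : 𝓢(Rn (d + 1), ℂ), tsupport φ ⊆ halfSpace d →
        ∫ y, (G y - symbol m μ A ((2 * Real.pi) • y) lam * U y) *
          (𝓕⁻ φ : 𝓢(Rn (d + 1), ℂ)) y = 0) →
      ∀ l ≤ m, ∀ᵐ x : Rn d,
        ENNReal.ofReal (Xi m μ l lam ((2 * Real.pi) • x)) * halfLineNorm (H l) x ≤
        ENNReal.ofReal C * (sliceNorm m μ lam G x +
          ∑ i ∈ Finset.range m, ‖boundaryTerm m μ lam U i x‖ₑ +
          ENNReal.ofReal (lam ^ (m - μ)) * halfLineNorm (H 0) x) := by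
  obtain ⟨C, hC, hest⟩ := exists_halfLine_estimate hA hμ hell hreg hprop hlam0
  refine ⟨C, hC, fun lam hlam U G H hUm hU hG hH h0 l hl => ?_⟩
  have hl0 : 0 < lam := hlam0.trans_le hlam
  have hhL : MemLp (fun y => ((spaceWeight m μ lam y)⁻¹ : ℂ) *
      (G y - symbol m μ A ((2 * Real.pi) • y) lam * U y)) 2 := by
    refine (hG.sub (memLp_inv_spaceWeight_mul_symbol_mul hA hl0 hUm hU)).ae_eq
      (Eventually.of_forall fun y => ?_)
    simp only [Pi.sub_apply, mul_sub]
  have hann := ae_forall_integral_slice_eq_zero hμ hl0 hhL h0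
  have hH' : ∀ᵐ x : Rn d, ∀ l ≤ m, IsFourierPair (fun t => H l (x, t))
      fun η => ((2 * Real.pi * η : ℝ) : ℂ) ^ l * U (glue x η) := by
    refine ae_all_iff.2 fun l => ?_
    by_cases hl : l ≤ m
    · filter_upwards [hH l hl] with x hx _ using hx
    · exact Eventually.of_forall fun x h => absurd h hl
  have hU' := memLp_slice_left (MemLp.comp_glue hU)
  have hG' := memLp_slice_left (MemLp.comp_glue hG)
  simp only [spaceWeight_glue] at hU' hG'
  simp only [smul_glue] at hann
  filter_upwards [hH', hann, hU', hG'] with x hx1 hx2 hx3 hx4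
  simp only [enorm_boundaryTerm hl0]
  exact hest lam hlam ((2 * Real.pi) • x) (fun η => U (glue x η)) (fun η => G (glue x η))
    (fun l t => H l (x, t)) hx1 hx3 hx4 hx2 l hl

theorem exists_halfSpace_estimate (hA : ∀ j ∈ Finset.Icc (2 * μ) (2 * m), (A j).IsHomogeneous j)
    (hμ : μ < m) (hell : NElliptic m μ A) (hreg : DegeneratesRegularly m μ A)
    (hprop : ProperlyElliptic m μ A) {lam0 : ℝ} (hlam0 : 0 < lam0) :
    ∃ C > 0, ∀ lam ≥ lam0, ∀ u : 𝓢'(Rn (d + 1), ℂ), MemSobolevSpace (Xi m μ 0 lam) u →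
      ∀ g : 𝓢'(Rn (d + 1), ℂ),
      Distribution.IsVanishingOn (g - pencil m μ A lam u) (halfSpace d) →
      ∀ G : Rn (d + 1) → ℂ, RepresentedOn Set.univ (𝓕 g) G →
      MemLp (fun y => ((spaceWeight m μ lam y)⁻¹ : ℂ) * G y) 2 →
      halfSpaceXiNorm m μ lam u ≤ ENNReal.ofReal C *
        (eLpNorm (fun y => ((spaceWeight m μ lam y)⁻¹ : ℂ) * G y) 2 volume +
          ∑ i ∈ Finset.range m, traceNorm (XiReal m μ (((i + 1 : ℕ) : ℝ) - 1 / 2) lam)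
            ((D (Fin.last d) ^ i) u) +
          ENNReal.ofReal (lam ^ (m - μ)) * halfSpaceL2Norm u) := by
  obtain ⟨C, hC, hest⟩ := exists_slice_estimate hA hμ hell hreg hprop hlam0
  -- The factor m + 1 is the number of summands l = 0, …, m in the half-space norm.
  refine ⟨(m + 1) * C, by positivity, fun lam hlam u hu g hg G hGr hG => ?_⟩
  have hl0 : 0 < lam := hlam0.trans_le hlam
  obtain ⟨U, hUm, hUr, hU⟩ := hu.exists_fourier hμ hl0
  obtain ⟨w, H, hwH⟩ := exists_normal_derivatives hμ hl0 hUr hUm hU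
  have hpt := hest lam hlam U G H hUm hU hG (fun l hl => (hwH l hl).2.2.2.2) fun φ hφ =>
    integral_sub_mul_fourierInv_eq_zero (hUr.fourier_pencil m μ A lam) hGr hg hφ
  have hTn : ∀ i ∈ Finset.range m, eLpNorm (fun x => ‖boundaryTerm m μ lam U i x‖ₑ) 2 volume ≤
      traceNorm (XiReal m μ (((i + 1 : ℕ) : ℝ) - 1 / 2) lam) ((D (Fin.last d) ^ i) u) := by
    intro i hi
    have hi' := Finset.mem_range.1 hi
    obtain ⟨-, hr, hp, -, hs⟩ := hwH i hi'.le
    rw [eLpNorm_enorm]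
    exact eLpNorm_boundaryTerm_le hUm hr hp hs (hwH (i + 1) hi').2.2.2.2
  obtain ⟨hHm, hr, -, hs, -⟩ := hwH 0 (Nat.zero_le _)
  rw [pow_zero, Module.End.one_apply] at hr
  have hL : ∀ l ∈ Finset.range (m + 1), eLpNorm (fun x =>
      ENNReal.ofReal (Xi m μ l lam ((2 * Real.pi) • x)) * halfLineNorm (H l) x) 2 volume ≤
      ENNReal.ofReal C *
        (eLpNorm (fun y => ((spaceWeight m μ lam y)⁻¹ : ℂ) * G y) 2 volume +
          ∑ i ∈ Finset.range m, traceNorm (XiReal m μ (((i + 1 : ℕ) : ℝ) - 1 / 2) lam)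
            ((D (Fin.last d) ^ i) u) +
          ENNReal.ofReal (lam ^ (m - μ)) * halfSpaceL2Norm u) := by
    intro l hl
    have h1 := eLpNorm_le_of_ae_le (Finset.range m) ENNReal.ofReal_ne_top ENNReal.ofReal_ne_top
      (aemeasurable_sliceNorm hG) (aemeasurable_halfLineNorm hHm)
      (fun i _ => (stronglyMeasurable_boundaryTerm hl0 hUm i).enorm.aemeasurable)
      (hpt l (Nat.lt_succ_iff.1 (Finset.mem_range.1 hl)))
    refine h1.trans (mul_le_mul_right ?_ _)
    rw [eLpNorm_sliceNorm hG]
    exact add_le_add (add_le_add le_rfl (Finset.sum_le_sum hTn))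
      (mul_le_mul_right (eLpNorm_halfLineNorm_le hHm hr hs) _)
  have hsum := sum_sq_rpow_half_le (Finset.range (m + 1)) hL
  rw [Finset.card_range, ← mul_assoc] at hsum
  have hc : ENNReal.ofReal (((m : ℝ) + 1) * C) = ((m + 1 : ℕ) : ℝ≥0∞) * ENNReal.ofReal C := by
    rw [ENNReal.ofReal_mul (by positivity), ← Nat.cast_succ, ENNReal.ofReal_natCast]
  rw [hc]
  refine le_trans ?_ hsum
  refine ENNReal.rpow_le_rpow (Finset.sum_le_sum fun l hl => ?_) (by norm_num)
  obtain ⟨hm, hr, -, hs, -⟩ := hwH l (Nat.lt_succ_iff.1 (Finset.mem_range.1 hl))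
  exact (iInf₂_le (w l) (hr.restrict isOpen_halfSpace.measurableSet)).trans
    (lintegral_funSobolevNorm_le hm (continuous_Xi m μ l lam) (Xi_nonneg hl0.le) hs)

end HalfSpaceEstimate

/-! ### Infimum over all extensions of the right-hand side. -/

section Conclusion

variable {d m μ : ℕ} {A : ℕ → MvPolynomial (Fin (d + 1)) ℂ}

theorem exists_quotientNorm_estimate
    (hA : ∀ j ∈ Finset.Icc (2 * μ) (2 * m), (A j).IsHomogeneous j)
    (hμ : μ < m) (hell : NElliptic m μ A) (hreg : DegeneratesRegularly m μ A)
    (hprop : ProperlyElliptic m μ A) {lam0 : ℝ} (hlam0 : 0 < lam0) :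
    ∃ C > 0, ∀ lam ≥ lam0, ∀ u : 𝓢'(Rn (d + 1), ℂ), MemSobolevSpace (Xi m μ 0 lam) u →
      halfSpaceXiNorm m μ lam u ≤ ENNReal.ofReal C *
        (quotientNorm (fun ξ => (Xi m μ 0 lam ξ)⁻¹) (pencil m μ A lam u) +
          ∑ i ∈ Finset.range m, traceNorm (XiReal m μ (((i + 1 : ℕ) : ℝ) - 1 / 2) lam)
            ((D (Fin.last d) ^ i) u) +
          ENNReal.ofReal (lam ^ (m - μ)) * halfSpaceL2Norm u) := by
  obtain ⟨C₁, hC₁, hest⟩ := exists_halfSpace_estimate hA hμ hell hreg hprop hlam0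
  obtain ⟨C₂, hC₂, hle⟩ := exists_Xi_le (m := m) (μ := μ) (n := d + 1) hlam0
  -- C₂ pays for passing from the inverse product weight to 1/Ξ in the first term; the summand 1
  -- keeps the factor at least 1 for the other terms.
  refine ⟨C₁ * (1 + C₂), by positivity, fun lam hlam u hu => ?_⟩
  have hl0 : 0 < lam := hlam0.trans_le hlam
  have hC0 : ENNReal.ofReal (C₁ * (1 + C₂)) ≠ 0 := by
    rw [ne_eq, ENNReal.ofReal_eq_zero, not_le]; positivity
  rw [add_assoc]
  generalize hR : (∑ i ∈ Finset.range m, traceNorm (XiReal m μ (((i + 1 : ℕ) : ℝ) - 1 / 2) lam)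
    ((D (Fin.last d) ^ i) u) + ENNReal.ofReal (lam ^ (m - μ)) * halfSpaceL2Norm u) = R
  have key : ∀ g : 𝓢'(Rn (d + 1), ℂ),
      Distribution.IsVanishingOn (g - pencil m μ A lam u) (halfSpace d) →
      ∀ G : Rn (d + 1) → ℂ, RepresentedOn Set.univ (𝓕 g) G →
      halfSpaceXiNorm m μ lam u ≤ ENNReal.ofReal (C₁ * (1 + C₂)) * (eLpNorm (fun η =>
        (((Xi m μ 0 lam ((2 * Real.pi) • η))⁻¹ : ℝ) : ℂ) * G η) 2 volume + R) := by
    intro g hg G hG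
    have hw := sobolevNorm_inv_le hμ hl0 hC₂ (hle lam hlam) G
    rcases eq_or_ne (eLpNorm (fun η =>
      (((Xi m μ 0 lam ((2 * Real.pi) • η))⁻¹ : ℝ) : ℂ) * G η) 2 volume) ∞ with h | h
    · rw [h, top_add, ENNReal.mul_top hC0]
      exact le_top
    · have hGm : MemLp (fun y => ((spaceWeight m μ lam y)⁻¹ : ℂ) * G y) 2 := by
        refine ⟨(Continuous.aestronglyMeasurable ?_).mul hG.aestronglyMeasurable,
          hw.trans_lt (ENNReal.mul_lt_top ENNReal.ofReal_lt_top h.lt_top)⟩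
        exact (Complex.continuous_ofReal.comp (continuous_spaceWeight m μ lam)).inv₀ fun y =>
          Complex.ofReal_ne_zero.2 (spaceWeight_pos hl0 y).ne'
      have h1 := hest lam hlam u hu g hg G hG hGm
      rw [add_assoc, hR] at h1
      refine h1.trans ?_
      rw [ENNReal.ofReal_mul hC₁.le, mul_assoc]
      refine mul_le_mul_right ?_ _
      rw [mul_add]
      refine add_le_add (hw.trans ?_) ?_
      · gcongr
        linarith
      · refine le_mul_of_one_le_left zero_le ?_
        rw [ENNReal.one_le_ofReal]
        linarith
  have hC1 : ENNReal.ofReal (C₁ * (1 + C₂)) ≠ ∞ := ENNReal.ofReal_ne_top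
  -- Solving the inequality for the quotient norm lets the two infima, over the extensions g and
  -- over the representatives G, be handled by a lower bound.
  rw [mul_comm, ← ENNReal.div_le_iff_le_mul (Or.inl hC0) (Or.inl hC1), ← tsub_le_iff_right]
  refine le_iInf₂ fun g hg => le_iInf₂ fun G hG => ?_
  rw [tsub_le_iff_right, ENNReal.div_le_iff_le_mul (Or.inl hC0) (Or.inl hC1), mul_comm]
  exact key g hg G hG

end Conclusion

end NewtonHalfSpace

end

theorem theorem5p3 (d m μ : ℕ) (hμ : μ < m)
    (A : ℕ → MvPolynomial (Fin (d + 1)) ℂ)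
    (hA : ∀ j ∈ Finset.Icc (2 * μ) (2 * m), (A j).IsHomogeneous j)
    (hell : NewtonHalfSpace.NElliptic m μ A)
    (hreg : NewtonHalfSpace.DegeneratesRegularly m μ A)
    (hroots : d + 1 ≤ 2 → NewtonHalfSpace.ProperlyElliptic m μ A)
    (lam0 : ℝ) (hlam0 : 0 < lam0) :
    ∃ C : ℝ, 0 < C ∧ ∀ lam : ℝ, lam0 ≤ lam → ∀ u : 𝓢'(NewtonHalfSpace.Rn (d + 1), ℂ),
      NewtonHalfSpace.MemSobolevSpace (NewtonHalfSpace.Xi m μ 0 lam) u →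
      NewtonHalfSpace.halfSpaceXiNorm m μ lam u ≤
        ENNReal.ofReal C *
          (NewtonHalfSpace.quotientNorm (fun ξ => (NewtonHalfSpace.Xi m μ 0 lam ξ)⁻¹)
              (NewtonHalfSpace.pencil m μ A lam u)
            + ∑ j ∈ Finset.Icc 1 m,
                NewtonHalfSpace.traceNorm
                  (NewtonHalfSpace.XiReal m μ ((j : ℝ) - 1 / 2) lam)
                  ((NewtonHalfSpace.D (Fin.last d) ^ (j - 1)) u)
            + ENNReal.ofReal (lam ^ (m - μ)) * NewtonHalfSpace.halfSpaceL2Norm u) := by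
  have hprop : NewtonHalfSpace.ProperlyElliptic m μ A := by
    by_cases hd : d + 1 ≤ 2
    · exact hroots hd
    · exact NewtonHalfSpace.properlyElliptic_of_two_le hA hμ hell (by omega)
  obtain ⟨C, hC, h⟩ :=
    NewtonHalfSpace.exists_quotientNorm_estimate hA hμ hell hreg hprop hlam0
  refine ⟨C, hC, fun lam hlam u hu => (h lam hlam u hu).trans (le_of_eq ?_)⟩
  -- Index shift j = i + 1 between orders of derivatives and numbers of boundary conditions.
  rw [Finset.range_eq_Ico, show Finset.Icc 1 m = Finset.Ico (0 + 1) (m + 1) from rfl,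
    ← Finset.sum_Ico_add']
  simp only [Nat.add_sub_cancel]
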